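/- Let $G=PSL_2(\mathbb R)$, and in $\mathfrak g=\mathfrak{sl}_2(\mathbb R)$ put $\Xi=\frac12\begin{pmatrix}0&1\\-1&0\end{pmatrix}$, $H=\frac12\begin{pmatrix}1&0\\0&-1\end{pmatrix}$, $B=\frac12\begin{pmatrix}0&1\\1&0\end{pmatrix}$, $\Omega=4\Xi^2-4H^2-4B^2$. Let $\pi$ be a (strongly continuous) irreducible unitary representation of $G$ on a complex Hilbert space $\mathcal H_\pi$, and let $\lambda_\pi$ be the scalar by which $\Omega$ acts on the smooth vectors. We call $\pi$ a principal series representation if $\lambda_\pi=1+s^2$ with $s\in\mathbb R$, a complementary series representation if $\lambda_\pi=1-s^2$ with $s\in(-1,1)\setminus\{0\}$, and a discrete series representation if $\pi$ is not the trivial representation and $\lambda_\pi=1-(2n-1)^2$ with an integer $n\ge1$ (by the classification of the irreducible unitary representations of $G$ these are exactly the usual series). For $x\in\mathbb C$ let $T_\pi(x)=-\Xi^2+xH$ be the closed operator on $\mathcal H_\pi$ with domain $\{u\in\mathcal H_\pi\mid T_\pi(x)u\in\mathcal H_\pi\}$, where $T_\pi(x)u$ is understood in the sense of distributions (as a functional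 on the smooth vectors), and let $\sigma(T_\pi(x))$ be its spectrum. (i) Let $\pi$ be a principal or complementary series representation and $r_\pi=(\lambda_\pi+6)^{-1/2}$. Then there is a holomorphic function $\mu\colon\{x\in\mathbb C:|x|<r_\pi\}\to\mathbb C$ such that for all $x\in\mathbb C$ with $|x|<r_\pi$: $\mu(x)$ is an eigenvalue of $T_\pi(x)$ of (algebraic) multiplicity $1$, $|\mu(x)|\le\frac12$, $$\sigma(T_\pi(x))\cap\{\zeta\in\mathbb C\mid \operatorname{Re}\zeta\le\tfrac12\}=\{\mu(x)\},$$ and $$\Bigl|\mu(x)-\frac{\lambda_\pi}{8}x^2\Bigr|\le\frac{|x|^3}{2r_\pi^2\,(r_\pi-|x|)}.$$ (ii) Let $\pi$ be a discrete series representation. Then every $\zeta\in\sigma(T_\pi(x))$ satisfies $\operatorname{Re}\zeta>\frac12$, for all $x\in\mathbb C$ with $|x|<1/\sqrt{32}$. -/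

import Mathlib

open scoped MatrixGroups ComplexConjugate

noncomputable section

namespace KineticBrownian

/-! ### The group `PSL₂(ℝ)`, its Lie algebra and the exponential map -/

/-- The Lie algebra `𝔰𝔩₂(ℝ)` of real `2 × 2` matrices of trace zero. -/
abbrev sl2 : Type := LieAlgebra.SpecialLinear.sl (Fin 2) ℝ

lemma mem_sl2_iff (X : Matrix (Fin 2) (Fin 2) ℝ) :
    X ∈ LieAlgebra.SpecialLinear.sl (Fin 2) ℝ ↔ X 0 0 + X 1 1 = 0 := by
  rw [← Matrix.trace_fin_two]
  exact LinearMap.mem_ker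

/-- `Ξ = ½ (0 1; -1 0)`, the generator of rotations. -/
def Xi : sl2 := ⟨!![0, 1 / 2; -(1 / 2), 0], (mem_sl2_iff _).2 (by simp)⟩

/-- `H = ½ (1 0; 0 -1)`, the generator of the geodesic flow. -/
def Hg : sl2 := ⟨!![1 / 2, 0; 0, -(1 / 2)], (mem_sl2_iff _).2 (by simp)⟩

/-- `B = ½ (0 1; 1 0)`. -/
def Bg : sl2 := ⟨!![0, 1 / 2; 1 / 2, 0], (mem_sl2_iff _).2 (by simp)⟩

section
open scoped Matrix.Norms.Operator

lemma det_exp_sl2 (X : sl2) : (NormedSpace.exp (X : Matrix (Fin 2) (Fin 2) ℝ)).det = 1 := by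
  obtain ⟨A, hX⟩ := X
  have htr : A 0 0 + A 1 1 = 0 := (mem_sl2_iff A).1 hX
  set M : ℝ → Matrix (Fin 2) (Fin 2) ℝ := fun t => NormedSpace.exp (t • A) with hM
  have hd : ∀ t, HasDerivAt M (A * M t) t := fun t => hasDerivAt_exp_smul_const' A t
  have hij : ∀ (i j : Fin 2) (t : ℝ), HasDerivAt (fun s => M s i j) ((A * M t) i j) t := by
    intro i j t
    exact hasDerivAt_pi.1 (hasDerivAt_pi.1 (hd t) i) j
  have hdet : ∀ t, HasDerivAt (fun s => (M s).det) 0 t := by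
    intro t
    have h := ((hij 0 0 t).mul (hij 1 1 t)).sub ((hij 0 1 t).mul (hij 1 0 t))
    have h0 : (A * M t) 0 0 * M t 1 1 + M t 0 0 * (A * M t) 1 1
        - ((A * M t) 0 1 * M t 1 0 + M t 0 1 * (A * M t) 1 0) = 0 := by
      simp only [Matrix.mul_apply, Fin.sum_univ_two]
      linear_combination (M t 0 0 * M t 1 1 - M t 0 1 * M t 1 0) * htr
    rw [h0] at h
    refine h.congr_of_eventuallyEq (Filter.Eventually.of_forall fun s => ?_)
    simp [Matrix.det_fin_two]
  have hc := is_const_of_deriv_eq_zero (fun t => (hdet t).differentiableAt)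
    (fun t => (hdet t).deriv) 1 0
  simpa [hM] using hc

end

/-- The exponential map `𝔰𝔩₂(ℝ) → PSL₂(ℝ)`: the matrix exponential, modulo the centre `{±1}`. -/
def expG (X : sl2) : PSL(2, ℝ) :=
  QuotientGroup.mk (⟨NormedSpace.exp (X : Matrix (Fin 2) (Fin 2) ℝ), det_exp_sl2 X⟩ : SL(2, ℝ))

/-! ### Unitary representations -/

/-- A (strongly continuous) unitary representation of `PSL₂(ℝ)` on the complex Hilbert space `V`. -/
structure UnitaryRep (V : Type*) [NormedAddCommGroup V] [InnerProductSpace ℂ V] where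
  /-- the homomorphism into the group of unitary operators -/
  toHom : PSL(2, ℝ) →* (V ≃ₗᵢ[ℂ] V)
  /-- strong continuity -/
  continuous_orbit : ∀ u : V, Continuous fun g => toHom g u

namespace UnitaryRep

variable {V : Type*} [NormedAddCommGroup V] [InnerProductSpace ℂ V]

/-- Irreducibility: `V ≠ 0`, and the only closed invariant subspaces are `0` and `V`. -/
def IsIrreducible (π : UnitaryRep V) : Prop :=
  Nontrivial V ∧ ∀ W : Submodule ℂ V, IsClosed (W : Set V) →
    (∀ g, ∀ u ∈ W, π.toHom g u ∈ W) → W = ⊥ ∨ W = ⊤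

/-- `G` acts by the identity. -/
def IsTrivial (π : UnitaryRep V) : Prop := ∀ g u, π.toHom g u = u

/-- The `n` times differentiable vectors: every vector is `0` times differentiable, and `u` is `n+1`
times differentiable if for every `X` in the Lie algebra the derivative of `t ↦ π(exp tX)u` at `0`
exists and is `n` times differentiable. -/
def diffVectors (π : UnitaryRep V) : ℕ → Submodule ℂ V
  | 0 => ⊤
  | n + 1 =>
    { carrier := {u | ∀ X : sl2, ∃ w ∈ diffVectors π n,
        HasDerivAt (fun t : ℝ => π.toHom (expG (t • X)) u) w 0}
      zero_mem' := fun X => ⟨0, Submodule.zero_mem _, by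
        simpa using hasDerivAt_const (0 : ℝ) (0 : V)⟩
      add_mem' := by
        intro a b ha hb X
        obtain ⟨w, hw, h⟩ := ha X
        obtain ⟨w', hw', h'⟩ := hb X
        exact ⟨w + w', Submodule.add_mem _ hw hw', by
          simpa [Pi.add_def] using h.add h'⟩
      smul_mem' := by
        intro c a ha X
        obtain ⟨w, hw, h⟩ := ha X
        exact ⟨c • w, Submodule.smul_mem _ c hw, by
          simpa [Pi.smul_def] using h.const_smul c⟩ }

/-- The space `C^∞(V)` of smooth vectors of `π`. -/
def smooth (π : UnitaryRep V) : Submodule ℂ V := ⨅ n, π.diffVectors n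

lemma hasDerivAt_of_smooth (π : UnitaryRep V) (X : sl2) {u : V} (hu : u ∈ π.smooth) :
    HasDerivAt (fun t : ℝ => π.toHom (expG (t • X)) u)
      (deriv (fun t : ℝ => π.toHom (expG (t • X)) u) 0) 0 := by
  obtain ⟨w, -, h⟩ := (Submodule.mem_iInf _).1 hu 1 X
  exact h.differentiableAt.hasDerivAt

lemma deriv_mem_smooth (π : UnitaryRep V) (X : sl2) {u : V} (hu : u ∈ π.smooth) :
    deriv (fun t : ℝ => π.toHom (expG (t • X)) u) 0 ∈ π.smooth := by
  refine (Submodule.mem_iInf _).2 fun n => ?_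
  obtain ⟨w, hw, h⟩ := (Submodule.mem_iInf _).1 hu (n + 1) X
  rwa [h.deriv]

/-- The derived representation of the Lie algebra on smooth vectors,
`dπ(X) u = d/dt|₀ π(exp tX) u`. -/
def dpi (π : UnitaryRep V) (X : sl2) : Module.End ℂ π.smooth where
  toFun u := ⟨deriv (fun t : ℝ => π.toHom (expG (t • X)) (u : V)) 0, π.deriv_mem_smooth X u.2⟩
  map_add' u v := by
    ext
    simpa [Pi.add_def] using ((π.hasDerivAt_of_smooth X u.2).add (π.hasDerivAt_of_smooth X v.2)).deriv
  map_smul' c u := by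
    ext
    simpa [Pi.smul_def] using ((π.hasDerivAt_of_smooth X u.2).const_smul c).deriv

/-- The Casimir element `Ω = 4Ξ² - 4H² - 4B²` acting on smooth vectors. -/
def casimir (π : UnitaryRep V) : Module.End ℂ π.smooth :=
  (4 : ℂ) • π.dpi Xi ^ 2 - (4 : ℂ) • π.dpi Hg ^ 2 - (4 : ℂ) • π.dpi Bg ^ 2

/-- `Ω` acts as the scalar `lam`; for irreducible `π` this determines the number `λ_π`. -/
def HasCasimirScalar (π : UnitaryRep V) (lam : ℝ) : Prop :=
  π.casimir = (lam : ℂ) • (1 : Module.End ℂ π.smooth)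

/-- `π` is the principal series representation `π_{is}`: it is irreducible with `Ω = 1 + s²`.
(Irreducible unitary representations are classified by the Casimir scalar, up to the choice of sign
in the discrete series and the trivial representation; that all `K`-types `k ∈ ℤ` occur here is a
consequence.) -/
def IsPrincipalSeries (π : UnitaryRep V) (s : ℝ) : Prop :=
  π.IsIrreducible ∧ π.HasCasimirScalar (1 + s ^ 2)

/-- `π` is the complementary series representation `π_s`, `s ∈ (-1,1) \ {0}`: it is irreducible with
`Ω = 1 - s²`. -/
def IsComplementarySeries (π : UnitaryRep V) (s : ℝ) : Prop :=
  s ∈ Set.Ioo (-1 : ℝ) 1 ∧ s ≠ 0 ∧ π.IsIrreducible ∧ π.HasCasimirScalar (1 - s ^ 2)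

/-- `π` is one of the discrete series representations `π^±_{±2n}`, `n ≥ 1`: it is irreducible, not
the trivial representation, and `Ω = 1 - (2n-1)²`. The last two conditions do not follow from each
other only for `n = 1`, where the trivial representation has the same Casimir scalar `0`. -/
def IsDiscreteSeries (π : UnitaryRep V) (n : ℕ) : Prop :=
  1 ≤ n ∧ π.IsIrreducible ∧ ¬ π.IsTrivial ∧ π.HasCasimirScalar (1 - (2 * (n : ℝ) - 1) ^ 2)

/-- The differential expression `-Ξ² + xH` on smooth vectors. -/
def formalT (π : UnitaryRep V) (x : ℂ) : Module.End ℂ π.smooth :=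
  -(π.dpi Xi ^ 2) + x • π.dpi Hg

/-- The same as a partially defined operator on `V` with domain the smooth vectors. -/
def formalTPMap (π : UnitaryRep V) (x : ℂ) : V →ₗ.[ℂ] V where
  domain := π.smooth
  toFun := π.smooth.subtype ∘ₗ π.formalT x

/-- The operator `T_π(x) = -Ξ² + xH` on its maximal domain `{u ∈ V | T_π(x) u ∈ V}`, where
`T_π(x) u` is understood in the sense of distributions, i.e. as a functional on the smooth vectors.
As `Ξ` and `H` are skew-symmetric, the formal adjoint of `-Ξ² + xH` is `-Ξ² - x̄H`. So `u` lies
in the domain with `T_π(x) u = w` iff `⟪w, v⟫ = ⟪u, (-Ξ² - x̄H) v⟫` for all smooth `v`, i.e.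
`T_π(x)` is the Hilbert space adjoint of `-Ξ² - x̄H` on the (dense) space of smooth vectors. -/
def T [CompleteSpace V] (π : UnitaryRep V) (x : ℂ) : V →ₗ.[ℂ] V :=
  (π.formalTPMap (-conj x)).adjoint

end UnitaryRep

/-! ### Spectrum and multiplicity for unbounded operators -/

section Spectrum

variable {V : Type*} [NormedAddCommGroup V] [NormedSpace ℂ V]

/-- The resolvent set: `T - ζ` is a bijection from the domain of `T` onto `V` with bounded
inverse `R`. -/
def resolventSet (T : V →ₗ.[ℂ] V) : Set ℂ :=
  {ζ | ∃ R : V →L[ℂ] V, (∀ w, ∃ h : R w ∈ T.domain, T ⟨R w, h⟩ - ζ • R w = w) ∧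
    ∀ u : T.domain, R (T u - ζ • (u : V)) = u}

/-- The spectrum of an unbounded operator. -/
def spec (T : V →ₗ.[ℂ] V) : Set ℂ := (resolventSet T)ᶜ

/-- `ker (T - ζ)^n`, with the natural domain of `(T - ζ)^n`. -/
def kerPow (T : V →ₗ.[ℂ] V) (ζ : ℂ) : ℕ → Submodule ℂ V
  | 0 => ⊥
  | n + 1 =>
    { carrier := {u | ∃ h : u ∈ T.domain, T ⟨u, h⟩ - ζ • u ∈ kerPow T ζ n}
      zero_mem' := ⟨T.domain.zero_mem, by
        have h0 : T ⟨0, T.domain.zero_mem⟩ = 0 := T.map_zero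
        rw [h0]; simp⟩
      add_mem' := by
        rintro a b ⟨ha, ha'⟩ ⟨hb, hb'⟩
        refine ⟨T.domain.add_mem ha hb, ?_⟩
        have h0 : T ⟨a + b, T.domain.add_mem ha hb⟩ = T ⟨a, ha⟩ + T ⟨b, hb⟩ :=
          T.map_add ⟨a, ha⟩ ⟨b, hb⟩
        rw [h0]
        convert Submodule.add_mem _ ha' hb' using 1
        rw [smul_add]; abel
      smul_mem' := by
        rintro c a ⟨ha, ha'⟩
        refine ⟨T.domain.smul_mem c ha, ?_⟩
        have h0 : T ⟨c • a, T.domain.smul_mem c ha⟩ = c • T ⟨a, ha⟩ := T.map_smul c ⟨a, ha⟩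
        rw [h0]
        convert Submodule.smul_mem _ c ha' using 1
        rw [smul_sub, smul_comm] }

/-- `ζ` is an eigenvalue of `T` of (algebraic, hence also geometric) multiplicity one: it has an
eigenvector, and the generalized eigenspace `⋃ n, ker (T - ζ)^n` is one-dimensional. -/
def IsSimpleEigenvalue (T : V →ₗ.[ℂ] V) (ζ : ℂ) : Prop :=
  (∃ u : T.domain, (u : V) ≠ 0 ∧ T u = ζ • (u : V)) ∧
    Module.finrank ℂ (⨆ n, kerPow T ζ n : Submodule ℂ V) = 1

end Spectrum

end KineticBrownian

end

/-! The rotation group generated by `Xi` splits `V` into weight spaces, indexed by integers `k`, on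
which `-Ξ²` is `k²`. The operators `H ± iB` move weight `k` to `k ± 1`, and the Casimir scalar fixes
their size: `‖(H + eiB)v‖² = (k² + ek + λ/4)‖v‖²` for `e = ±1` (`norm_sq_ladder`). Everything rests
on this tridiagonal picture and on the weight `0` space, the only place where `-Ξ²` has spectrum
below `1`.

Weight `0`. If `λ > 0`, stepping down the ladder produces a `K`-fixed unit vector `φ`. It is unique
up to scalars: a matrix coefficient of two orthogonal fixed vectors solves a radial ODE with zero
initial data, hence vanishes on the group by the Cartan decomposition (`spherical_eq_zero`). If `λ ≤
0` and the representation is nontrivial, there is no fixed vector (`projK_zero_eq_zero`).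

Off weight `0`. There `-Ξ² ≥ 1`, and the Casimir identity bounds `H` relative to `-Ξ² - ζ` uniformly
for `Re ζ ≤ 1/2` (`norm_sq_Hg_le`), so the compression of `T(x) - ζ` has a bounded inverse `R(x, ζ)`
(`RelBounded.isUnit_pencil`). In the discrete series this is the whole operator and (ii) follows.
For `λ > 0` a weighted Cauchy–Schwarz estimate on the off-diagonal terms (`norm_inner_Hg_le`) gives
`‖R(x, ζ)‖ ≤ 5/2` when `|x|²(λ + 6) ≤ 1`.

Schur complement. Eliminating the part off `φ` shows that, in the half plane, `ζ` is in the spectrum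
iff `ζ = x² ⟪Hφ, R(x, ζ)Hφ⟫` (`weakSol_iff_schur`). Since `‖Hφ‖² = λ/8`, the right side has modulus
at most `5/16` and Lipschitz constant at most `25/32` in `ζ`, so it has a unique fixed point `μ(x)`,
holomorphic as a uniform limit of iterates. Lipschitz constant below `1` also excludes Jordan
blocks. Finally `μ(x) = x² g(x)` with `g(0) = λ/8`, and the Schwarz lemma applied to `g - g(0)`
gives the asymptotics. -/

noncomputable section

namespace KineticBrownian

/-! ### Relatively bounded perturbations and their resolvents -/

section RelativeBound

open scoped InnerProductSpace

variable {E D : Type*} [NormedAddCommGroup E] [InnerProductSpace ℂ E]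
  [AddCommGroup D] [Module ℂ D]

/-- `N` is an unbounded operator on `E` (with domain `D`, included by `ι`) whose translates
`N - ζ`, `Re ζ ≤ 1/2`, have dense range and dominate `H` with relative bound `C`. -/
structure RelBounded (ι N H : D →ₗ[ℂ] E) (C : ℝ) : Prop where
  dense : ∀ ζ : ℂ, ζ.re ≤ 1 / 2 → DenseRange (N - ζ • ι)
  bound : ∀ ζ : ℂ, ζ.re ≤ 1 / 2 → ∀ v, ‖H v‖ ≤ C * ‖N v - ζ • ι v‖
  bound_self : ∀ ζ : ℂ, ζ.re ≤ 1 / 2 → ∀ v, ‖N v‖ ≤ 2 * ‖N v - ζ • ι v‖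
  bound_incl : ∀ v, ‖ι v‖ ≤ 2 * ‖N v‖

namespace RelBounded

variable {ι N H : D →ₗ[ℂ] E} {C : ℝ}

lemma denseRange (h : RelBounded ι N H C) : DenseRange N := by
  simpa using h.dense 0 (by norm_num)

lemma lower_bound (h : RelBounded ι N H C) {x ζ : ℂ} (hζ : ζ.re ≤ 1 / 2) (v : D) :
    (1 - ‖x‖ * C) * ‖N v - ζ • ι v‖ ≤ ‖N v + x • H v - ζ • ι v‖ := by
  have h1 : ‖N v - ζ • ι v‖ ≤ ‖N v + x • H v - ζ • ι v‖ + ‖x • H v‖ := by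
    have := norm_sub_le (N v + x • H v - ζ • ι v) (x • H v)
    rwa [show N v + x • H v - ζ • ι v - x • H v = N v - ζ • ι v by abel] at this
  rw [norm_smul] at h1
  nlinarith [mul_le_mul_of_nonneg_left (h.bound ζ hζ v) (norm_nonneg x)]

variable [CompleteSpace E]

/-- The bounded extension of `N v ↦ ι v`. -/
def inv (_ : RelBounded ι N H C) : E →L[ℂ] E := ι.extendOfNorm N

/-- The bounded extension of `N v ↦ H v`. -/
def rel (_ : RelBounded ι N H C) : E →L[ℂ] E := H.extendOfNorm N

lemma inv_apply (h : RelBounded ι N H C) (v : D) : h.inv (N v) = ι v :=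
  LinearMap.extendOfNorm_eq h.denseRange ⟨2, h.bound_incl⟩ v

lemma rel_apply (h : RelBounded ι N H C) (v : D) : h.rel (N v) = H v :=
  LinearMap.extendOfNorm_eq h.denseRange ⟨C, fun v => by simpa using h.bound 0 (by norm_num) v⟩ v

/-- The bounded operator `(N + xH - ζ) N⁻¹`. -/
def pencil (h : RelBounded ι N H C) (x ζ : ℂ) : E →L[ℂ] E := 1 + x • h.rel - ζ • h.inv

lemma pencil_apply (h : RelBounded ι N H C) (x ζ : ℂ) (v : D) :
    h.pencil x ζ (N v) = N v + x • H v - ζ • ι v := by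
  simp [pencil, h.inv_apply, h.rel_apply]

/-- The perturbation `xH` has relative bound `‖x‖ * C < 1` with respect to `N - ζ`. This yields both
a lower bound and the density of the range, and the two together give bijectivity. -/
lemma isUnit_pencil (h : RelBounded ι N H C) {x ζ : ℂ} (hx : ‖x‖ * C < 1) (hζ : ζ.re ≤ 1 / 2) :
    IsUnit (h.pencil x ζ) := by
  set q := 1 - ‖x‖ * C with hq
  have hq0 : 0 < q := by linarith
  have hlow : ∀ y : E, (q / 2) * ‖y‖ ≤ ‖h.pencil x ζ y‖ := by
    have hcl : IsClosed {y : E | (q / 2) * ‖y‖ ≤ ‖h.pencil x ζ y‖} :=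
      isClosed_le (by fun_prop) (by fun_prop)
    refine fun y => h.denseRange.induction_on (p := fun y => (q / 2) * ‖y‖ ≤ ‖h.pencil x ζ y‖)
      y hcl fun v => ?_
    rw [h.pencil_apply]
    refine le_trans ?_ (h.lower_bound hζ v)
    nlinarith [h.bound_self ζ hζ v]
  have hanti : AntilipschitzWith (Real.toNNReal (2 / q)) (h.pencil x ζ) := by
    refine ContinuousLinearMap.antilipschitz_of_bound _ fun y => ?_
    rw [Real.coe_toNNReal _ (by positivity)]
    have := hlow y
    rw [div_mul_eq_mul_div, le_div_iff₀ hq0]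
    linarith
  have hdense : (LinearMap.range (h.pencil x ζ).toLinearMap).topologicalClosure = ⊤ := by
    rw [Submodule.topologicalClosure_eq_top_iff, Submodule.eq_bot_iff]
    intro w hw
    have hw' : ∀ v, ⟪w, N v - ζ • ι v⟫_ℂ = -⟪w, x • H v⟫_ℂ := by
      intro v
      have := (Submodule.mem_orthogonal' _ _).1 hw (h.pencil x ζ (N v)) ⟨N v, rfl⟩
      rw [h.pencil_apply] at this
      rw [← add_eq_zero_iff_eq_neg, ← inner_add_right, ← this]
      congr 1
      abel
    -- A vector `w` orthogonal to the range turns `N - ζ` into `-xH` under the pairing. The vectors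
    -- `y = (N - ζ)v` are dense, and `y = w` then forces `w = 0`.
    have hb : ∀ y : E, ‖⟪w, y⟫_ℂ‖ ≤ (‖x‖ * C) * ‖w‖ * ‖y‖ := by
      have hcl : IsClosed {y : E | ‖⟪w, y⟫_ℂ‖ ≤ (‖x‖ * C) * ‖w‖ * ‖y‖} :=
        isClosed_le (by fun_prop) (by fun_prop)
      refine fun y => (h.dense ζ hζ).induction_on
        (p := fun y => ‖⟪w, y⟫_ℂ‖ ≤ (‖x‖ * C) * ‖w‖ * ‖y‖) y hcl fun v => ?_
      simp only [LinearMap.sub_apply, LinearMap.smul_apply]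
      rw [hw' v, norm_neg]
      refine (norm_inner_le_norm _ _).trans ?_
      rw [norm_smul]
      calc ‖w‖ * (‖x‖ * ‖H v‖) ≤ ‖w‖ * (‖x‖ * (C * ‖N v - ζ • ι v‖)) := by
            gcongr; exact h.bound ζ hζ v
        _ = _ := by ring
    have := hb w
    rw [inner_self_eq_norm_sq_to_K] at this
    simp only [Complex.coe_algebraMap, norm_pow, Complex.norm_real, norm_norm] at this
    by_contra hne
    have : 0 < ‖w‖ := norm_pos_iff.2 hne
    nlinarith [mul_pos (mul_pos this this) hq0]
  rw [ContinuousLinearMap.isUnit_iff_bijective,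
    ContinuousLinearMap.bijective_iff_dense_range_and_antilipschitz]
  exact ⟨hdense, _, hanti⟩

/-- The resolvent `(N + xH - ζ)⁻¹`, in the sense of the weak formulation
`inner_eq_iff_eq_resolvent`. -/
def resolvent (h : RelBounded ι N H C) (x ζ : ℂ) : E →L[ℂ] E :=
  Ring.inverse (1 - x • star h.rel - ζ • star h.inv) * star h.inv

lemma star_pencil (h : RelBounded ι N H C) (x ζ : ℂ) :
    star (h.pencil (-conj x) (conj ζ)) = 1 - x • star h.rel - ζ • star h.inv := by
  simp [pencil, sub_eq_add_neg]

lemma isUnit_star_pencil (h : RelBounded ι N H C) {x ζ : ℂ} (hx : ‖x‖ * C < 1)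
    (hζ : ζ.re ≤ 1 / 2) : IsUnit (1 - x • star h.rel - ζ • star h.inv) := by
  rw [← h.star_pencil, isUnit_star]
  exact h.isUnit_pencil (by simpa using hx) (by simpa using hζ)

/-- The operator of interest is the adjoint of `N - x̄H - ζ̄`. Factoring the latter as a pencil
composed with `N` and taking adjoints leaves an equation between bounded operators, equivalent to
the weak one because `N` has dense range. -/
lemma inner_eq_iff_eq_resolvent (h : RelBounded ι N H C) {x ζ : ℂ} (hx : ‖x‖ * C < 1)
    (hζ : ζ.re ≤ 1 / 2) (u w : E) :
    (∀ v, ⟪w, ι v⟫_ℂ = ⟪u, N v - conj x • H v - conj ζ • ι v⟫_ℂ) ↔ u = h.resolvent x ζ w := by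
  have hU := h.isUnit_star_pencil hx hζ
  have h1 : (∀ v, ⟪w, ι v⟫_ℂ = ⟪u, N v - conj x • H v - conj ζ • ι v⟫_ℂ) ↔
      star h.inv w = (1 - x • star h.rel - ζ • star h.inv) u := by
    have h2 : ∀ v, ⟪u, N v - conj x • H v - conj ζ • ι v⟫_ℂ =
        ⟪(1 - x • star h.rel - ζ • star h.inv) u, N v⟫_ℂ := by
      intro v
      rw [← h.star_pencil, ContinuousLinearMap.star_eq_adjoint,
        ContinuousLinearMap.adjoint_inner_left, h.pencil_apply, neg_smul, ← sub_eq_add_neg]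
    have h3 : ∀ v, ⟪w, ι v⟫_ℂ = ⟪star h.inv w, N v⟫_ℂ := by
      intro v
      rw [ContinuousLinearMap.star_eq_adjoint, ContinuousLinearMap.adjoint_inner_left, h.inv_apply]
    simp_rw [h2, h3]
    constructor
    · intro h4
      refine ext_inner_right ℂ fun y => ?_
      exact h.denseRange.induction_on
        (p := fun y => ⟪star h.inv w, y⟫_ℂ = ⟪(1 - x • star h.rel - ζ • star h.inv) u, y⟫_ℂ)
        y (isClosed_eq (by fun_prop) (by fun_prop)) h4
    · intro h4 v
      rw [h4]
  rw [h1, resolvent]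
  constructor
  · intro h4
    rw [mul_apply_eq_comp, h4, ← mul_apply_eq_comp,
      Ring.inverse_mul_cancel _ hU, one_apply_eq_self]
  · rintro rfl
    rw [← mul_apply_eq_comp, ← mul_assoc, Ring.mul_inverse_cancel _ hU, one_mul]

lemma inner_resolvent (h : RelBounded ι N H C) {x ζ : ℂ} (hx : ‖x‖ * C < 1)
    (hζ : ζ.re ≤ 1 / 2) (w : E) (v : D) :
    ⟪h.resolvent x ζ w, N v - conj x • H v - conj ζ • ι v⟫_ℂ = ⟪w, ι v⟫_ℂ :=
  ((h.inner_eq_iff_eq_resolvent hx hζ _ w).2 rfl v).symm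

lemma differentiableOn_resolvent (h : RelBounded ι N H C) {U : Set ℂ} {f : ℂ → ℂ}
    (hf : DifferentiableOn ℂ f U) (hU : ∀ x ∈ U, ‖x‖ * C < 1 ∧ (f x).re ≤ 1 / 2) :
    DifferentiableOn ℂ (fun x => h.resolvent x (f x)) U := by
  intro x hx
  obtain ⟨h1, h2⟩ := hU x hx
  refine DifferentiableWithinAt.mul ?_ (differentiableWithinAt_const _)
  refine DifferentiableWithinAt.inverse ?_ (h.isUnit_star_pencil h1 h2)
  exact ((differentiableWithinAt_const _).sub (differentiableWithinAt_id.smul_const _)).sub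
    ((hf x hx).smul_const _)

lemma resolvent_sub_resolvent (h : RelBounded ι N H C) {x ζ η : ℂ} (hx : ‖x‖ * C < 1)
    (hζ : ζ.re ≤ 1 / 2) (hη : η.re ≤ 1 / 2) (w : E) :
    h.resolvent x ζ w - h.resolvent x η w
      = (ζ - η) • h.resolvent x ζ (h.resolvent x η w) := by
  have : h.resolvent x η w = h.resolvent x ζ (w - (ζ - η) • h.resolvent x η w) := by
    rw [← h.inner_eq_iff_eq_resolvent hx hζ]
    intro v
    have e : N v - conj x • H v - conj ζ • ι v
        = (N v - conj x • H v - conj η • ι v) - (conj ζ - conj η) • ι v := by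
      rw [sub_smul]; abel
    rw [e, inner_sub_right, h.inner_resolvent hx hη, inner_sub_left, inner_smul_left,
      inner_smul_right]
    simp
  rw [map_sub, map_smul] at this
  rw [sub_eq_iff_eq_add, add_comm, ← sub_eq_iff_eq_add, ← this]

/-- A Lax–Milgram bound: coercivity of the formal adjoint controls `ι v` by its image, these images
are dense, and duality passes the estimate to the resolvent. -/
lemma norm_resolvent_le (h : RelBounded ι N H C) {x ζ : ℂ} (hx : ‖x‖ * C < 1)
    (hζ : ζ.re ≤ 1 / 2) {δ : ℝ} (hδ : 0 < δ)
    (hco : ∀ v, δ * ‖ι v‖ ^ 2 ≤ (⟪ι v, N v - conj x • H v - conj ζ • ι v⟫_ℂ).re) (w : E) :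
    ‖h.resolvent x ζ w‖ ≤ δ⁻¹ * ‖w‖ := by
  set u := h.resolvent x ζ w
  have hco' : ∀ v, ‖ι v‖ ≤ δ⁻¹ * ‖N v - conj x • H v - conj ζ • ι v‖ := by
    intro v
    rcases eq_or_lt_of_le (norm_nonneg (ι v)) with h0 | h0
    · rw [← h0]; positivity
    have := (hco v).trans ((Complex.re_le_norm _).trans (norm_inner_le_norm _ _))
    rw [inv_mul_eq_div, le_div_iff₀ hδ]
    nlinarith
  have hd : DenseRange fun v => h.pencil (-conj x) (conj ζ) (N v) := by
    have := (ContinuousLinearMap.isUnit_iff_bijective.1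
      (h.isUnit_pencil (x := -conj x) (ζ := conj ζ) (by simpa using hx) (by simpa using hζ))).2
    exact this.denseRange.comp h.denseRange (ContinuousLinearMap.continuous _)
  have hb : ∀ y : E, ‖⟪u, y⟫_ℂ‖ ≤ δ⁻¹ * ‖w‖ * ‖y‖ := by
    refine fun y => hd.induction_on (p := fun y => ‖⟪u, y⟫_ℂ‖ ≤ δ⁻¹ * ‖w‖ * ‖y‖) y
      (isClosed_le (by fun_prop) (by fun_prop)) fun v => ?_
    have e : h.pencil (-conj x) (conj ζ) (N v) = N v - conj x • H v - conj ζ • ι v := by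
      rw [h.pencil_apply, neg_smul, ← sub_eq_add_neg]
    rw [e, h.inner_resolvent hx hζ]
    refine (norm_inner_le_norm _ _).trans ?_
    calc ‖w‖ * ‖ι v‖ ≤ ‖w‖ * (δ⁻¹ * ‖N v - conj x • H v - conj ζ • ι v‖) := by
          gcongr; exact hco' v
      _ = _ := by ring
  have := hb u
  rw [inner_self_eq_norm_sq_to_K] at this
  simp only [Complex.coe_algebraMap, norm_pow, Complex.norm_real, norm_norm] at this
  rcases eq_or_lt_of_le (norm_nonneg u) with h0 | h0
  · rw [← h0]; positivity
  · nlinarith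

end RelBounded

end RelativeBound

/-! ### Holomorphic fixed points of a family of contractions -/

section FixedPoint

/-- A family of contractions of the half plane `Re ζ ≤ 1/2`, depending holomorphically on a
parameter, has a holomorphic family of fixed points. -/
lemma exists_differentiableOn_fixedPoint {U : Set ℂ} (hU : IsOpen U) (F : ℂ → ℂ → ℂ) {κ : ℝ}
    (hκ0 : 0 ≤ κ) (hκ : κ < 1)
    (hF : ∀ x ∈ U, ∀ ζ : ℂ, ζ.re ≤ 1 / 2 → ‖F x ζ‖ ≤ 1 / 2)
    (hL : ∀ x ∈ U, ∀ ζ η : ℂ, ζ.re ≤ 1 / 2 → η.re ≤ 1 / 2 → ‖F x ζ - F x η‖ ≤ κ * ‖ζ - η‖)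
    (hD : ∀ f : ℂ → ℂ, DifferentiableOn ℂ f U → (∀ x ∈ U, (f x).re ≤ 1 / 2) →
      DifferentiableOn ℂ (fun x => F x (f x)) U) :
    ∃ μ : ℂ → ℂ, DifferentiableOn ℂ μ U ∧ ∀ x ∈ U, ‖μ x‖ ≤ 1 / 2 ∧ F x (μ x) = μ x ∧
      ∀ ζ : ℂ, ζ.re ≤ 1 / 2 → F x ζ = ζ → ζ = μ x := by
  -- Picard iteration from `0`. Each iterate is holomorphic and stays in the disc of radius `1/2`,
  -- inside the half plane; the first step has length at most `1/2`, which gives the geometric bound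
  -- below.
  let m : ℕ → ℂ → ℂ := fun n => Nat.rec (fun _ => 0) (fun _ f x => F x (f x)) n
  have hm0 : ∀ x, m 0 x = 0 := fun _ => rfl
  have hms : ∀ n x, m (n + 1) x = F x (m n x) := fun _ _ => rfl
  have hmn : ∀ n, ∀ x ∈ U, ‖m n x‖ ≤ 1 / 2 := by
    intro n
    induction n with
    | zero => intro x _; simp [hm0]
    | succ n ih => exact fun x hx => hF x hx _ ((Complex.re_le_norm _).trans (ih x hx))
  have hmre : ∀ n, ∀ x ∈ U, (m n x).re ≤ 1 / 2 := fun n x hx =>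
    (Complex.re_le_norm _).trans (hmn n x hx)
  have hmd : ∀ n, DifferentiableOn ℂ (m n) U := by
    intro n
    induction n with
    | zero => exact differentiableOn_const _
    | succ n ih => exact hD _ ih (hmre n)
  have hgeo : ∀ x ∈ U, ∀ n, dist (m n x) (m (n + 1) x) ≤ 1 / 2 * κ ^ n := by
    intro x hx n
    induction n with
    | zero => simpa [hm0] using hmn 1 x hx
    | succ n ih =>
      rw [dist_eq_norm, hms, hms (n + 1)]
      refine (hL x hx _ _ (hmre n x hx) (hmre (n + 1) x hx)).trans ?_
      rw [← dist_eq_norm, pow_succ]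
      nlinarith
  have hlim : ∀ x, ∃ z, x ∈ U → Filter.Tendsto (fun n => m n x) Filter.atTop (nhds z) := by
    intro x
    by_cases hx : x ∈ U
    · obtain ⟨z, hz⟩ := cauchySeq_tendsto_of_complete
        (cauchySeq_of_le_geometric κ (1 / 2) hκ (hgeo x hx))
      exact ⟨z, fun _ => hz⟩
    · exact ⟨0, fun h => absurd h hx⟩
  choose μ hμ using hlim
  have hunif : TendstoUniformlyOn m μ Filter.atTop U := by
    rw [Metric.tendstoUniformlyOn_iff]
    intro ε hε
    have h0 : Filter.Tendsto (fun n => 1 / 2 * κ ^ n / (1 - κ)) Filter.atTop (nhds 0) := by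
      have := ((tendsto_pow_atTop_nhds_zero_of_lt_one hκ0 hκ).const_mul (1 / 2)).div_const (1 - κ)
      rwa [mul_zero, zero_div] at this
    filter_upwards [h0.eventually_lt_const hε] with n hn x hx
    rw [dist_comm]
    exact (dist_le_of_le_geometric_of_tendsto κ (1 / 2) hκ (hgeo x hx) (hμ x hx) n).trans_lt hn
  refine ⟨μ, hunif.tendstoLocallyUniformlyOn.differentiableOn
    (Filter.Eventually.of_forall hmd) hU, fun x hx => ?_⟩
  have hμn : ‖μ x‖ ≤ 1 / 2 :=
    le_of_tendsto (hμ x hx).norm (Filter.Eventually.of_forall fun n => hmn n x hx)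
  have hμre : (μ x).re ≤ 1 / 2 := (Complex.re_le_norm _).trans hμn
  have hfix : F x (μ x) = μ x := by
    refine tendsto_nhds_unique ?_ ((Filter.tendsto_add_atTop_iff_nat 1).2 (hμ x hx))
    rw [tendsto_iff_norm_sub_tendsto_zero]
    refine squeeze_zero (fun _ => norm_nonneg _)
      (fun n => hL x hx (m n x) (μ x) (hmre n x hx) hμre) ?_
    simpa using (tendsto_iff_norm_sub_tendsto_zero.1 (hμ x hx)).const_mul κ
  refine ⟨hμn, hfix, fun ζ hζ hFζ => ?_⟩
  have := hL x hx ζ (μ x) hζ hμre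
  rw [hFζ, hfix] at this
  have h0 : ‖ζ - μ x‖ ≤ 0 := by nlinarith [norm_nonneg (ζ - μ x)]
  exact sub_eq_zero.1 (norm_le_zero_iff.1 h0)

end FixedPoint

/-! ### One-parameter subgroups, the adjoint action, the Cartan decomposition -/

section Group

open scoped Matrix.Norms.Operator
open Matrix

/-- The exponential map with values in `SL₂(ℝ)`. -/
def expS (X : sl2) : SL(2, ℝ) := ⟨NormedSpace.exp (X : Matrix (Fin 2) (Fin 2) ℝ), det_exp_sl2 X⟩

/-- The projection `SL₂(ℝ) → PSL₂(ℝ)`. -/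
def proj : SL(2, ℝ) →* PSL(2, ℝ) := QuotientGroup.mk' _

lemma expG_eq (X : sl2) : expG X = proj (expS X) := rfl

lemma continuous_proj : Continuous proj := continuous_quotient_mk'

lemma proj_surjective : Function.Surjective proj := QuotientGroup.mk'_surjective _

lemma expS_coe (X : sl2) :
    (expS X : Matrix (Fin 2) (Fin 2) ℝ) = NormedSpace.exp (X : Matrix (Fin 2) (Fin 2) ℝ) := rfl

lemma expS_add_smul (X : sl2) (s t : ℝ) : expS ((s + t) • X) = expS (s • X) * expS (t • X) := by
  refine Subtype.ext ?_
  rw [Matrix.SpecialLinearGroup.coe_mul]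
  simp only [expS_coe]
  rw [add_smul]
  push_cast
  exact Matrix.exp_add_of_commute _ _ (((Commute.refl _).smul_left s).smul_right t)

lemma expS_zero : expS 0 = 1 := by
  refine Subtype.ext ?_
  simp [expS_coe]

lemma continuous_expS_smul (X : sl2) : Continuous fun t : ℝ => expS (t • X) := by
  refine Continuous.subtype_mk ?_ _
  push_cast
  exact (NormedSpace.exp_continuous (𝔸 := Matrix (Fin 2) (Fin 2) ℝ)).comp (by fun_prop)

lemma expG_add_smul (X : sl2) (s t : ℝ) : expG ((s + t) • X) = expG (s • X) * expG (t • X) := by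
  simp only [expG_eq, expS_add_smul, map_mul]

lemma expG_zero : expG 0 = 1 := by simp [expG_eq, expS_zero]

lemma expG_neg_smul (X : sl2) (t : ℝ) : expG (-(t • X)) = (expG (t • X))⁻¹ := by
  rw [eq_inv_iff_mul_eq_one, ← neg_smul, ← expG_add_smul, neg_add_cancel, zero_smul, expG_zero]

lemma expS_neg (X : sl2) : expS (-X) = (expS X)⁻¹ := by
  have := expS_add_smul X (-1) 1
  rw [neg_add_cancel, zero_smul, expS_zero, one_smul, neg_one_smul] at this
  rw [eq_inv_iff_mul_eq_one, this]

lemma continuous_expG_smul (X : sl2) : Continuous fun t : ℝ => expG (t • X) :=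
  continuous_proj.comp (continuous_expS_smul X)

/-- A curve of matrices solving `C' = X C`, `C 0 = 1`, is the one-parameter group of `X`. -/
lemma exp_smul_eq_of_hasDerivAt (X : Matrix (Fin 2) (Fin 2) ℝ) (C : ℝ → Matrix (Fin 2) (Fin 2) ℝ)
    (hC : ∀ t, HasDerivAt C (X * C t) t) (h0 : C 0 = 1) (t : ℝ) :
    NormedSpace.exp (t • X) = C t := by
  have hd : ∀ s : ℝ, HasDerivAt (fun s => NormedSpace.exp (s • -X) * C s) 0 s := by
    intro s
    have h := (hasDerivAt_exp_smul_const (-X) s).mul (hC s)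
    refine h.congr_deriv ?_
    rw [mul_assoc, neg_mul, mul_neg, neg_add_cancel]
  have hc := is_const_of_deriv_eq_zero (fun s => (hd s).differentiableAt)
    (fun s => (hd s).deriv) t 0
  simp only [h0, zero_smul, NormedSpace.exp_zero, mul_one] at hc
  have h1 : NormedSpace.exp (t • X) * NormedSpace.exp (t • -X) = 1 := by
    rw [← Matrix.exp_add_of_commute]
    · simp
    · exact ((Commute.refl X).neg_right.smul_left t).smul_right t
  calc NormedSpace.exp (t • X)
      = NormedSpace.exp (t • X) * (NormedSpace.exp (t • -X) * C t) := by rw [hc, mul_one]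
    _ = C t := by rw [← mul_assoc, h1, one_mul]

lemma expS_smul_Xi (t : ℝ) : (expS (t • Xi) : Matrix (Fin 2) (Fin 2) ℝ) =
    !![Real.cos (t / 2), Real.sin (t / 2); -Real.sin (t / 2), Real.cos (t / 2)] := by
  rw [expS_coe]
  push_cast
  refine exp_smul_eq_of_hasDerivAt _
    (fun t => !![Real.cos (t / 2), Real.sin (t / 2); -Real.sin (t / 2), Real.cos (t / 2)])
    (fun t => ?_) ?_ t
  · have hs : HasDerivAt (fun t : ℝ => Real.sin (t / 2)) (Real.cos (t / 2) * (1 / 2)) t :=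
      ((hasDerivAt_id t).div_const 2).sin
    have hc : HasDerivAt (fun t : ℝ => Real.cos (t / 2)) (-Real.sin (t / 2) * (1 / 2)) t :=
      ((hasDerivAt_id t).div_const 2).cos
    refine hasDerivAt_pi.2 fun i => hasDerivAt_pi.2 fun j => ?_
    fin_cases i <;> fin_cases j
    · exact hc.congr_deriv (by simp [Xi, Matrix.mul_apply]; ring)
    · exact hs.congr_deriv (by simp [Xi, Matrix.mul_apply]; ring)
    · exact hs.neg.congr_deriv (by simp [Xi, Matrix.mul_apply]; ring)
    · exact hc.congr_deriv (by simp [Xi, Matrix.mul_apply]; ring)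
  · ext i j
    fin_cases i <;> fin_cases j <;> simp

lemma expS_smul_Hg (t : ℝ) : (expS (t • Hg) : Matrix (Fin 2) (Fin 2) ℝ) =
    !![Real.exp (t / 2), 0; 0, Real.exp (-(t / 2))] := by
  rw [expS_coe]
  push_cast
  refine exp_smul_eq_of_hasDerivAt _
    (fun t => !![Real.exp (t / 2), 0; 0, Real.exp (-(t / 2))]) (fun t => ?_) ?_ t
  · have hp : HasDerivAt (fun t : ℝ => Real.exp (t / 2)) (Real.exp (t / 2) * (1 / 2)) t :=
      ((hasDerivAt_id t).div_const 2).exp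
    have hn : HasDerivAt (fun t : ℝ => Real.exp (-(t / 2))) (Real.exp (-(t / 2)) * -(1 / 2)) t :=
      ((hasDerivAt_id t).div_const 2).neg.exp
    refine hasDerivAt_pi.2 fun i => hasDerivAt_pi.2 fun j => ?_
    fin_cases i <;> fin_cases j
    · exact hp.congr_deriv (by simp [Hg, Matrix.mul_apply]; ring)
    · exact (hasDerivAt_const t (0 : ℝ)).congr_deriv (by simp [Hg, Matrix.mul_apply])
    · exact (hasDerivAt_const t (0 : ℝ)).congr_deriv (by simp [Hg, Matrix.mul_apply])
    · exact hn.congr_deriv (by simp [Hg, Matrix.mul_apply]; ring)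
  · ext i j
    fin_cases i <;> fin_cases j <;> simp

/-- In `SL₂` this element is `-1`, which dies in `PSL₂`. Hence the rotation group has period `2π`
and its weights are integers. -/
lemma expG_two_pi_smul_Xi : expG ((2 * Real.pi) • Xi) = 1 := by
  rw [expG_eq]
  refine (QuotientGroup.eq_one_iff _).2 ?_
  have h : expS ((2 * Real.pi) • Xi) = -1 := by
    refine Subtype.ext ?_
    rw [expS_smul_Xi]
    ext i j
    fin_cases i <;> fin_cases j <;> simp
  rw [h, Subgroup.mem_center_iff]
  intro g
  simp

/-- The adjoint action of `SL₂(ℝ)` on its Lie algebra. -/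
def Ad (h : SL(2, ℝ)) (X : sl2) : sl2 :=
  ⟨h * X * (h⁻¹ : SL(2, ℝ)), by
    have := X.2
    rw [mem_sl2_iff, ← Matrix.trace_fin_two] at this ⊢
    rw [Matrix.trace_mul_cycle, ← Matrix.SpecialLinearGroup.coe_mul, inv_mul_cancel]
    simpa using this⟩

lemma Ad_smul (h : SL(2, ℝ)) (t : ℝ) (X : sl2) : Ad h (t • X) = t • Ad h X := by
  ext1
  simp [Ad]

lemma expS_Ad (h : SL(2, ℝ)) (X : sl2) : expS (Ad h X) = h * expS X * h⁻¹ := by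
  refine Subtype.ext ?_
  have hu : IsUnit (h : Matrix (Fin 2) (Fin 2) ℝ) := by
    rw [Matrix.isUnit_iff_isUnit_det]; simp
  have hinv : ((h⁻¹ : SL(2, ℝ)) : Matrix (Fin 2) (Fin 2) ℝ) = (h : Matrix (Fin 2) (Fin 2) ℝ)⁻¹ := by
    refine (Matrix.inv_eq_left_inv ?_).symm
    rw [← Matrix.SpecialLinearGroup.coe_mul, inv_mul_cancel, Matrix.SpecialLinearGroup.coe_one]
  rw [Matrix.SpecialLinearGroup.coe_mul, Matrix.SpecialLinearGroup.coe_mul]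
  simp only [expS_coe, Ad]
  rw [hinv, Matrix.exp_conj _ _ hu]

lemma expG_Ad (h : SL(2, ℝ)) (t : ℝ) (X : sl2) :
    proj h * expG (t • X) = expG (t • Ad h X) * proj h := by
  rw [← Ad_smul, expG_eq, expG_eq, expS_Ad, map_mul, map_mul, map_inv, inv_mul_cancel_right]

lemma Ad_Xi_Hg (t : ℝ) : Ad (expS (t • Xi)) Hg = Real.cos t • Hg + (-Real.sin t) • Bg := by
  ext1
  simp only [Ad]
  rw [Matrix.SpecialLinearGroup.coe_inv, expS_smul_Xi, Matrix.adjugate_fin_two_of]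
  have h1 : Real.cos t = Real.cos (t / 2) ^ 2 - Real.sin (t / 2) ^ 2 := by
    rw [← Real.cos_two_mul']; ring_nf
  have h2 : Real.sin t = 2 * Real.sin (t / 2) * Real.cos (t / 2) := by
    rw [← Real.sin_two_mul]; ring_nf
  rw [h1, h2]
  ext i j
  fin_cases i <;> fin_cases j <;> simp [Hg, Bg, Matrix.mul_apply] <;> ring

lemma Ad_Xi_Bg (t : ℝ) : Ad (expS (t • Xi)) Bg = Real.sin t • Hg + Real.cos t • Bg := by
  ext1
  simp only [Ad]
  rw [Matrix.SpecialLinearGroup.coe_inv, expS_smul_Xi, Matrix.adjugate_fin_two_of]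
  have h1 : Real.cos t = Real.cos (t / 2) ^ 2 - Real.sin (t / 2) ^ 2 := by
    rw [← Real.cos_two_mul']; ring_nf
  have h2 : Real.sin t = 2 * Real.sin (t / 2) * Real.cos (t / 2) := by
    rw [← Real.sin_two_mul]; ring_nf
  rw [h1, h2]
  ext i j
  fin_cases i <;> fin_cases j <;> simp [Hg, Bg, Matrix.mul_apply] <;> ring

lemma Ad_Hg_Xi (t : ℝ) : Ad (expS (t • Hg)) Xi = Real.cosh t • Xi + Real.sinh t • Bg := by
  ext1
  simp only [Ad]
  rw [Matrix.SpecialLinearGroup.coe_inv, expS_smul_Hg, Matrix.adjugate_fin_two_of]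
  have h1 : Real.exp (t / 2) * Real.exp (t / 2) = Real.cosh t + Real.sinh t := by
    rw [← Real.exp_add, Real.cosh_add_sinh]; ring_nf
  have h2 : Real.exp (-(t / 2)) * Real.exp (-(t / 2)) = Real.cosh t - Real.sinh t := by
    rw [← Real.exp_add, Real.cosh_sub_sinh]; ring_nf
  ext i j
  fin_cases i <;> fin_cases j <;> simp [Xi, Bg, Matrix.mul_apply] <;> linarith

/-- The Cartan decomposition of `PSL₂(ℝ)`. -/
lemma exists_cartan (g : PSL(2, ℝ)) :
    ∃ a t b : ℝ, g = expG (a • Xi) * expG (t • Hg) * expG (b • Xi) := by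
  obtain ⟨h, rfl⟩ := proj_surjective g
  have hdet : h 0 0 * h 1 1 - h 0 1 * h 1 0 = 1 := by
    rw [← Matrix.det_fin_two]; exact h.2
  set p : ℝ := h 0 0 * h 0 1 + h 1 0 * h 1 1 with hp
  set q : ℝ := h 0 1 ^ 2 + h 1 1 ^ 2 - h 0 0 ^ 2 - h 1 0 ^ 2 with hq
  -- make the columns of `h * k` orthogonal
  obtain ⟨θ, hθ⟩ : ∃ θ : ℝ, p * (Real.cos θ ^ 2 - Real.sin θ ^ 2) - q * (Real.sin θ * Real.cos θ) = 0 := by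
    -- The expression equals `p` at `0` and `-p` at `π/2`, so it vanishes in between.
    have hcont : Continuous fun θ : ℝ =>
        p * (Real.cos θ ^ 2 - Real.sin θ ^ 2) - q * (Real.sin θ * Real.cos θ) := by fun_prop
    have h0 : p * (Real.cos 0 ^ 2 - Real.sin 0 ^ 2) - q * (Real.sin 0 * Real.cos 0) = p := by simp
    have h1 : p * (Real.cos (Real.pi / 2) ^ 2 - Real.sin (Real.pi / 2) ^ 2)
        - q * (Real.sin (Real.pi / 2) * Real.cos (Real.pi / 2)) = -p := by simp
    have := intermediate_value_uIcc (a := 0) (b := Real.pi / 2) hcont.continuousOn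
    obtain ⟨θ, -, hθ⟩ := this (show (0 : ℝ) ∈ _ by
      rw [h0, h1, Set.mem_uIcc]
      rcases le_total 0 p with h | h
      · right; constructor <;> linarith
      · left; constructor <;> linarith)
    exact ⟨θ, hθ⟩
  set c := Real.cos θ with hc
  set s := Real.sin θ with hs
  have hcs : c ^ 2 + s ^ 2 = 1 := Real.cos_sq_add_sin_sq θ
  -- the matrix `m = h * k`
  set m00 := h 0 0 * c - h 0 1 * s with hm00
  set m01 := h 0 0 * s + h 0 1 * c with hm01
  set m10 := h 1 0 * c - h 1 1 * s with hm10
  set m11 := h 1 0 * s + h 1 1 * c with hm11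
  have horth : m00 * m01 + m10 * m11 = 0 := by
    rw [← hθ, hm00, hm01, hm10, hm11, hp, hq]; ring
  have hmdet : m00 * m11 - m01 * m10 = 1 := by
    rw [hm00, hm01, hm10, hm11]
    linear_combination (c ^ 2 + s ^ 2) * hdet + hcs
  set n2 := m00 ^ 2 + m10 ^ 2 with hn2
  have hn2pos : 0 < n2 := by
    rcases eq_or_lt_of_le (show 0 ≤ n2 by positivity) with h0 | h0
    · have ha : m00 = 0 := by nlinarith [sq_nonneg m10, sq_nonneg m00]
      have hb : m10 = 0 := by nlinarith [sq_nonneg m10, sq_nonneg m00]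
      rw [ha, hb] at hmdet; simp at hmdet
    · exact h0
  set n := Real.sqrt n2 with hn
  have hnpos : 0 < n := Real.sqrt_pos.2 hn2pos
  have hnn : n ^ 2 = n2 := Real.sq_sqrt hn2pos.le
  have hm01' : m01 * n ^ 2 = -m10 := by
    rw [hnn, hn2]; linear_combination m00 * horth - m10 * hmdet
  have hm11' : m11 * n ^ 2 = m00 := by
    rw [hnn, hn2]; linear_combination m10 * horth + m00 * hmdet
  -- The columns of `m` are orthogonal and its determinant is `1`, so `m` is a rotation times
  -- `diag(n, 1/n)`; the normalized first column gives the angle.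
  obtain ⟨φ, hφc, hφs⟩ : ∃ φ : ℝ, Real.cos φ = m00 / n ∧ Real.sin φ = -(m10 / n) := by
    set z : ℂ := ⟨m00 / n, -(m10 / n)⟩ with hz
    have hz1 : ‖z‖ = 1 := by
      rw [Complex.norm_def, Complex.normSq_mk, Real.sqrt_eq_one]
      field_simp
      linarith
    have hz0 : z ≠ 0 := by
      rw [← norm_pos_iff, hz1]; exact one_pos
    refine ⟨z.arg, ?_, ?_⟩
    · rw [Complex.cos_arg hz0, hz1, div_one]
    · rw [Complex.sin_arg, hz1, div_one]
  -- The factors `2` undo the halves in `Xi` and `Hg`: the matrices of `exp(tΞ)` and `exp(tH)`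
  -- involve `t/2`.
  refine ⟨2 * φ, 2 * Real.log n, -2 * θ, ?_⟩
  rw [expG_eq, expG_eq, expG_eq, ← map_mul, ← map_mul]
  congr 1
  refine Subtype.ext ?_
  rw [Matrix.SpecialLinearGroup.coe_mul, Matrix.SpecialLinearGroup.coe_mul, expS_smul_Xi, expS_smul_Xi,
    expS_smul_Hg]
  rw [show 2 * φ / 2 = φ by ring, show -2 * θ / 2 = -θ by ring,
    show 2 * Real.log n / 2 = Real.log n by ring, Real.exp_neg, Real.exp_log hnpos,
    Real.cos_neg, Real.sin_neg, hφc, hφs, ← hc, ← hs]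
  have e00 : h 0 0 = m00 * c + m01 * s := by rw [hm00, hm01]; linear_combination -h 0 0 * hcs
  have e01 : h 0 1 = -m00 * s + m01 * c := by rw [hm00, hm01]; linear_combination -h 0 1 * hcs
  have e10 : h 1 0 = m10 * c + m11 * s := by rw [hm10, hm11]; linear_combination -h 1 0 * hcs
  have e11 : h 1 1 = -m10 * s + m11 * c := by rw [hm10, hm11]; linear_combination -h 1 1 * hcs
  have f01 : m01 = -(m10 / n) * n⁻¹ := by field_simp; linarith
  have f11 : m11 = (m00 / n) * n⁻¹ := by field_simp; linarith
  have g00 : m00 = m00 / n * n := by field_simp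
  have g10 : m10 = m10 / n * n := by field_simp
  ext i j
  fin_cases i <;> fin_cases j
  · simp only [Matrix.mul_apply, Fin.sum_univ_two]
    simp
    rw [e00, f01]
    nth_rewrite 1 [g00]
    ring
  · simp only [Matrix.mul_apply, Fin.sum_univ_two]
    simp
    rw [e01, f01]
    nth_rewrite 1 [g00]
    ring
  · simp only [Matrix.mul_apply, Fin.sum_univ_two]
    simp
    rw [e10, f11]
    nth_rewrite 1 [g10]
    ring
  · simp only [Matrix.mul_apply, Fin.sum_univ_two]
    simp
    rw [e11, f11]
    nth_rewrite 1 [g10]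
    ring

end Group

/-! ### Gårding vectors: smooth vectors are dense -/

section Garding

open scoped Matrix.Norms.Operator ContDiff Topology
open Matrix MeasureTheory

/-- The space of real `2 × 2` matrices, as pairs of columns. -/
abbrev Cols : Type := (Fin 2 → ℝ) × (Fin 2 → ℝ)

/-- Left multiplication by a matrix. -/
def act (M : Matrix (Fin 2) (Fin 2) ℝ) : Cols →L[ℝ] Cols :=
  M.mulVecLin.toContinuousLinearMap.prodMap M.mulVecLin.toContinuousLinearMap

lemma act_apply (M : Matrix (Fin 2) (Fin 2) ℝ) (p : Cols) : act M p = (M *ᵥ p.1, M *ᵥ p.2) := rfl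

lemma act_mul (M N : Matrix (Fin 2) (Fin 2) ℝ) (p : Cols) : act (M * N) p = act M (act N p) := by
  simp only [act_apply, Matrix.mulVec_mulVec]

lemma act_one (p : Cols) : act 1 p = p := by simp [act_apply]

lemma act_add (M N : Matrix (Fin 2) (Fin 2) ℝ) (p : Cols) :
    act (M + N) p = act M p + act N p := by
  simp [act_apply, Matrix.add_mulVec]

lemma act_smul (c : ℝ) (M : Matrix (Fin 2) (Fin 2) ℝ) (p : Cols) :
    act (c • M) p = c • act M p := by
  simp [act_apply, Matrix.smul_mulVec]

lemma act_neg (M : Matrix (Fin 2) (Fin 2) ℝ) (p : Cols) : act (-M) p = -act M p := by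
  simp [act_apply, Matrix.neg_mulVec]

lemma act_sub (M N : Matrix (Fin 2) (Fin 2) ℝ) (p : Cols) :
    act (M - N) p = act M p - act N p := by
  rw [sub_eq_add_neg, act_add, act_neg, ← sub_eq_add_neg]

lemma hasDerivAt_act_expS (X : sl2) (p : Cols) (t : ℝ) :
    HasDerivAt (fun t : ℝ => act (expS (-(t • X))) p) (-act X (act (expS (-(t • X))) p)) t := by
  have hM : ∀ s : ℝ, (expS (-(s • X)) : Matrix (Fin 2) (Fin 2) ℝ) =
      NormedSpace.exp (s • (-X : Matrix (Fin 2) (Fin 2) ℝ)) := by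
    intro s
    rw [expS_coe]
    push_cast
    rw [smul_neg]
  simp_rw [hM]
  have hd := hasDerivAt_exp_smul_const' (𝕂 := ℝ) (-X : Matrix (Fin 2) (Fin 2) ℝ) t
  set M : ℝ → Matrix (Fin 2) (Fin 2) ℝ :=
    fun s => NormedSpace.exp (s • (-X : Matrix (Fin 2) (Fin 2) ℝ))
  have hij : ∀ i j : Fin 2, HasDerivAt (fun s => M s i j)
      ((-X * M t : Matrix (Fin 2) (Fin 2) ℝ) i j) t := by
    intro i j
    exact hasDerivAt_pi.1 (hasDerivAt_pi.1 hd i) j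
  have hv : ∀ q : Fin 2 → ℝ, HasDerivAt (fun s => M s *ᵥ q)
      ((-X * M t : Matrix (Fin 2) (Fin 2) ℝ) *ᵥ q) t := by
    intro q
    refine hasDerivAt_pi.2 fun i => ?_
    have h := ((hij i 0).mul_const (q 0)).add ((hij i 1).mul_const (q 1))
    have e : ∀ A : Matrix (Fin 2) (Fin 2) ℝ, (A *ᵥ q) i = A i 0 * q 0 + A i 1 * q 1 := by
      intro A
      simp [Matrix.mulVec, dotProduct, Fin.sum_univ_two]
    simp_rw [e]
    exact h
  refine ((hv p.1).prodMk (hv p.2)).congr_deriv ?_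
  rw [← act_mul, ← act_neg, neg_mul]
  rfl

lemma continuous_act_expS (X : sl2) :
    Continuous fun q : ℝ × Cols => act (expS (q.1 • X)) q.2 := by
  have hij : ∀ i j : Fin 2, Continuous fun q : ℝ × Cols =>
      (expS (q.1 • X) : Matrix (Fin 2) (Fin 2) ℝ) i j := by
    intro i j
    have h1 : Continuous fun h : SL(2, ℝ) => (h : Matrix (Fin 2) (Fin 2) ℝ) i j :=
      (continuous_apply_apply i j).comp continuous_subtype_val
    exact h1.comp ((continuous_expS_smul X).comp continuous_fst)
  have hv : ∀ g : ℝ × Cols → Fin 2 → ℝ, Continuous g → Continuous fun q : ℝ × Cols =>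
      (expS (q.1 • X) : Matrix (Fin 2) (Fin 2) ℝ) *ᵥ g q := by
    intro g hg
    refine continuous_pi fun i => ?_
    simp only [Matrix.mulVec, dotProduct, Fin.sum_univ_two]
    exact ((hij i 0).mul ((continuous_apply 0).comp hg)).add
      ((hij i 1).mul ((continuous_apply 1).comp hg))
  exact (hv _ (continuous_fst.comp continuous_snd)).prodMk
    (hv _ (continuous_snd.comp continuous_snd))

/-- The determinant of a matrix, given by its columns. -/
def colsDet (p : Cols) : ℝ := p.1 0 * p.2 1 - p.1 1 * p.2 0

lemma continuous_colsDet : Continuous colsDet := by unfold colsDet; fun_prop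

lemma colsDet_act (h : SL(2, ℝ)) (p : Cols) : colsDet (act h p) = colsDet p := by
  have hd := h.2
  rw [Matrix.det_fin_two] at hd
  simp only [colsDet, act_apply, Matrix.mulVec, dotProduct, Fin.sum_univ_two]
  linear_combination (p.1 0 * p.2 1 - p.1 1 * p.2 0) * hd

/-- This invariance lets Lebesgue measure on the matrices of positive determinant play the role of
Haar measure on the group, so that smoothing uses ordinary calculus on a vector space. -/
lemma measurePreserving_act (h : SL(2, ℝ)) :
    MeasurePreserving (act h) (volume : Measure Cols) volume := by
  have h1 : MeasurePreserving (Matrix.toLin' (h : Matrix (Fin 2) (Fin 2) ℝ)) volume volume := by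
    refine ⟨(LinearMap.continuous_of_finiteDimensional _).measurable, ?_⟩
    rw [Real.map_matrix_volume_pi_eq_smul_volume_pi] <;> simp
  exact h1.prod h1

lemma measurableEmbedding_act (h : SL(2, ℝ)) : MeasurableEmbedding (act h) := by
  refine (act h).continuous.measurableEmbedding fun p q hpq => ?_
  have := congrArg (act (h⁻¹ : SL(2, ℝ))) hpq
  rwa [← act_mul, ← act_mul, ← Matrix.SpecialLinearGroup.coe_mul, inv_mul_cancel,
    Matrix.SpecialLinearGroup.coe_one, act_one, act_one] at this

/-- The matrix with given columns, scaled to determinant one. -/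
def normalize (p : Cols) : Matrix (Fin 2) (Fin 2) ℝ :=
  (Real.sqrt (colsDet p))⁻¹ • !![p.1 0, p.2 0; p.1 1, p.2 1]

lemma det_normalize {p : Cols} (hp : 0 < colsDet p) : (normalize p).det = 1 := by
  have h : Real.sqrt (colsDet p) ^ 2 = colsDet p := Real.sq_sqrt hp.le
  have h0 : 0 < Real.sqrt (colsDet p) := Real.sqrt_pos.2 hp
  simp only [normalize, Matrix.det_fin_two, Matrix.smul_apply, Matrix.of_apply, Matrix.cons_val',
    Matrix.cons_val_zero, Matrix.cons_val_one, smul_eq_mul, Matrix.cons_val_fin_one]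
  field_simp
  rw [h, colsDet]
  ring

/-- A matrix of determinant one as an element of `SL₂(ℝ)`. -/
def mkSL (M : Matrix (Fin 2) (Fin 2) ℝ) (h : M.det = 1) : SL(2, ℝ) := ⟨M, h⟩

lemma mkSL_coe (M : Matrix (Fin 2) (Fin 2) ℝ) (h : M.det = 1) :
    (mkSL M h : Matrix (Fin 2) (Fin 2) ℝ) = M := rfl

/-- The class in `PSL₂(ℝ)` of a matrix of positive determinant. -/
def cls (p : Cols) : PSL(2, ℝ) :=
  if hp : 0 < colsDet p then proj (mkSL (normalize p) (det_normalize hp)) else 1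

lemma cls_act (h : SL(2, ℝ)) {p : Cols} (hp : 0 < colsDet p) :
    cls (act h p) = proj h * cls p := by
  have hp' : 0 < colsDet (act h p) := by rwa [colsDet_act]
  have e : mkSL (normalize (act h p)) (det_normalize hp')
      = h * mkSL (normalize p) (det_normalize hp) := by
    refine Subtype.ext ?_
    rw [Matrix.SpecialLinearGroup.coe_mul]
    simp only [mkSL_coe, normalize, colsDet_act, Matrix.mul_smul]
    congr 1
    ext i j
    fin_cases j <;>
      simp [act_apply, Matrix.mul_apply, Fin.sum_univ_two] <;>
      fin_cases i <;> simp
  rw [cls, cls, dif_pos hp, dif_pos hp', e, map_mul]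

lemma continuousAt_cls {p : Cols} (hp : 0 < colsDet p) : ContinuousAt cls p := by
  have hopen : IsOpen {q : Cols | 0 < colsDet q} := isOpen_lt continuous_const continuous_colsDet
  have hc : ContinuousOn cls {q : Cols | 0 < colsDet q} := by
    rw [continuousOn_iff_continuous_domRestrict]
    have hn : Continuous fun q : {q : Cols | 0 < colsDet q} =>
        mkSL (normalize q) (det_normalize q.2) := by
      refine Continuous.subtype_mk ?_ _
      have hs : Continuous fun q : {q : Cols | 0 < colsDet q} => (Real.sqrt (colsDet q))⁻¹ :=
        Continuous.inv₀ (continuous_colsDet.comp continuous_subtype_val).sqrt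
          fun q => (Real.sqrt_pos.2 q.2).ne'
      refine continuous_matrix fun i j => ?_
      fin_cases i <;> fin_cases j <;> simp [normalize] <;> refine hs.mul ?_ <;> fun_prop
    refine (continuous_proj.comp hn).congr fun q => ?_
    simp only [Set.domRestrict_apply, cls, Function.comp]
    rw [dif_pos (show 0 < colsDet q.1 from q.2)]
  exact hc.continuousAt (hopen.mem_nhds hp)

/-- Test functions on the matrices of positive determinant. -/
structure IsTest (f : Cols → ℝ) : Prop where
  contDiff : ContDiff ℝ ∞ f
  compact : HasCompactSupport f
  pos : tsupport f ⊆ {p | 0 < colsDet p}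

lemma IsTest.colsDet_pos {f : Cols → ℝ} (hf : IsTest f) {p : Cols} (hp : f p ≠ 0) :
    0 < colsDet p := hf.pos (subset_tsupport f hp)

/-- The infinitesimal left translation of functions of a matrix. -/
def lieD (X : sl2) (f : Cols → ℝ) (p : Cols) : ℝ := -fderiv ℝ f p (act X p)

lemma lieD_eq_zero (X : sl2) {f : Cols → ℝ} {p : Cols} (hp : p ∉ tsupport f) : lieD X f p = 0 := by
  have : fderiv ℝ f p = 0 := by
    by_contra h
    exact hp (tsupport_fderiv_subset ℝ (subset_tsupport _ h))
  simp [lieD, this]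

lemma tsupport_lieD_subset (X : sl2) (f : Cols → ℝ) : tsupport (lieD X f) ⊆ tsupport f := by
  refine closure_minimal (fun p hp => ?_) (isClosed_tsupport f)
  by_contra h
  exact hp (lieD_eq_zero X h)

lemma IsTest.lieD {f : Cols → ℝ} (hf : IsTest f) (X : sl2) : IsTest (lieD X f) where
  contDiff := ((hf.contDiff.fderiv_right (m := ∞) (by simp)).clm_apply (act X).contDiff).neg
  compact := hf.compact.of_isClosed_subset (isClosed_tsupport _) (tsupport_lieD_subset X f)
  pos := (tsupport_lieD_subset X f).trans hf.pos

lemma lieD_add_smul (a b : ℝ) (X Y : sl2) (f : Cols → ℝ) (p : Cols) :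
    lieD (a • X + b • Y) f p = a * lieD X f p + b * lieD Y f p := by
  simp only [lieD]
  push_cast
  rw [act_add, act_smul, act_smul, map_add, map_smul, map_smul, smul_eq_mul, smul_eq_mul]
  ring

/-- The second derivatives of `f` cancel by symmetry, leaving the first derivative along `(YX -
XY)p`; the sign in `lieD` turns this into the bracket in the right order. -/
lemma lieD_comm {f : Cols → ℝ} (hf : IsTest f) (X Y Z : sl2)
    (hZ : (Z : Matrix (Fin 2) (Fin 2) ℝ) = X * Y - Y * X) (p : Cols) :
    lieD X (lieD Y f) p - lieD Y (lieD X f) p = lieD Z f p := by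
  have h2 : Differentiable ℝ (fderiv ℝ f) :=
    (hf.contDiff.fderiv_right (m := 1) (by norm_cast)).differentiable (by simp)
  have hd : ∀ X Y : sl2, KineticBrownian.lieD X (KineticBrownian.lieD Y f) p =
      fderiv ℝ (fderiv ℝ f) p (act X p) (act Y p) + fderiv ℝ f p (act Y (act X p)) := by
    intro X Y
    have h : HasFDerivAt (KineticBrownian.lieD Y f) _ p :=
      ((h2 p).hasFDerivAt.clm_apply (act (Y : Matrix (Fin 2) (Fin 2) ℝ)).hasFDerivAt).neg
    rw [KineticBrownian.lieD, h.fderiv]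
    simp
    ring
  have hsymm : IsSymmSndFDerivAt ℝ f p :=
    (hf.contDiff.contDiffAt).isSymmSndFDerivAt
      (by simp only [minSmoothness_of_isRCLikeNormedField]; exact WithTop.coe_le_coe.2 (le_top : (2 : ℕ∞) ≤ ⊤))
  rw [hd, hd, hsymm.eq, KineticBrownian.lieD, hZ, act_sub, act_mul, act_mul, map_sub]
  ring

variable {V : Type*} [NormedAddCommGroup V] [InnerProductSpace ℂ V]

namespace UnitaryRep

lemma toHom_mul (π : UnitaryRep V) (g h : PSL(2, ℝ)) (u : V) :
    π.toHom (g * h) u = π.toHom g (π.toHom h u) := by rw [map_mul]; rfl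

lemma toHom_one (π : UnitaryRep V) (u : V) : π.toHom 1 u = u := by rw [map_one]; rfl

lemma toHom_inv_toHom (π : UnitaryRep V) (g : PSL(2, ℝ)) (u : V) :
    π.toHom g⁻¹ (π.toHom g u) = u := by rw [← toHom_mul, inv_mul_cancel, toHom_one]

lemma toHom_toHom_inv (π : UnitaryRep V) (g : PSL(2, ℝ)) (u : V) :
    π.toHom g (π.toHom g⁻¹ u) = u := by rw [← toHom_mul, mul_inv_cancel, toHom_one]

lemma toHom_real_smul (π : UnitaryRep V) (g : PSL(2, ℝ)) (c : ℝ) (u : V) :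
    π.toHom g (c • u) = c • π.toHom g u := by
  rw [← Complex.coe_smul, map_smul, Complex.coe_smul]

/-- The integrand `f(p) π(p) u`. -/
def weighted (π : UnitaryRep V) (f : Cols → ℝ) (u : V) (p : Cols) : V := f p • π.toHom (cls p) u

/-- The Gårding vector `∫ f(p) π(p) u dp`. -/
def garding (π : UnitaryRep V) (f : Cols → ℝ) (u : V) : V := ∫ p, π.weighted f u p

lemma continuous_weighted (π : UnitaryRep V) {f : Cols → ℝ} (hf : IsTest f) (u : V) :
    Continuous (π.weighted f u) := by
  refine continuous_of_tsupport fun p hp => ?_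
  have hp' : p ∈ tsupport f := tsupport_smul_subset_left f _ hp
  exact hf.contDiff.continuous.continuousAt.smul
    ((π.continuous_orbit u).continuousAt.comp (continuousAt_cls (hf.pos hp')))

lemma integrable_weighted (π : UnitaryRep V) {f : Cols → ℝ} (hf : IsTest f) (u : V) :
    Integrable (π.weighted f u) :=
  (π.continuous_weighted hf u).integrable_of_hasCompactSupport hf.compact.smul_right

lemma smul_comp_act (π : UnitaryRep V) {f : Cols → ℝ} (hf : IsTest f) (u : V) (h : SL(2, ℝ))
    (p : Cols) : f (act h p) • π.toHom (cls p) u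
      = π.toHom (proj h⁻¹) (π.weighted f u (act h p)) := by
  by_cases h0 : f (act h p) = 0
  · simp [weighted, h0]
  · have hp : 0 < colsDet p := by
      rw [← colsDet_act h]; exact hf.colsDet_pos h0
    rw [weighted, cls_act h hp, map_inv]
    rw [toHom_real_smul, ← toHom_mul, inv_mul_cancel_left]

variable [CompleteSpace V]

lemma toHom_garding (π : UnitaryRep V) {f : Cols → ℝ} (hf : IsTest f) (u : V) (h : SL(2, ℝ)) :
    π.toHom (proj h⁻¹) (π.garding f u) = ∫ p, f (act h p) • π.toHom (cls p) u := by
  simp_rw [π.smul_comp_act hf u h]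
  rw [garding, ← (measurePreserving_act h).integral_comp (measurableEmbedding_act h)]
  exact ((π.toHom (proj h⁻¹)).toContinuousLinearEquiv.toContinuousLinearMap.integral_comp_comm
    ((measurePreserving_act h).integrable_comp_of_integrable (π.integrable_weighted hf u))).symm

/-- By invariance of the measure the group element moves onto the test function, and one
differentiates under the integral sign. -/
lemma hasDerivAt_garding (π : UnitaryRep V) {f : Cols → ℝ} (hf : IsTest f) (u : V) (X : sl2) :
    HasDerivAt (fun t : ℝ => π.toHom (expG (t • X)) (π.garding f u))
      (π.garding (lieD X f) u) 0 := by
  set E : ℝ → SL(2, ℝ) := fun t => expS (-(t • X)) with hE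
  have hE0 : E 0 = 1 := by simp [hE, expS_zero]
  have hEinv : ∀ t, (E t)⁻¹ = expS (t • X) := fun t => by rw [hE, ← expS_neg, neg_neg]
  have h1 : (fun t : ℝ => π.toHom (expG (t • X)) (π.garding f u)) =
      fun t => ∫ p, f (act (E t) p) • π.toHom (cls p) u := by
    funext t
    rw [← π.toHom_garding hf u (E t), hEinv, expG_eq]
  have hEd : ∀ (t : ℝ) (p : Cols), HasDerivAt (fun t => act (E t) p)
      (-act X (act (E t) p)) t := fun t p => hasDerivAt_act_expS X p t
  obtain ⟨C, hC⟩ := (hf.lieD X).contDiff.continuous.bounded_above_of_compact_support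
    (hf.lieD X).compact
  have hC0 : 0 ≤ C := (norm_nonneg _).trans (hC 0)
  -- A compact set containing the supports of all translates of `f` with `|t| ≤ 1`; a constant on it
  -- dominates the derivative.
  set K : Set Cols := (fun q : ℝ × Cols => act (expS (q.1 • X)) q.2) ''
    (Set.Icc (-1) 1 ×ˢ tsupport f) with hK
  have hKc : IsCompact K := by
    exact (isCompact_Icc.prod hf.compact).image (continuous_act_expS X)
  have hderiv := (hasDerivAt_integral_of_dominated_loc_of_deriv_le (μ := volume) (𝕜 := ℝ) (x₀ := 0)
    (s := Metric.ball 0 1) (F := fun t p => f (act (E t) p) • π.toHom (cls p) u)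
    (F' := fun t p => lieD X f (act (E t) p) • π.toHom (cls p) u)
    (bound := K.indicator fun _ => C * ‖u‖) (Metric.ball_mem_nhds _ one_pos) ?_ ?_ ?_ ?_ ?_ ?_).2
  · rw [h1]
    refine hderiv.congr_deriv ?_
    rw [hE0]
    simp only [Matrix.SpecialLinearGroup.coe_one, act_one]
    rfl
  · refine Filter.Eventually.of_forall fun t => ?_
    simp_rw [π.smul_comp_act hf u (E t)]
    exact ((π.toHom _).continuous.comp
      ((π.continuous_weighted hf u).comp (act _).continuous)).aestronglyMeasurable
  · rw [hE0]
    simp only [Matrix.SpecialLinearGroup.coe_one, act_one]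
    exact π.integrable_weighted hf u
  · rw [hE0]
    simp only [Matrix.SpecialLinearGroup.coe_one, act_one]
    exact (π.continuous_weighted (hf.lieD X) u).aestronglyMeasurable
  · refine Filter.Eventually.of_forall fun p t ht => ?_
    by_cases hp : p ∈ K
    · rw [Set.indicator_of_mem hp, norm_smul, LinearIsometryEquiv.norm_map]
      gcongr
      exact hC _
    · rw [Set.indicator_of_notMem hp, lieD_eq_zero, zero_smul, norm_zero]
      intro hmem
      refine hp ⟨(t, act (E t) p), ⟨?_, hmem⟩, ?_⟩
      · rw [Metric.mem_ball, dist_zero_right, Real.norm_eq_abs, abs_lt] at ht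
        exact ⟨ht.1.le, ht.2.le⟩
      · simp only
        rw [← hEinv, ← act_mul, ← Matrix.SpecialLinearGroup.coe_mul, inv_mul_cancel,
          Matrix.SpecialLinearGroup.coe_one, act_one]
  · rw [integrable_indicator_iff hKc.measurableSet]
    exact integrableOn_const hKc.measure_lt_top.ne
  · refine Filter.Eventually.of_forall fun p t _ => ?_
    refine HasDerivAt.smul_const ?_ _
    have hfd := (hf.contDiff.differentiable (by simp) (act (E t) p)).hasFDerivAt
    refine (hfd.comp_hasDerivAt t (hEd t p)).congr_deriv ?_
    rw [map_neg, lieD]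

lemma garding_mem_smooth (π : UnitaryRep V) {f : Cols → ℝ} (hf : IsTest f) (u : V) :
    π.garding f u ∈ π.smooth := by
  refine (Submodule.mem_iInf _).2 fun n => ?_
  induction n generalizing f with
  | zero => exact Submodule.mem_top
  | succ n ih => exact fun X => ⟨_, ih (hf.lieD X), π.hasDerivAt_garding hf u X⟩

lemma dpi_garding (π : UnitaryRep V) {f : Cols → ℝ} (hf : IsTest f) (u : V) (X : sl2) :
    π.dpi X ⟨π.garding f u, π.garding_mem_smooth hf u⟩
      = ⟨π.garding (lieD X f) u, π.garding_mem_smooth (hf.lieD X) u⟩ :=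
  Subtype.ext (π.hasDerivAt_garding hf u X).deriv

/-- An approximate identity: a normalized bump function near the identity matrix, where the orbit
map is within `ε` of `u`. -/
lemma exists_garding_near (π : UnitaryRep V) (u : V) {ε : ℝ} (hε : 0 < ε) :
    ∃ f, IsTest f ∧ ‖π.garding f u - u‖ ≤ ε := by
  set e : Cols := (![1, 0], ![0, 1]) with he
  have he1 : colsDet e = 1 := by simp [colsDet, he]
  have hcls : cls e = 1 := by
    rw [cls, dif_pos (by rw [he1]; exact one_pos), ← map_one proj]
    congr 1
    refine Subtype.ext ?_
    simp only [mkSL_coe, normalize, he1]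
    ext i j
    fin_cases i <;> fin_cases j <;> simp [he]
  have hpos : ∀ᶠ p in 𝓝 e, 0 < colsDet p :=
    continuous_colsDet.continuousAt.eventually_const_lt (by rw [he1]; exact one_pos)
  have hcont : ContinuousAt (fun p => π.toHom (cls p) u) e :=
    (π.continuous_orbit u).continuousAt.comp (continuousAt_cls (by rw [he1]; exact one_pos))
  have hnear : ∀ᶠ p in 𝓝 e, ‖π.toHom (cls p) u - u‖ < ε := by
    have := Metric.continuousAt_iff'.1 hcont ε hε
    simpa only [hcls, toHom_one, dist_eq_norm] using this
  obtain ⟨δ, hδ, hball⟩ := Metric.eventually_nhds_iff_ball.1 (hpos.and hnear)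
  let b : ContDiffBump e := ⟨δ / 4, δ / 2, by positivity, by linarith⟩
  set f := b.normed volume with hfdef
  have hts : tsupport f ⊆ Metric.ball e δ := by
    rw [hfdef, b.tsupport_normed_eq]
    exact Metric.closedBall_subset_ball (by simp only [b]; linarith)
  have hf : IsTest f :=
    ⟨b.contDiff_normed, b.hasCompactSupport_normed, fun p hp => (hball p (hts hp)).1⟩
  refine ⟨f, hf, ?_⟩
  have hfint : Integrable f := hf.contDiff.continuous.integrable_of_hasCompactSupport hf.compact
  have h1 : π.garding f u - u = ∫ p, (π.weighted f u p - f p • u) := by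
    rw [integral_sub (π.integrable_weighted hf u) (hfint.smul_const u), integral_smul_const,
      b.integral_normed, one_smul, garding]
  rw [h1]
  have h2 : ∫ p, f p * ε = ε := by rw [integral_mul_const, b.integral_normed, one_mul]
  rw [← h2]
  refine norm_integral_le_of_norm_le (hfint.mul_const ε) (Filter.Eventually.of_forall fun p => ?_)
  rw [weighted, ← smul_sub, norm_smul, Real.norm_of_nonneg (b.nonneg_normed p)]
  by_cases h0 : f p = 0
  · change f p * _ ≤ f p * ε
    rw [h0, zero_mul, zero_mul]
  · exact mul_le_mul_of_nonneg_left (hball p (hts (subset_tsupport f h0))).2.le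
      (b.nonneg_normed p)

/-- Two vectors with the same inner products against all Gårding vectors agree. -/
lemma ext_garding (π : UnitaryRep V) {u v : V}
    (h : ∀ f, IsTest f → ∀ y, inner ℂ u (π.garding f y) = inner ℂ v (π.garding f y)) : u = v := by
  refine ext_inner_right ℂ fun y => ?_
  have hcl : IsClosed {y | inner ℂ u y = inner ℂ v y} := isClosed_eq (by fun_prop) (by fun_prop)
  have : y ∈ closure {y | inner ℂ u y = inner ℂ v y} := by
    refine Metric.mem_closure_iff.2 fun ε hε => ?_
    obtain ⟨f, hf, hlt⟩ := π.exists_garding_near y (half_pos hε)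
    refine ⟨π.garding f y, h f hf y, ?_⟩
    rw [dist_comm, dist_eq_norm]
    linarith
  rwa [hcl.closure_eq] at this

lemma dense_smooth (π : UnitaryRep V) : Dense (π.smooth : Set V) := by
  intro u
  refine Metric.mem_closure_iff.2 fun ε hε => ?_
  obtain ⟨f, hf, hlt⟩ := π.exists_garding_near u (half_pos hε)
  refine ⟨π.garding f u, π.garding_mem_smooth hf u, ?_⟩
  rw [dist_comm, dist_eq_norm]
  linarith

end UnitaryRep

end Garding

/-! ### The derived representation: linearity, brackets, weak derivatives -/

section Relations

open scoped InnerProductSpace Topology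
open MeasureTheory

variable {V : Type*} [NormedAddCommGroup V] [InnerProductSpace ℂ V]

lemma comm_Xi_Bg : (Hg : Matrix (Fin 2) (Fin 2) ℝ) = Xi * Bg - Bg * Xi := by
  ext i j
  fin_cases i <;> fin_cases j <;> simp [Xi, Hg, Bg] <;> norm_num

lemma comm_Hg_Bg : (Xi : Matrix (Fin 2) (Fin 2) ℝ) = Hg * Bg - Bg * Hg := by
  ext i j
  fin_cases i <;> fin_cases j <;> simp [Xi, Hg, Bg] <;> norm_num

lemma exists_eq_combination (X : sl2) :
    ∃ a b c : ℝ, X = a • Xi + (1 : ℝ) • (b • Hg + c • Bg) := by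
  obtain ⟨X, hX⟩ := X
  have htr := (mem_sl2_iff X).1 hX
  refine ⟨X 0 1 - X 1 0, 2 * X 0 0, X 0 1 + X 1 0, ?_⟩
  ext i j
  fin_cases i <;> fin_cases j <;> simp [Xi, Hg, Bg] <;> linarith

namespace UnitaryRep

lemma inner_toHom_left (π : UnitaryRep V) (g : PSL(2, ℝ)) (u v : V) :
    ⟪π.toHom g u, v⟫_ℂ = ⟪u, π.toHom g⁻¹ v⟫_ℂ := by
  conv_lhs => rw [← π.toHom_toHom_inv g v, LinearIsometryEquiv.inner_map_map]

lemma hasDerivAt_dpi (π : UnitaryRep V) (X : sl2) (u : π.smooth) :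
    HasDerivAt (fun t : ℝ => π.toHom (expG (t • X)) (u : V)) (π.dpi X u) 0 :=
  π.hasDerivAt_of_smooth X u.2

lemma hasDerivAt_toHom_comp (π : UnitaryRep V) (g : PSL(2, ℝ)) {f : ℝ → V} {w : V} {t : ℝ}
    (h : HasDerivAt f w t) : HasDerivAt (fun s => π.toHom g (f s)) (π.toHom g w) t := by
  have := ((π.toHom g).toContinuousLinearEquiv.toContinuousLinearMap.restrictScalars
    ℝ).hasFDerivAt.comp_hasDerivAt t h
  exact this

lemma hasDerivAt_orbit (π : UnitaryRep V) (X : sl2) (u : π.smooth) (t : ℝ) :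
    HasDerivAt (fun t : ℝ => π.toHom (expG (t • X)) (u : V))
      (π.toHom (expG (t • X)) (π.dpi X u)) t := by
  have h0 : HasDerivAt (fun s : ℝ => π.toHom (expG (s • X)) (u : V)) (π.dpi X u) (t - t) := by
    rw [sub_self]; exact π.hasDerivAt_dpi X u
  have h := π.hasDerivAt_toHom_comp (expG (t • X)) (h0.comp_sub_const t t)
  refine h.congr_of_eventuallyEq (Filter.Eventually.of_forall fun s => ?_)
  simp only
  rw [← toHom_mul, ← expG_add_smul, add_sub_cancel]

lemma toHom_mem_diffVectors (π : UnitaryRep V) (h : SL(2, ℝ)) (n : ℕ) {u : V}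
    (hu : u ∈ π.diffVectors n) : π.toHom (proj h) u ∈ π.diffVectors n := by
  induction n generalizing u with
  | zero => exact Submodule.mem_top
  | succ n ih =>
    intro X
    obtain ⟨w, hw, hd⟩ := hu (Ad h⁻¹ X)
    refine ⟨_, ih hw, ?_⟩
    have := π.hasDerivAt_toHom_comp (proj h) hd
    refine this.congr_of_eventuallyEq (Filter.Eventually.of_forall fun t => ?_)
    have e := expG_Ad h⁻¹ t X
    simp only
    rw [← toHom_mul, ← toHom_mul]
    congr 2
    rw [map_inv] at e
    rw [eq_mul_inv_iff_mul_eq.2 e.symm]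
    group

lemma toHom_mem_smooth (π : UnitaryRep V) (h : SL(2, ℝ)) {u : V} (hu : u ∈ π.smooth) :
    π.toHom (proj h) u ∈ π.smooth :=
  (Submodule.mem_iInf _).2 fun n => π.toHom_mem_diffVectors h n ((Submodule.mem_iInf _).1 hu n)

/-- The action of the group on smooth vectors. -/
def toHomS (π : UnitaryRep V) (h : SL(2, ℝ)) (u : π.smooth) : π.smooth :=
  ⟨π.toHom (proj h) u, π.toHom_mem_smooth h u.2⟩

lemma toHomS_coe (π : UnitaryRep V) (h : SL(2, ℝ)) (u : π.smooth) :
    (π.toHomS h u : V) = π.toHom (proj h) u := rfl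

lemma dpi_eq_of_hasDerivAt (π : UnitaryRep V) {X : sl2} {u w : π.smooth}
    (h : HasDerivAt (fun t : ℝ => π.toHom (expG (t • X)) (u : V)) w 0) : π.dpi X u = w :=
  Subtype.ext h.deriv

lemma dpi_Ad (π : UnitaryRep V) (h : SL(2, ℝ)) (X : sl2) (u : π.smooth) :
    π.dpi (Ad h X) (π.toHomS h u) = π.toHomS h (π.dpi X u) := by
  refine π.dpi_eq_of_hasDerivAt ?_
  have := π.hasDerivAt_toHom_comp (proj h) (π.hasDerivAt_dpi X u)
  refine this.congr_of_eventuallyEq (Filter.Eventually.of_forall fun t => ?_)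
  simp only [toHomS_coe]
  rw [← toHom_mul, ← toHom_mul, expG_Ad]

lemma dpi_toHomS_expS (π : UnitaryRep V) (X : sl2) (t : ℝ) (u : π.smooth) :
    π.dpi X (π.toHomS (expS (t • X)) u) = π.toHomS (expS (t • X)) (π.dpi X u) := by
  refine π.dpi_eq_of_hasDerivAt ?_
  have := π.hasDerivAt_toHom_comp (expG (t • X)) (π.hasDerivAt_dpi X u)
  refine this.congr_of_eventuallyEq (Filter.Eventually.of_forall fun s => ?_)
  simp only [toHomS_coe]
  rw [← expG_eq, ← toHom_mul, ← toHom_mul, ← expG_add_smul, ← expG_add_smul, add_comm]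

lemma inner_dpi_left (π : UnitaryRep V) (X : sl2) (u v : π.smooth) :
    ⟪(π.dpi X u : V), v⟫_ℂ = -⟪(u : V), π.dpi X v⟫_ℂ := by
  have h := (π.hasDerivAt_dpi X u).inner ℂ (π.hasDerivAt_dpi X v)
  simp only [LinearIsometryEquiv.inner_map_map, zero_smul, expG_zero, toHom_one] at h
  have := h.unique (hasDerivAt_const (0 : ℝ) (⟪(u : V), v⟫_ℂ))
  rw [add_comm] at this
  exact eq_neg_of_add_eq_zero_left this

lemma inner_dpi_right (π : UnitaryRep V) (X : sl2) (u v : π.smooth) :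
    ⟪(u : V), π.dpi X v⟫_ℂ = -⟪(π.dpi X u : V), v⟫_ℂ := by rw [inner_dpi_left, neg_neg]

lemma garding_add_smul (π : UnitaryRep V) {f g : Cols → ℝ} (hf : IsTest f) (hg : IsTest g)
    (a b : ℝ) (u : V) :
    π.garding (fun p => a * f p + b * g p) u = a • π.garding f u + b • π.garding g u := by
  have e : ∫ p, (a • π.weighted f u p + b • π.weighted g u p)
      = a • π.garding f u + b • π.garding g u := by
    refine (integral_add ((π.integrable_weighted hf u).smul a)
      ((π.integrable_weighted hg u).smul b)).trans ?_
    simp only [Pi.smul_apply]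
    rw [integral_smul, integral_smul, garding, garding]
  rw [← e, garding]
  refine integral_congr_ae (Filter.Eventually.of_forall fun p => ?_)
  simp only [weighted, add_smul, mul_smul]

variable [CompleteSpace V]

lemma ext_garding_smooth (π : UnitaryRep V) {u v : π.smooth}
    (h : ∀ f (hf : IsTest f) (y : V), ⟪(u : V), (⟨π.garding f y, π.garding_mem_smooth hf y⟩ :
      π.smooth)⟫_ℂ = ⟪(v : V), (⟨π.garding f y, π.garding_mem_smooth hf y⟩ : π.smooth)⟫_ℂ) :
    u = v :=
  Subtype.ext (π.ext_garding fun f hf y => h f hf y)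

/-- `dpi` is defined one one-parameter group at a time, so linearity in the Lie algebra needs an
argument. Skew-symmetry moves the operators to Gårding vectors, where they become the operators
`lieD` on test functions, which are visibly linear. -/
lemma dpi_add_smul (π : UnitaryRep V) (a b : ℝ) (X Y : sl2) (u : π.smooth) :
    π.dpi (a • X + b • Y) u = (a : ℂ) • π.dpi X u + (b : ℂ) • π.dpi Y u := by
  refine π.ext_garding_smooth fun f hf y => ?_
  rw [inner_dpi_left, Submodule.coe_add, Submodule.coe_smul, Submodule.coe_smul, inner_add_left,
    inner_smul_left, inner_smul_left, inner_dpi_left, inner_dpi_left, dpi_garding π hf,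
    dpi_garding π hf, dpi_garding π hf]
  have : lieD (a • X + b • Y) f = fun p => a * lieD X f p + b * lieD Y f p :=
    funext fun p => lieD_add_smul a b X Y f p
  simp only [this]
  rw [π.garding_add_smul (hf.lieD X) (hf.lieD Y), ← Complex.coe_smul, ← Complex.coe_smul,
    inner_add_right, inner_smul_right, inner_smul_right]
  simp only [Complex.conj_ofReal]
  ring

/-- By the same duality the bracket relation reduces to `lieD_comm`. Skew-symmetry is used twice,
which reverses the order of the two operators on the test function. -/
lemma dpi_comm (π : UnitaryRep V) (X Y Z : sl2)
    (hZ : (Z : Matrix (Fin 2) (Fin 2) ℝ) = X * Y - Y * X) (u : π.smooth) :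
    π.dpi X (π.dpi Y u) - π.dpi Y (π.dpi X u) = π.dpi Z u := by
  refine π.ext_garding_smooth fun f hf y => ?_
  have h2 : ∀ X Y : sl2, ⟪(π.dpi X (π.dpi Y u) : V), (⟨π.garding f y,
      π.garding_mem_smooth hf y⟩ : π.smooth)⟫_ℂ = ⟪(u : V), π.garding (lieD Y (lieD X f)) y⟫_ℂ := by
    intro X Y
    rw [inner_dpi_left, dpi_garding π hf, inner_dpi_left, dpi_garding π (hf.lieD X), neg_neg]
  rw [Submodule.coe_sub, inner_sub_left, h2, h2, inner_dpi_left, dpi_garding π hf]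
  have : lieD Z f = fun p => 1 * lieD X (lieD Y f) p + (-1) * lieD Y (lieD X f) p :=
    funext fun p => by rw [← lieD_comm hf X Y Z hZ p]; ring
  simp only [this]
  rw [π.garding_add_smul ((hf.lieD Y).lieD X) ((hf.lieD X).lieD Y), one_smul, neg_one_smul,
    inner_add_right, inner_neg_right]
  ring

/-- A vector which is weakly differentiable along `X` is differentiable along `X`. -/
lemma hasDerivAt_of_weak (π : UnitaryRep V) (X : sl2) {u w : V}
    (h : ∀ v : π.smooth, ⟪w, v⟫_ℂ = -⟪u, π.dpi X v⟫_ℂ) :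
    HasDerivAt (fun t : ℝ => π.toHom (expG (t • X)) u) w 0 := by
  have hcw : Continuous fun t : ℝ => π.toHom (expG (t • X)) w :=
    (π.continuous_orbit w).comp (continuous_expG_smul X)
  -- The orbit of `u` is shown to be `u` plus this integral: paired with any smooth vector, the
  -- difference has zero derivative, and smooth vectors are dense.
  set I : ℝ → V := fun t => ∫ s in (0 : ℝ)..t, π.toHom (expG (s • X)) w with hI
  have hId : ∀ t, HasDerivAt I (π.toHom (expG (t • X)) w) t := fun t =>
    (hcw.integral_hasStrictDerivAt 0 t).hasDerivAt
  have key : ∀ t, π.toHom (expG (t • X)) u = I t + u := by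
    intro t
    have hz : ∀ v ∈ π.smooth, ⟪π.toHom (expG (t • X)) u, v⟫_ℂ = ⟪I t + u, v⟫_ℂ := by
      intro v hv
      have hd : ∀ s : ℝ, HasDerivAt (fun s : ℝ => ⟪π.toHom (expG (s • X)) u, v⟫_ℂ - ⟪I s, v⟫_ℂ)
          0 s := by
        intro s
        have h1 : HasDerivAt (fun s : ℝ => π.toHom (expG ((-s) • X)) v)
            (-(π.toHom (expG ((-s) • X)) (π.dpi X ⟨v, hv⟩))) s := by
          have := (π.hasDerivAt_orbit X ⟨v, hv⟩ (-s)).scomp s (hasDerivAt_neg s)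
          rw [neg_one_smul] at this
          exact this
        have h2 := (hasDerivAt_const s u).inner ℂ h1
        have h3 := (hId s).inner ℂ (hasDerivAt_const s v)
        refine ((h2.sub h3).congr_of_eventuallyEq (Filter.Eventually.of_forall fun r => ?_)
          ).congr_deriv ?_
        · simp only [Pi.sub_apply]
          rw [inner_toHom_left, ← expG_neg_smul, neg_smul]
        · have h4 := h (π.toHomS (expS ((-s) • X)) ⟨v, hv⟩)
          rw [dpi_toHomS_expS, toHomS_coe, toHomS_coe, ← expG_eq] at h4
          rw [inner_neg_right, ← h4, inner_toHom_left, ← expG_neg_smul, neg_smul]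
          simp
      have := is_const_of_deriv_eq_zero (fun s => (hd s).differentiableAt)
        (fun s => (hd s).deriv) t 0
      simp only [hI, intervalIntegral.integral_same, zero_smul, expG_zero, toHom_one,
        inner_zero_left, sub_zero] at this
      rw [inner_add_left, ← this, hI]
      ring
    have := π.dense_smooth.eq_of_inner_left (𝕜 := ℂ) (x := π.toHom (expG (t • X)) u) (y := I t + u)
      (fun v hv => hz v hv)
    exact this
  have h0 := (hId 0).add_const u
  rw [zero_smul, expG_zero, toHom_one] at h0
  exact h0.congr_of_eventuallyEq (Filter.Eventually.of_forall key)

end UnitaryRep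

end Relations

/-! ### Decomposition into weight spaces of the rotation group -/

section KTypes

open scoped InnerProductSpace Topology
open MeasureTheory Complex

/-- A continuous `2 π`-periodic function whose Fourier coefficients vanish is zero at zero. -/
lemma eq_zero_of_fourier_integral_eq_zero {f : ℝ → ℂ} (hf : Continuous f)
    (hp : Function.Periodic f (2 * Real.pi))
    (h : ∀ k : ℤ, ∫ t in (0 : ℝ)..2 * Real.pi, exp (-(k * t) * I) * f t = 0) : f 0 = 0 := by
  have : Fact (0 < 2 * Real.pi) := ⟨Real.two_pi_pos⟩
  let F : C(AddCircle (2 * Real.pi), ℂ) := ⟨hp.lift, continuous_coinduced_dom.2 hf⟩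
  have hF : ∀ k, fourierCoeff F k = 0 := by
    intro k
    rw [fourierCoeff_eq_intervalIntegral _ k 0, zero_add]
    have e : ∀ x : ℝ, fourier (-k) (x : AddCircle (2 * Real.pi)) • F x
        = exp (-(k * x) * I) * f x := by
      intro x
      rw [fourier_coe_apply, smul_eq_mul]
      have h1 : F (x : AddCircle (2 * Real.pi)) = f x := rfl
      rw [h1]
      congr 2
      have : (Real.pi : ℂ) ≠ 0 := by exact_mod_cast Real.pi_ne_zero
      push_cast
      field_simp
    simp_rw [e, h k, smul_zero]
  have hs : Summable (fourierCoeff F) := by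
    rw [show fourierCoeff F = fun _ => 0 from funext hF]
    exact summable_zero
  have h0 := has_pointwise_sum_fourier_series_of_summable hs (0 : ℝ)
  simp only [hF, zero_smul] at h0
  exact (h0.unique hasSum_zero)

variable {V : Type*} [NormedAddCommGroup V] [InnerProductSpace ℂ V]

namespace UnitaryRep

/-- The action of the rotation group. -/
def rot (π : UnitaryRep V) (t : ℝ) : V ≃ₗᵢ[ℂ] V := π.toHom (expG (t • Xi))

lemma rot_add (π : UnitaryRep V) (s t : ℝ) (u : V) : π.rot (s + t) u = π.rot s (π.rot t u) := by
  rw [rot, expG_add_smul, toHom_mul]; rfl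

lemma rot_zero (π : UnitaryRep V) (u : V) : π.rot 0 u = u := by
  rw [rot, zero_smul, expG_zero, toHom_one]

lemma rot_two_pi (π : UnitaryRep V) (u : V) : π.rot (2 * Real.pi) u = u := by
  rw [rot, expG_two_pi_smul_Xi, toHom_one]

lemma continuous_rot (π : UnitaryRep V) (u : V) : Continuous fun t => π.rot t u :=
  (π.continuous_orbit u).comp (continuous_expG_smul Xi)

lemma inner_rot_left (π : UnitaryRep V) (t : ℝ) (u v : V) :
    ⟪π.rot t u, v⟫_ℂ = ⟪u, π.rot (-t) v⟫_ℂ := by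
  rw [rot, inner_toHom_left, rot, neg_smul, expG_neg_smul]

/-- The Fourier integrand `e^{-ikt} π(exp tΞ) u`. -/
def mode (π : UnitaryRep V) (k : ℤ) (u : V) (t : ℝ) : V := exp (-(k * t) * I) • π.rot t u

lemma continuous_mode (π : UnitaryRep V) (k : ℤ) (u : V) : Continuous (π.mode k u) :=
  Continuous.smul (by fun_prop) (π.continuous_rot u)

lemma norm_mode (π : UnitaryRep V) (k : ℤ) (u : V) (t : ℝ) : ‖π.mode k u t‖ = ‖u‖ := by
  rw [mode, norm_smul, LinearIsometryEquiv.norm_map]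
  have : -((k : ℂ) * t) * I = ((-(k * t) : ℝ) : ℂ) * I := by push_cast; ring
  rw [this, norm_exp_ofReal_mul_I, one_mul]

lemma mode_periodic (π : UnitaryRep V) (k : ℤ) (u : V) :
    Function.Periodic (π.mode k u) (2 * Real.pi) := by
  intro t
  simp only [mode]
  rw [rot_add, rot_two_pi]
  congr 1
  have : -((k : ℂ) * ((t + 2 * Real.pi : ℝ) : ℂ)) * I
      = -(k * t) * I + ((-k : ℤ) : ℂ) * (2 * Real.pi * I) := by push_cast; ring
  rw [this, exp_add, exp_int_mul_two_pi_mul_I, mul_one]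

lemma mode_rot (π : UnitaryRep V) (k : ℤ) (u : V) (s t : ℝ) :
    π.mode k (π.rot s u) t = exp (k * s * I) • π.mode k u (t + s) := by
  simp only [mode]
  rw [rot_add, smul_smul, ← exp_add]
  congr 2
  push_cast
  ring

lemma mode_neg (π : UnitaryRep V) (k : ℤ) (u v : V) (t : ℝ) :
    ⟪u, π.mode k v t⟫_ℂ = ⟪π.mode k u (-t), v⟫_ℂ := by
  simp only [mode]
  rw [inner_smul_left, inner_smul_right, inner_rot_left, neg_neg, ← exp_conj]
  congr 2
  simp

/-- The projection to the vectors of weight `k` under the rotation group. -/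
def projK (π : UnitaryRep V) (k : ℤ) : V →L[ℂ] V :=
  LinearMap.mkContinuous
    { toFun := fun u => (1 / (2 * Real.pi) : ℂ) • ∫ t in (0 : ℝ)..2 * Real.pi, π.mode k u t
      map_add' := by
        intro u v
        rw [← smul_add, ← intervalIntegral.integral_add
          ((π.continuous_mode k u).intervalIntegrable _ _)
          ((π.continuous_mode k v).intervalIntegrable _ _)]
        simp only [mode, map_add, smul_add]
      map_smul' := by
        intro c u
        have h : ∀ t, π.mode k (c • u) t = c • π.mode k u t := fun t => by
          simp only [mode, map_smul]
          rw [smul_comm]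
        simp_rw [h]
        rw [RingHom.id_apply, smul_comm, intervalIntegral.integral_smul] } 1 (by
    intro u
    have h := intervalIntegral.norm_integral_le_of_norm_le_const (a := 0) (b := 2 * Real.pi)
      (f := π.mode k u) (C := ‖u‖) fun t _ => (π.norm_mode k u t).le
    simp only [LinearMap.coe_mk, AddHom.coe_mk]
    rw [norm_smul, one_mul]
    have h2 : ‖(1 / (2 * Real.pi) : ℂ)‖ = 1 / (2 * Real.pi) := by
      rw [show (1 / (2 * Real.pi) : ℂ) = ((1 / (2 * Real.pi) : ℝ) : ℂ) by push_cast; ring,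
        Complex.norm_real, Real.norm_of_nonneg (by positivity)]
    rw [sub_zero, abs_of_pos Real.two_pi_pos] at h
    rw [h2]
    calc 1 / (2 * Real.pi) * ‖∫ t in (0 : ℝ)..2 * Real.pi, π.mode k u t‖
        ≤ 1 / (2 * Real.pi) * (‖u‖ * (2 * Real.pi)) := by gcongr
      _ = ‖u‖ := by have := Real.pi_pos; field_simp)

lemma projK_apply (π : UnitaryRep V) (k : ℤ) (u : V) :
    π.projK k u = (1 / (2 * Real.pi) : ℂ) • ∫ t in (0 : ℝ)..2 * Real.pi, π.mode k u t := rfl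

/-- The vectors of weight `k`. -/
def weightSpace (π : UnitaryRep V) (k : ℤ) : Submodule ℂ V :=
  ((π.projK k - 1 : V →L[ℂ] V) : V →ₗ[ℂ] V).ker

lemma mem_weightSpace (π : UnitaryRep V) (k : ℤ) (u : V) :
    u ∈ π.weightSpace k ↔ π.projK k u = u := by
  rw [weightSpace, LinearMap.mem_ker]
  simp [sub_eq_zero]

lemma projK_rot (π : UnitaryRep V) (k : ℤ) (s : ℝ) (u : V) :
    π.projK k (π.rot s u) = exp (k * s * I) • π.projK k u := by
  rw [projK_apply, projK_apply, smul_comm, ← intervalIntegral.integral_smul]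
  simp_rw [mode_rot, intervalIntegral.integral_smul]
  rw [intervalIntegral.integral_comp_add_right (fun t => π.mode k u t), zero_add, add_comm,
    (π.mode_periodic k u).intervalIntegral_add_eq s 0, zero_add]

variable [CompleteSpace V]

lemma inner_projK_right_eq (π : UnitaryRep V) (k : ℤ) (u v : V) :
    ⟪u, π.projK k v⟫_ℂ
      = (1 / (2 * Real.pi) : ℂ) * ∫ t in (0 : ℝ)..2 * Real.pi, ⟪u, π.mode k v t⟫_ℂ := by
  rw [projK_apply, inner_smul_right]
  congr 1
  exact ((innerSL ℂ u).intervalIntegral_comp_comm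
    ((π.continuous_mode k v).intervalIntegrable _ _)).symm

lemma inner_projK_right (π : UnitaryRep V) (k : ℤ) (u v : V) :
    ⟪u, π.projK k v⟫_ℂ = ⟪π.projK k u, v⟫_ℂ := by
  have hconj : ∀ f : ℝ → ℂ, conj (∫ t in (0 : ℝ)..2 * Real.pi, f t)
      = ∫ t in (0 : ℝ)..2 * Real.pi, conj (f t) := by
    intro f
    rw [intervalIntegral.integral_of_le Real.two_pi_pos.le,
      intervalIntegral.integral_of_le Real.two_pi_pos.le, integral_conj]
  rw [← inner_conj_symm (π.projK k u), inner_projK_right_eq, inner_projK_right_eq, map_mul, hconj]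
  congr 1
  · rw [map_div₀, map_one, map_mul, conj_ofReal, map_ofNat]
  simp_rw [inner_conj_symm, mode_neg]
  have hper : Function.Periodic (fun t => ⟪π.mode k u t, v⟫_ℂ) (2 * Real.pi) := fun t => by
    simp only [π.mode_periodic k u t]
  rw [intervalIntegral.integral_comp_neg (fun t => ⟪π.mode k u t, v⟫_ℂ), neg_zero]
  have := hper.intervalIntegral_add_eq (-(2 * Real.pi)) 0
  rwa [neg_add_cancel, zero_add] at this

lemma projK_eq_self (π : UnitaryRep V) (k : ℤ) {u : V}
    (h : ∀ t, π.rot t u = exp (k * t * I) • u) : π.projK k u = u := by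
  have : ∀ t, π.mode k u t = u := by
    intro t
    rw [mode, h, smul_smul, ← exp_add]
    simp
  rw [projK_apply]
  simp_rw [this]
  rw [intervalIntegral.integral_const, sub_zero, ← Complex.coe_smul, smul_smul]
  have : (Real.pi : ℂ) ≠ 0 := by exact_mod_cast Real.pi_ne_zero
  push_cast
  field_simp
  rw [one_smul]

lemma rot_projK (π : UnitaryRep V) (k : ℤ) (s : ℝ) (u : V) :
    π.rot s (π.projK k u) = exp (k * s * I) • π.projK k u := by
  refine ext_inner_left ℂ fun v => ?_
  rw [← neg_neg s, ← inner_rot_left, inner_projK_right, projK_rot, inner_smul_left,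
    inner_smul_right, inner_projK_right, ← exp_conj]
  simp

lemma projK_projK_self (π : UnitaryRep V) (k : ℤ) (u : V) :
    π.projK k (π.projK k u) = π.projK k u :=
  π.projK_eq_self k fun t => π.rot_projK k t u

lemma inner_projK_of_ne (π : UnitaryRep V) {j k : ℤ} (hjk : j ≠ k) (u v : V) :
    ⟪π.projK j u, π.projK k v⟫_ℂ = 0 := by
  have h := fun s => (π.rot s).inner_map_map (π.projK j u) (π.projK k v)
  -- For this angle the two weights differ by the factor `-1`, while the rotation preserves the
  -- inner product.
  set s : ℝ := Real.pi / (k - j) with hs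
  have hkj : ((k : ℝ) - j) ≠ 0 := by
    rw [sub_ne_zero]; exact_mod_cast hjk.symm
  have h1 := h s
  rw [rot_projK, rot_projK, inner_smul_left, inner_smul_right, ← mul_assoc, ← exp_conj,
    ← exp_add] at h1
  have h2 : (starRingEnd ℂ) (j * s * I) + k * s * I = Real.pi * I := by
    have : ((k : ℂ) - j) ≠ 0 := by exact_mod_cast hkj
    simp only [map_mul, conj_I, conj_ofReal, hs, map_intCast]
    push_cast
    field_simp
    ring
  rw [h2, exp_pi_mul_I] at h1
  linear_combination (-1 / 2 : ℂ) * h1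

lemma projK_projK_of_ne (π : UnitaryRep V) {j k : ℤ} (hjk : j ≠ k) (u : V) :
    π.projK j (π.projK k u) = 0 := by
  refine ext_inner_left ℂ fun v => ?_
  rw [inner_projK_right, inner_projK_of_ne π hjk, inner_zero_right]

/-- The continuous periodic function `t ↦ ⟪u, π.rot t u⟫` has Fourier coefficients `⟪u, π.projK k
u⟫`. If they vanish, so does its value at `0`, which is `‖u‖²`. -/
lemma eq_zero_of_projK_eq_zero (π : UnitaryRep V) {u : V} (h : ∀ k, π.projK k u = 0) : u = 0 := by
  have h0 := eq_zero_of_fourier_integral_eq_zero (f := fun t => ⟪u, π.rot t u⟫_ℂ)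
    (continuous_const.inner (π.continuous_rot u))
    (fun t => by simp only; rw [rot_add, rot_two_pi]) fun k => by
      have h1 := π.inner_projK_right_eq k u u
      rw [h k, inner_zero_right] at h1
      simp only [mode, inner_smul_right] at h1
      have hpi : (1 / (2 * Real.pi) : ℂ) ≠ 0 := by
        have : (Real.pi : ℂ) ≠ 0 := by exact_mod_cast Real.pi_ne_zero
        simp [this]
      exact (mul_eq_zero.1 h1.symm).resolve_left hpi
  simp only [rot_zero] at h0
  exact inner_self_eq_zero.1 h0

lemma isHilbertSum_weightSpace (π : UnitaryRep V) :
    IsHilbertSum ℂ (fun k => π.weightSpace k) fun k => (π.weightSpace k).subtypeₗᵢ := by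
  have : ∀ k, CompleteSpace (π.weightSpace k) := fun k =>
    (ContinuousLinearMap.isClosed_ker (π.projK k - 1)).completeSpace_coe
  refine IsHilbertSum.mkInternal _ ?_ ?_
  · intro j k hjk u v
    have hu := (π.mem_weightSpace j u).1 u.2
    have hv := (π.mem_weightSpace k v).1 v.2
    simp only [Submodule.coe_subtypeₗᵢ, Submodule.coe_subtype]
    rw [← hu, ← hv, inner_projK_of_ne π hjk]
  · rw [top_le_iff, Submodule.topologicalClosure_eq_top_iff, Submodule.eq_bot_iff]
    intro w hw
    refine π.eq_zero_of_projK_eq_zero fun k => ?_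
    have hmem : π.projK k w ∈ ⨆ k, π.weightSpace k :=
      Submodule.mem_iSup_of_mem k ((π.mem_weightSpace k _).2 (π.projK_projK_self k w))
    have := (Submodule.mem_orthogonal _ _).1 hw _ hmem
    rw [← inner_projK_right] at this
    rw [← inner_self_eq_zero (𝕜 := ℂ), ← inner_projK_right, projK_projK_self,
      inner_projK_right, ← inner_projK_right, this]

lemma hasSum_projK (π : UnitaryRep V) (u : V) : HasSum (fun k : ℤ => π.projK k u) u := by
  have hH := π.isHilbertSum_weightSpace
  have h := hH.hasSum_linearIsometryEquiv_symm (hH.linearIsometryEquiv u)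
  rw [LinearIsometryEquiv.symm_apply_apply] at h
  convert h using 2 with k
  have hk := (π.projK k).hasSum h
  refine hk.unique ?_
  convert hasSum_single k fun j hj => ?_ using 1
  · exact ((π.mem_weightSpace k _).1 (hH.linearIsometryEquiv u k).2).symm
  · simp only [Submodule.coe_subtypeₗᵢ, Submodule.coe_subtype]
    rw [← (π.mem_weightSpace j _).1 (hH.linearIsometryEquiv u j).2, projK_projK_of_ne π hj.symm]

lemma hasSum_inner_projK (π : UnitaryRep V) (u v : V) :
    HasSum (fun k : ℤ => ⟪π.projK k u, π.projK k v⟫_ℂ) ⟪u, v⟫_ℂ := by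
  have e : ∀ k, ⟪π.projK k u, π.projK k v⟫_ℂ = ⟪u, π.projK k v⟫_ℂ := fun k => by
    rw [← inner_projK_right, projK_projK_self]
  simp_rw [e]
  exact (innerSL ℂ u).hasSum (π.hasSum_projK v)

lemma hasSum_norm_sq_projK (π : UnitaryRep V) (u : V) :
    HasSum (fun k : ℤ => ‖π.projK k u‖ ^ 2) (‖u‖ ^ 2) := by
  have h := Complex.reCLM.hasSum (π.hasSum_inner_projK u u)
  simpa [Function.comp_def, inner_self_eq_norm_sq_to_K, ← ofReal_pow] using h

end UnitaryRep

end KTypes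

/-! ### Ladder operators and their norms -/

section Ladder

open scoped InnerProductSpace Topology
open MeasureTheory Complex

lemma inner_self_ofReal {V : Type*} [NormedAddCommGroup V] [InnerProductSpace ℂ V] (u : V) :
    ⟪u, u⟫_ℂ = ((‖u‖ ^ 2 : ℝ) : ℂ) := by
  rw [inner_self_eq_norm_sq_to_K]; simp

variable {V : Type*} [NormedAddCommGroup V] [InnerProductSpace ℂ V]

namespace UnitaryRep

/-- The ladder operators `H + e i B`, `e = ±1`. -/
def ladder (π : UnitaryRep V) (e : ℤ) : Module.End ℂ π.smooth :=
  π.dpi Hg + ((e : ℂ) * I) • π.dpi Bg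

lemma ladder_apply (π : UnitaryRep V) (e : ℤ) (u : π.smooth) :
    π.ladder e u = π.dpi Hg u + ((e : ℂ) * I) • π.dpi Bg u := rfl

lemma inner_ladder_left (π : UnitaryRep V) (e : ℤ) (u v : π.smooth) :
    ⟪(π.ladder e u : V), v⟫_ℂ = -⟪(u : V), π.ladder (-e) v⟫_ℂ := by
  simp only [ladder_apply, Submodule.coe_add, Submodule.coe_smul, inner_add_left, inner_add_right,
    inner_smul_left, inner_smul_right, inner_dpi_left, map_mul, conj_I, map_intCast]
  push_cast
  ring

lemma dpi_Hg_eq (π : UnitaryRep V) (u : π.smooth) :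
    π.dpi Hg u = (1 / 2 : ℂ) • (π.ladder 1 u + π.ladder (-1) u) := by
  simp only [ladder_apply]
  push_cast
  module

lemma dpi_Bg_eq (π : UnitaryRep V) (u : π.smooth) :
    π.dpi Bg u = (-I / 2 : ℂ) • (π.ladder 1 u - π.ladder (-1) u) := by
  simp only [ladder_apply]
  have h : (-I / 2 : ℂ) • ((π.dpi Hg u + (((1 : ℤ) : ℂ) * I) • π.dpi Bg u)
      - (π.dpi Hg u + (((-1 : ℤ) : ℂ) * I) • π.dpi Bg u)) = (-(I * I)) • π.dpi Bg u := by
    push_cast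
    module
  rw [h, I_mul_I, neg_neg, one_smul]

/-- The Casimir identity paired with `v`; skew-symmetry turns each square of a generator into minus
a squared norm. -/
lemma norm_sq_Hg_add_Bg (π : UnitaryRep V) {lam : ℝ} (h : π.HasCasimirScalar lam) (v : π.smooth) :
    ‖(π.dpi Hg v : V)‖ ^ 2 + ‖(π.dpi Bg v : V)‖ ^ 2
      = ‖(π.dpi Xi v : V)‖ ^ 2 + lam / 4 * ‖(v : V)‖ ^ 2 := by
  have h1 := congrArg (fun A : Module.End ℂ π.smooth => ⟪(v : V), (A v : V)⟫_ℂ) h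
  simp only [casimir, LinearMap.sub_apply, LinearMap.smul_apply, pow_two, Module.End.mul_apply,
    Module.End.one_apply, Submodule.coe_sub, Submodule.coe_smul, inner_sub_right, inner_smul_right,
    inner_dpi_right, inner_self_ofReal] at h1
  have h2 : (4 : ℝ) * -(‖(π.dpi Xi v : V)‖ ^ 2) - 4 * -(‖(π.dpi Hg v : V)‖ ^ 2)
      - 4 * -(‖(π.dpi Bg v : V)‖ ^ 2) = lam * ‖(v : V)‖ ^ 2 := by
    simp only [← pow_two] at h1
    exact_mod_cast h1
  linarith

variable [CompleteSpace V]

/-- `H + eiB` is an eigenvector of the adjoint action of rotations, with eigenvalue `exp(iet)`. This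
is why it shifts weights by `e`. -/
lemma toHomS_ladder (π : UnitaryRep V) {e : ℤ} (he : e = 1 ∨ e = -1) (t : ℝ) (u : π.smooth) :
    π.toHomS (expS (t • Xi)) (π.ladder e u)
      = exp (e * t * I) • π.ladder e (π.toHomS (expS (t • Xi)) u) := by
  have hadd : ∀ (c : ℂ) (v w : π.smooth), π.toHomS (expS (t • Xi)) (v + c • w)
      = π.toHomS (expS (t • Xi)) v + c • π.toHomS (expS (t • Xi)) w := fun c v w =>
    Subtype.ext (by simp [toHomS_coe])
  have hexp : exp (e * t * I) = Real.cos t + e * Real.sin t * I := by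
    rcases he with rfl | rfl
    · rw [exp_mul_I]; simp
    · rw [exp_mul_I]; simp [Complex.cos_neg, Complex.sin_neg]
  rw [ladder_apply, hadd, ← dpi_Ad, ← dpi_Ad, Ad_Xi_Hg, Ad_Xi_Bg, dpi_add_smul, dpi_add_smul,
    ladder_apply, hexp]
  have he2 : (e : ℂ) * e = 1 := by rcases he with rfl | rfl <;> norm_num
  have hB : -(Real.sin t : ℂ) + e * I * Real.cos t
      = (Real.cos t + e * Real.sin t * I) * (e * I) := by
    linear_combination (-(Real.sin t : ℂ)) * I * I * he2 - (Real.sin t : ℂ) * I_mul_I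
  have hr : ∀ p q : π.smooth, (Real.cos t + e * Real.sin t * I : ℂ) • (p + ((e : ℂ) * I) • q)
      = (Real.cos t + e * Real.sin t * I : ℂ) • p
        + ((Real.cos t + e * Real.sin t * I) * (e * I) : ℂ) • q := fun p q => by module
  rw [hr, ← hB]
  push_cast
  module

/-- The weight shift in weak form, with the ladder operator moved to the test vector: it is needed
to prove that `π.projK k u` is smooth, before the ladder operator can be applied to it. -/
lemma inner_projK_ladder (π : UnitaryRep V) {e : ℤ} (he : e = 1 ∨ e = -1) (k : ℤ)
    (u y : π.smooth) :
    ⟪(y : V), π.projK (k + e) (π.ladder e u)⟫_ℂ = -⟪(π.ladder (-e) y : V), π.projK k u⟫_ℂ := by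
  rw [inner_projK_right_eq, inner_projK_right_eq, ← mul_neg, ← intervalIntegral.integral_neg]
  congr 1
  refine intervalIntegral.integral_congr fun t _ => ?_
  have h := congrArg Subtype.val (π.toHomS_ladder he t u)
  rw [toHomS_coe, ← expG_eq, Submodule.coe_smul] at h
  have hr : π.mode (k + e) (π.ladder e u) t
      = exp (-(k * t) * I) • (π.ladder e (π.toHomS (expS (t • Xi)) u) : V) := by
    rw [mode, rot, h, smul_smul, ← exp_add]
    congr 2
    push_cast
    ring
  rw [hr, mode, inner_smul_right, inner_smul_right]
  have hl := π.inner_ladder_left (-e) y (π.toHomS (expS (t • Xi)) u)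
  rw [neg_neg, toHomS_coe, ← expG_eq] at hl
  rw [rot, hl]
  ring

lemma dpi_combination (π : UnitaryRep V) {X : sl2} {a b c : ℝ}
    (hX : X = a • Xi + (1 : ℝ) • (b • Hg + c • Bg)) (u : π.smooth) :
    π.dpi X u = (a : ℂ) • π.dpi Xi u + ((b : ℂ) • π.dpi Hg u + (c : ℂ) • π.dpi Bg u) := by
  rw [hX, dpi_add_smul, dpi_add_smul]
  simp

lemma hasDerivAt_rot_projK (π : UnitaryRep V) (k : ℤ) (u : V) :
    HasDerivAt (fun t : ℝ => π.toHom (expG (t • Xi)) (π.projK k u)) ((k * I) • π.projK k u) 0 := by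
  have h : HasDerivAt (fun t : ℝ => exp (k * t * I)) (k * I) 0 := by
    have h1 : HasDerivAt (fun t : ℝ => (k : ℂ) * (t : ℂ) * I) (k * I) 0 := by
      simpa using (((hasDerivAt_id (0 : ℝ)).ofReal_comp).const_mul (k : ℂ)).mul_const I
    simpa using h1.cexp
  exact (h.smul_const (π.projK k u)).congr_of_eventuallyEq
    (Filter.Eventually.of_forall fun t => π.rot_projK k t u)

lemma hasDerivAt_projK (π : UnitaryRep V) (k : ℤ) (u : π.smooth) {X : sl2} {a b c : ℝ}
    (hX : X = a • Xi + (1 : ℝ) • (b • Hg + c • Bg)) :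
    HasDerivAt (fun t : ℝ => π.toHom (expG (t • X)) (π.projK k u))
      ((a * (k * I) : ℂ) • π.projK k u
        + ((b / 2 - c * I / 2 : ℂ) • π.projK (k + 1) (π.ladder 1 u)
          + (b / 2 + c * I / 2 : ℂ) • π.projK (k + -1) (π.ladder (-1) u))) 0 := by
  refine π.hasDerivAt_of_weak X fun y => ?_
  rw [π.dpi_combination hX, dpi_Hg_eq, dpi_Bg_eq]
  have h1 := π.inner_projK_ladder (Or.inl rfl) k u y
  have h2 := π.inner_projK_ladder (Or.inr rfl) k u y
  have h3 : ⟪(y : V), (k * I) • π.projK k (u : V)⟫_ℂ = -⟪(π.dpi Xi y : V), π.projK k u⟫_ℂ := by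
    have hd := (π.hasDerivAt_dpi Xi y).inner ℂ (π.hasDerivAt_rot_projK k u)
    simp only [LinearIsometryEquiv.inner_map_map, zero_smul, expG_zero, toHom_one] at hd
    exact eq_neg_of_add_eq_zero_left
      (hd.unique (hasDerivAt_const (0 : ℝ) (⟪(y : V), π.projK k (u : V)⟫_ℂ)))
  rw [neg_neg] at h2
  rw [← inner_conj_symm, ← inner_conj_symm (π.projK k (u : V)), ← map_neg]
  congr 1
  rw [inner_smul_right] at h3
  simp only [Submodule.coe_add, Submodule.coe_sub, Submodule.coe_smul, inner_add_left,
    inner_add_right, inner_sub_left, inner_smul_left, inner_smul_right, h1, h2, map_div₀, map_neg,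
    conj_I, conj_ofReal, map_one, map_ofNat, mul_assoc] at h3 ⊢
  linear_combination (a : ℂ) * h3

/-- The derivative of `π.projK k u` along any direction is a combination of projections, to weights
`k` and `k ± 1`, of the smooth vectors `u` and `π.ladder (±1) u`; hence induction on the order of
differentiability, for all weights and all smooth `u` at once. -/
lemma projK_mem_smooth (π : UnitaryRep V) (k : ℤ) {u : V} (hu : u ∈ π.smooth) :
    π.projK k u ∈ π.smooth := by
  refine (Submodule.mem_iInf _).2 fun n => ?_
  induction n generalizing k u with
  | zero => exact Submodule.mem_top
  | succ n ih =>
    intro X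
    obtain ⟨a, b, c, hX⟩ := exists_eq_combination X
    refine ⟨_, ?_, π.hasDerivAt_projK k ⟨u, hu⟩ hX⟩
    exact Submodule.add_mem _ (Submodule.smul_mem _ _ (ih k hu)) (Submodule.add_mem _
      (Submodule.smul_mem _ _ (ih _ (Subtype.mem _))) (Submodule.smul_mem _ _ (ih _ (Subtype.mem _))))

/-- The projection to weight `k`, on smooth vectors. -/
def projS (π : UnitaryRep V) (k : ℤ) (u : π.smooth) : π.smooth :=
  ⟨π.projK k u, π.projK_mem_smooth k u.2⟩

lemma projS_coe (π : UnitaryRep V) (k : ℤ) (u : π.smooth) :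
    (π.projS k u : V) = π.projK k u := rfl

lemma dpi_Xi_projS (π : UnitaryRep V) (k : ℤ) (u : π.smooth) :
    π.dpi Xi (π.projS k u) = ((k : ℂ) * I) • π.projS k u :=
  π.dpi_eq_of_hasDerivAt (π.hasDerivAt_rot_projK k u)

lemma dpi_Xi_eq_of_projK_eq (π : UnitaryRep V) (k : ℤ) {u : π.smooth}
    (hu : π.projK k u = (u : V)) : π.dpi Xi u = ((k : ℂ) * I) • u := by
  have h : π.projS k u = u := Subtype.ext hu
  rw [← h, dpi_Xi_projS]

lemma projK_dpi_Xi (π : UnitaryRep V) (k : ℤ) (u : π.smooth) :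
    π.projK k (π.dpi Xi u) = ((k : ℂ) * I) • π.projK k u := by
  refine π.ext_garding fun f hf y => ?_
  set v : π.smooth := ⟨π.garding f y, π.garding_mem_smooth hf y⟩
  change ⟪π.projK k (π.dpi Xi u), (v : V)⟫_ℂ = ⟪((k : ℂ) * I) • π.projK k u, (v : V)⟫_ℂ
  rw [← inner_projK_right, ← projS_coe, inner_dpi_left, dpi_Xi_projS, Submodule.coe_smul,
    inner_smul_right, inner_smul_left, ← inner_projK_right, projS_coe]
  simp

lemma projK_ladder (π : UnitaryRep V) {e : ℤ} (he : e = 1 ∨ e = -1) (k : ℤ) (u : π.smooth) :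
    π.projK (k + e) (π.ladder e u) = (π.ladder e (π.projS k u) : V) := by
  refine π.ext_garding fun f hf y => ?_
  set v : π.smooth := ⟨π.garding f y, π.garding_mem_smooth hf y⟩
  change ⟪_, (v : V)⟫_ℂ = ⟪_, (v : V)⟫_ℂ
  rw [← inner_conj_symm, inner_projK_ladder π he, ← projS_coe, inner_ladder_left, neg_neg, neg_neg,
    inner_conj_symm]

/-- Expanding the square, the diagonal terms come from the Casimir identity, with `‖Ξv‖² = k²‖v‖²`,
and the cross terms from `[H, B] = Ξ`, which acts on `v` as `ik`. -/
lemma norm_sq_ladder (π : UnitaryRep V) {lam : ℝ} (h : π.HasCasimirScalar lam) {e : ℤ}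
    (he : e = 1 ∨ e = -1) (k : ℤ) {v : π.smooth} (hv : π.projK k v = (v : V)) :
    ‖(π.ladder e v : V)‖ ^ 2 = (k ^ 2 + e * k + lam / 4) * ‖(v : V)‖ ^ 2 := by
  have hX := π.dpi_Xi_eq_of_projK_eq k hv
  have h1 := π.norm_sq_Hg_add_Bg h v
  have h2 : ‖(π.dpi Xi v : V)‖ ^ 2 = k ^ 2 * ‖(v : V)‖ ^ 2 := by
    rw [hX, Submodule.coe_smul, norm_smul, mul_pow, norm_mul, norm_I, mul_one, Complex.norm_intCast,
      sq_abs]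
  have hc := π.dpi_comm Hg Bg Xi comm_Hg_Bg v
  have h3 : ⟪(π.dpi Hg v : V), π.dpi Bg v⟫_ℂ - ⟪(π.dpi Bg v : V), π.dpi Hg v⟫_ℂ
      = -(k * I) * ((‖(v : V)‖ ^ 2 : ℝ) : ℂ) := by
    have h4 := congrArg (fun w : π.smooth => ⟪(v : V), (w : V)⟫_ℂ) hc
    simp only [Submodule.coe_sub, inner_sub_right, hX, Submodule.coe_smul, inner_smul_right,
      inner_self_ofReal] at h4
    rw [inner_dpi_left, inner_dpi_left]
    linear_combination -h4
  have he2 : (e : ℂ) * e = 1 := by rcases he with rfl | rfl <;> norm_num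
  have h5 : ((‖(π.ladder e v : V)‖ ^ 2 : ℝ) : ℂ) = ((‖(π.dpi Hg v : V)‖ ^ 2 : ℝ) : ℂ)
      + ((‖(π.dpi Bg v : V)‖ ^ 2 : ℝ) : ℂ) + e * k * ((‖(v : V)‖ ^ 2 : ℝ) : ℂ) := by
    rw [← inner_self_ofReal, ladder_apply, Submodule.coe_add, Submodule.coe_smul, inner_add_left,
      inner_add_right, inner_add_right, inner_smul_left, inner_smul_right, inner_smul_left,
      inner_smul_right, inner_self_ofReal, inner_self_ofReal, map_mul, conj_I, map_intCast]
    linear_combination (e * I : ℂ) * h3 - (e * e * ((‖(π.dpi Bg v : V)‖ ^ 2 : ℝ) : ℂ)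
      + e * k * ((‖(v : V)‖ ^ 2 : ℝ) : ℂ)) * I_mul_I + ((‖(π.dpi Bg v : V)‖ ^ 2 : ℝ) : ℂ) * he2
  have h6 : ‖(π.ladder e v : V)‖ ^ 2 = ‖(π.dpi Hg v : V)‖ ^ 2 + ‖(π.dpi Bg v : V)‖ ^ 2
      + e * k * ‖(v : V)‖ ^ 2 := by exact_mod_cast h5
  rw [h6, h1, h2]
  ring

end UnitaryRep

end Ladder

/-! ### Existence, uniqueness and absence of spherical vectors -/

section Spherical

open scoped InnerProductSpace Topology
open MeasureTheory Complex

variable {V : Type*} [NormedAddCommGroup V] [InnerProductSpace ℂ V]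

/-- A function on `[0, ∞)` solving the radial Laplace equation
`sinh t f'' + cosh t f' + c sinh t f = 0` with `c > 0` and `f 0 = 0` vanishes. -/
lemma eq_zero_of_radial_ode {f g h : ℝ → ℂ} {c : ℝ} (hc : 0 < c)
    (hf : ∀ t, HasDerivAt f (g t) t) (hg : ∀ t, HasDerivAt g (h t) t)
    (ode : ∀ t, Real.sinh t * h t = -(Real.cosh t * g t) - c * (Real.sinh t * f t))
    (h0 : f 0 = 0) {t : ℝ} (ht : 0 ≤ t) : f t = 0 := by
  have hg0 : g 0 = 0 := by simpa using ode 0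
  -- An energy for the equation: `sinh t · E'(t) = -2 cosh t ‖g t‖² ≤ 0`. It starts at `0`, because
  -- the equation at `t = 0` forces `g 0 = 0`.
  set E : ℝ → ℝ := fun t => ‖g t‖ ^ 2 + c * ‖f t‖ ^ 2 with hE
  have hEd : ∀ t, HasDerivAt E (2 * ⟪g t, h t⟫_ℝ + c * (2 * ⟪f t, g t⟫_ℝ)) t := fun t =>
    (hg t).norm_sq.add ((hf t).norm_sq.const_mul c)
  have hanti : AntitoneOn E (Set.Ici 0) := by
    refine antitoneOn_of_deriv_nonpos (convex_Ici 0)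
      (fun s _ => (hEd s).continuousAt.continuousWithinAt)
      (fun s _ => (hEd s).differentiableAt.differentiableWithinAt) fun s hs => ?_
    rw [interior_Ici, Set.mem_Ioi] at hs
    rw [(hEd s).deriv]
    have hsinh : 0 < Real.sinh s := Real.sinh_pos_iff.2 hs
    have h1 : Real.sinh s * (2 * ⟪g s, h s⟫_ℝ + c * (2 * ⟪f s, g s⟫_ℝ))
        = -(2 * Real.cosh s * ‖g s‖ ^ 2) := by
      have h2 := congrArg (fun z => (conj (g s) * z).re) (ode s)
      simp only [Complex.inner, ← Complex.normSq_eq_norm_sq, Complex.normSq_apply]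
      simp [-Complex.ofReal_sinh, -Complex.ofReal_cosh] at h2 ⊢
      linear_combination 2 * h2
    have h3 : 0 ≤ 2 * Real.cosh s * ‖g s‖ ^ 2 := by positivity
    by_contra hneg
    push Not at hneg
    have := mul_pos hsinh hneg
    linarith
  have h1 := hanti (Set.mem_Ici.2 le_rfl) (Set.mem_Ici.2 ht) ht
  simp only [hE, h0, hg0, norm_zero] at h1
  have h2 : ‖f t‖ ^ 2 ≤ 0 := by
    have := sq_nonneg ‖g t‖
    nlinarith
  have h3 : ‖f t‖ = 0 := by nlinarith [norm_nonneg (f t)]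
  exact norm_eq_zero.1 h3

namespace UnitaryRep

variable [CompleteSpace V]

lemma exists_smooth_projK_ne_zero (π : UnitaryRep V) [Nontrivial V] :
    ∃ (k : ℤ) (u : π.smooth), (u : V) ≠ 0 ∧ π.projK k u = (u : V) := by
  by_contra hcon
  push Not at hcon
  have hz : ∀ u ∈ π.smooth, u = 0 := fun u hu => π.eq_zero_of_projK_eq_zero fun k => by
    by_contra hne
    exact hcon k (π.projS k ⟨u, hu⟩) hne (π.projK_projK_self k u)
  obtain ⟨v, hv⟩ := exists_ne (0 : V)
  exact hv (π.dense_smooth.eq_zero_of_inner_right (𝕜 := ℂ) fun w hw => by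
    rw [hz w hw, inner_zero_left])

lemma projK_ladder_of_projK_eq (π : UnitaryRep V) {e : ℤ} (he : e = 1 ∨ e = -1) {k : ℤ}
    {v : π.smooth} (hv : π.projK k v = (v : V)) :
    π.projK (k + e) (π.ladder e v) = (π.ladder e v : V) := by
  rw [projK_ladder π he, show π.projS k v = v from Subtype.ext hv]

/-- From a nonzero vector of weight `k`, step towards weight `0`. Each step multiplies the squared
norm by `k² - |k| + λ/4 > 0`, so the vector never vanishes on the way. -/
lemma exists_spherical (π : UnitaryRep V) [Nontrivial V] {lam : ℝ} (h : π.HasCasimirScalar lam)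
    (hlam : 0 < lam) : ∃ φ : π.smooth, ‖(φ : V)‖ = 1 ∧ π.projK 0 φ = (φ : V) := by
  have key : ∀ (n : ℕ) (k : ℤ) (v : π.smooth), k.natAbs = n → (v : V) ≠ 0 →
      π.projK k v = (v : V) → ∃ v : π.smooth, (v : V) ≠ 0 ∧ π.projK 0 v = (v : V) := by
    intro n
    induction n with
    | zero =>
      intro k v hk hv hkv
      rw [Int.natAbs_eq_zero] at hk
      exact ⟨v, hv, by rwa [← hk]⟩
    | succ n ih =>
      intro k v hk hv hkv
      have step : ∀ e : ℤ, (e = 1 ∨ e = -1) → 0 ≤ k ^ 2 + e * k → (k + e).natAbs = n →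
          ∃ v : π.smooth, (v : V) ≠ 0 ∧ π.projK 0 v = (v : V) := by
        intro e he hpos hn
        refine ih (k + e) (π.ladder e v) hn ?_ (π.projK_ladder_of_projK_eq he hkv)
        have h1 := π.norm_sq_ladder h he k hkv
        have h2 : (0 : ℝ) ≤ k ^ 2 + e * k := by exact_mod_cast hpos
        have h3 : 0 < ‖(v : V)‖ := norm_pos_iff.2 hv
        have h4 : 0 < ‖(π.ladder e v : V)‖ ^ 2 := by rw [h1]; positivity
        intro h0
        rw [h0, norm_zero] at h4
        norm_num at h4
      rcases lt_trichotomy k 0 with hk0 | hk0 | hk0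
      · exact step 1 (Or.inl rfl) (by nlinarith) (by omega)
      · simp [hk0] at hk
      · exact step (-1) (Or.inr rfl) (by nlinarith) (by omega)
  obtain ⟨k, u, hu, hk⟩ := π.exists_smooth_projK_ne_zero
  obtain ⟨v, hv, hv0⟩ := key _ k u rfl hu hk
  have hn : ‖(v : V)‖ ≠ 0 := norm_ne_zero_iff.2 hv
  refine ⟨((‖(v : V)‖⁻¹ : ℝ) : ℂ) • v, ?_, ?_⟩
  · rw [Submodule.coe_smul, norm_smul, Complex.norm_real, norm_inv, norm_norm,
      inv_mul_cancel₀ hn]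
  · rw [Submodule.coe_smul, map_smul, hv0]

lemma rot_of_projK_zero (π : UnitaryRep V) {u : V} (hu : π.projK 0 u = u) (t : ℝ) :
    π.rot t u = u := by
  have := π.rot_projK 0 t u
  rw [hu] at this
  simpa using this

lemma dpi_Xi_of_projK_zero (π : UnitaryRep V) {u : π.smooth} (hu : π.projK 0 u = (u : V)) :
    π.dpi Xi u = 0 := by
  rw [π.dpi_Xi_eq_of_projK_eq 0 hu]; simp

lemma inner_geodesic_eq_zero_of_nonneg (π : UnitaryRep V) {lam : ℝ} (h : π.HasCasimirScalar lam)
    (hlam : 0 < lam) {φ ψ : π.smooth} (hφ : π.projK 0 φ = (φ : V)) (hψ : π.projK 0 ψ = (ψ : V))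
    (h0 : ⟪(ψ : V), φ⟫_ℂ = 0) {t : ℝ} (ht : 0 ≤ t) :
    ⟪(ψ : V), π.toHom (expG (t • Hg)) φ⟫_ℂ = 0 := by
  have hder : ∀ (v : π.smooth) (s : ℝ),
      HasDerivAt (fun t : ℝ => ⟪(ψ : V), π.toHom (expG (t • Hg)) v⟫_ℂ)
        ⟪(ψ : V), π.toHom (expG (s • Hg)) (π.dpi Hg v)⟫_ℂ s := by
    intro v s
    have := (hasDerivAt_const s (ψ : V)).inner ℂ (π.hasDerivAt_orbit Hg v s)
    simpa using this
  refine eq_zero_of_radial_ode (c := lam / 4) (by linarith)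
    (f := fun t : ℝ => ⟪(ψ : V), π.toHom (expG (t • Hg)) φ⟫_ℂ)
    (g := fun t : ℝ => ⟪(ψ : V), π.toHom (expG (t • Hg)) (π.dpi Hg φ)⟫_ℂ)
    (h := fun t : ℝ => ⟪(ψ : V), π.toHom (expG (t • Hg)) (π.dpi Hg (π.dpi Hg φ))⟫_ℂ)
    (hder φ) (hder _) (fun s => ?_) (by simpa [expG_zero, toHom_one] using h0) ht
  have hXφ := π.dpi_Xi_of_projK_zero hφ
  have hXψ := π.dpi_Xi_of_projK_zero hψ
  have hHH : π.dpi Hg (π.dpi Hg φ) = -π.dpi Bg (π.dpi Bg φ) - (lam / 4 : ℂ) • φ := by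
    have h1 := congrArg (fun A : Module.End ℂ π.smooth => A φ) h
    simp only [casimir, LinearMap.sub_apply, LinearMap.smul_apply, pow_two, Module.End.mul_apply,
      Module.End.one_apply, hXφ, map_zero, smul_zero, zero_sub] at h1
    have h2 : (lam / 4 : ℂ) • φ = (1 / 4 : ℂ) • ((lam : ℂ) • φ) := by module
    rw [h2, ← h1]
    module
  have hXB : π.dpi Xi (π.dpi Bg φ) = π.dpi Hg φ := by
    have := π.dpi_comm Xi Bg Hg comm_Xi_Bg φ
    rwa [hXφ, map_zero, sub_zero] at this
  -- This eliminates `B²φ` and produces the radial equation. Conjugating `Ξ` by `exp(-sH)` gives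
  -- `cosh s · Ξ - sinh s · B`; applied to `Bφ` and paired with the `Ξ`-invariant `ψ` the total is
  -- zero, and `ΞBφ = Hφ` by `[Ξ, B] = H`.
  have hAd : Real.sinh s * ⟪(ψ : V), π.toHom (expG (s • Hg)) (π.dpi Bg (π.dpi Bg φ))⟫_ℂ
      = Real.cosh s * ⟪(ψ : V), π.toHom (expG (s • Hg)) (π.dpi Hg φ)⟫_ℂ := by
    set w : π.smooth := π.dpi Bg φ
    have h1 := π.dpi_Ad (expS ((-s) • Hg)) Xi (π.toHomS (expS (s • Hg)) w)
    have h2 : π.toHomS (expS ((-s) • Hg)) (π.toHomS (expS (s • Hg)) w) = w := by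
      refine Subtype.ext ?_
      rw [toHomS_coe, toHomS_coe, neg_smul, expS_neg, map_inv, toHom_inv_toHom]
    rw [h2, Ad_Hg_Xi, dpi_add_smul, hXB, Real.cosh_neg, Real.sinh_neg] at h1
    have h3 := congrArg (fun v : π.smooth => ⟪(ψ : V), π.toHom (expG (s • Hg)) v⟫_ℂ) h1
    simp only [toHomS_coe] at h3
    rw [neg_smul, expS_neg, map_inv, ← expG_eq, toHom_toHom_inv, inner_dpi_right, hXψ] at h3
    simp only [Submodule.coe_add, Submodule.coe_smul, map_add, map_smul, inner_add_right,
      inner_smul_right, Submodule.coe_zero, inner_zero_left, neg_zero] at h3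
    push_cast at h3 ⊢
    linear_combination -h3
  rw [hHH]
  simp only [Submodule.coe_sub, Submodule.coe_neg, Submodule.coe_smul, map_sub, map_neg, map_smul,
    inner_sub_right, inner_neg_right, inner_smul_right]
  push_cast at hAd ⊢
  linear_combination -hAd

lemma inner_toHom_eq_zero (π : UnitaryRep V) {lam : ℝ} (h : π.HasCasimirScalar lam)
    (hlam : 0 < lam) {φ ψ : π.smooth} (hφ : π.projK 0 φ = (φ : V)) (hψ : π.projK 0 ψ = (ψ : V))
    (h0 : ⟪(ψ : V), φ⟫_ℂ = 0) (g : PSL(2, ℝ)) : ⟪(ψ : V), π.toHom g φ⟫_ℂ = 0 := by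
  obtain ⟨a, t, b, rfl⟩ := exists_cartan g
  rw [toHom_mul, toHom_mul]
  have h1 := π.rot_of_projK_zero hφ b
  have h2 := π.inner_rot_left (-a) (ψ : V) (π.toHom (expG (t • Hg)) φ)
  rw [neg_neg, π.rot_of_projK_zero hψ] at h2
  rw [rot] at h1 h2
  rw [h1, ← h2]
  rcases le_total 0 t with ht | ht
  · exact π.inner_geodesic_eq_zero_of_nonneg h hlam hφ hψ h0 ht
  -- Negative times follow by exchanging `φ` and `ψ`, by unitarity.
  · have h3 := π.inner_geodesic_eq_zero_of_nonneg h hlam hψ hφ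
      (by rw [← inner_conj_symm, h0, map_zero]) (neg_nonneg.2 ht)
    rw [neg_smul, expG_neg_smul, ← inner_toHom_left] at h3
    rw [← inner_conj_symm, h3, map_zero]

/-- Spherical vectors of an irreducible representation with positive Casimir scalar are unique. -/
lemma spherical_eq_zero (π : UnitaryRep V) {lam : ℝ} (h : π.HasCasimirScalar lam)
    (hlam : 0 < lam) (hirr : π.IsIrreducible) {φ ψ : π.smooth} (hφ : π.projK 0 φ = (φ : V))
    (hψ : π.projK 0 ψ = (ψ : V)) (h0 : ⟪(ψ : V), φ⟫_ℂ = 0) (hne : (φ : V) ≠ 0) : (ψ : V) = 0 := by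
  -- The vectors whose orbit is orthogonal to `ψ` form a closed invariant subspace. It contains `φ ≠
  -- 0`, so it is everything, and in particular `ψ ⊥ ψ`.
  let W : Submodule ℂ V :=
    { carrier := {u | ∀ g, ⟪(ψ : V), π.toHom g u⟫_ℂ = 0}
      zero_mem' := fun g => by simp
      add_mem' := fun {a b} ha hb g => by rw [map_add, inner_add_right, ha g, hb g, add_zero]
      smul_mem' := fun c a ha g => by rw [map_smul, inner_smul_right, ha g, mul_zero] }
  have hcl : IsClosed (W : Set V) := by
    have : (W : Set V) = ⋂ g, {u | ⟪(ψ : V), π.toHom g u⟫_ℂ = 0} := by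
      ext u; simp [W]
    rw [this]
    exact isClosed_iInter fun g =>
      isClosed_eq (continuous_const.inner (π.toHom g).continuous) continuous_const
  have hφW : (φ : V) ∈ W := π.inner_toHom_eq_zero h hlam hφ hψ h0
  rcases hirr.2 W hcl fun g u hu g' => by rw [← toHom_mul]; exact hu _ with hW | hW
  · rw [hW, Submodule.mem_bot] at hφW
    exact absurd hφW hne
  · have hψW : (ψ : V) ∈ W := by rw [hW]; exact Submodule.mem_top
    have := hψW 1
    rw [toHom_one] at this
    exact inner_self_eq_zero.1 this

lemma projK_zero_eq (π : UnitaryRep V) {lam : ℝ} (h : π.HasCasimirScalar lam) (hlam : 0 < lam)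
    (hirr : π.IsIrreducible) {φ : π.smooth} (hφ : π.projK 0 φ = (φ : V)) (hn : ‖(φ : V)‖ = 1)
    (u : V) : π.projK 0 u = ⟪(φ : V), u⟫_ℂ • (φ : V) := by
  have hcl : IsClosed {u : V | π.projK 0 u = ⟪(φ : V), u⟫_ℂ • (φ : V)} :=
    isClosed_eq (π.projK 0).continuous (by fun_prop)
  have hsub : (π.smooth : Set V) ⊆ {u : V | π.projK 0 u = ⟪(φ : V), u⟫_ℂ • (φ : V)} := by
    intro u hu
    set ψ : π.smooth := π.projS 0 ⟨u, hu⟩ - ⟪(φ : V), u⟫_ℂ • φ with hψdef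
    have hψv : (ψ : V) = π.projK 0 u - ⟪(φ : V), u⟫_ℂ • (φ : V) := rfl
    have hψ0 : (ψ : V) = 0 := by
      refine π.spherical_eq_zero h hlam hirr hφ ?_ ?_ (norm_ne_zero_iff.1 (by rw [hn]; norm_num))
      · rw [hψv, map_sub, map_smul, projK_projK_self, hφ]
      · rw [hψv, inner_sub_left, inner_smul_left, ← inner_projK_right, hφ, inner_conj_symm,
          inner_self_ofReal, hn]
        simp
    rw [hψv, sub_eq_zero] at hψ0
    exact hψ0
  have hu : u ∈ closure (π.smooth : Set V) := π.dense_smooth u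
  exact hcl.closure_subset_iff.2 hsub hu

/-- A nontrivial irreducible representation with nonpositive Casimir scalar has no spherical
vectors. -/
lemma projK_zero_eq_zero (π : UnitaryRep V) {lam : ℝ} (h : π.HasCasimirScalar lam)
    (hlam : lam ≤ 0) (hirr : π.IsIrreducible) (hnt : ¬ π.IsTrivial) (u : V) : π.projK 0 u = 0 := by
  have hsm : ∀ v : π.smooth, π.projK 0 v = (v : V) → (v : V) = 0 := by
    intro v hv
    by_contra hne
    have hX := π.dpi_Xi_of_projK_zero hv
    have h1 := π.norm_sq_Hg_add_Bg h v
    rw [hX] at h1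
    -- For a fixed vector the Casimir identity reads `‖Hv‖² + ‖Bv‖² = (λ/4)‖v‖² ≤ 0`. So `v` is
    -- invariant under the geodesic flow, and by the Cartan decomposition under the group;
    -- irreducibility then makes the representation trivial.
    have hH : (π.dpi Hg v : V) = 0 := by
      have h2 : ‖(π.dpi Hg v : V)‖ ^ 2 ≤ 0 := by
        simp only [Submodule.coe_zero, norm_zero] at h1
        nlinarith [sq_nonneg ‖(v : V)‖, sq_nonneg ‖(π.dpi Bg v : V)‖]
      exact norm_eq_zero.1 (by nlinarith [norm_nonneg (π.dpi Hg v : V)])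
    have hgeo : ∀ t : ℝ, π.toHom (expG (t • Hg)) (v : V) = v := by
      intro t
      have hd : ∀ s : ℝ, HasDerivAt (fun t : ℝ => π.toHom (expG (t • Hg)) (v : V)) 0 s := by
        intro s
        have := π.hasDerivAt_orbit Hg v s
        rwa [hH, map_zero] at this
      have := is_const_of_deriv_eq_zero (fun s => (hd s).differentiableAt)
        (fun s => (hd s).deriv) t 0
      simpa [expG_zero, toHom_one] using this
    let W : Submodule ℂ V :=
      { carrier := {u | ∀ g, π.toHom g u = u}
        zero_mem' := fun g => by simp
        add_mem' := fun {a b} ha hb g => by rw [map_add, ha g, hb g]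
        smul_mem' := fun c a ha g => by rw [map_smul, ha g] }
    have hcl : IsClosed (W : Set V) := by
      have : (W : Set V) = ⋂ g, {u | π.toHom g u = u} := by
        ext u; simp [W]
      rw [this]
      exact isClosed_iInter fun g => isClosed_eq (π.toHom g).continuous continuous_id
    have hvW : (v : V) ∈ W := by
      intro g
      obtain ⟨a, t, b, rfl⟩ := exists_cartan g
      have hr := π.rot_of_projK_zero hv
      simp only [rot] at hr
      rw [toHom_mul, toHom_mul, hr, hgeo, hr]
    rcases hirr.2 W hcl fun g u hu g' => by rw [hu g, hu g'] with hW | hW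
    · rw [hW, Submodule.mem_bot] at hvW
      exact hne hvW
    · refine hnt fun g u => ?_
      have huW : u ∈ W := by rw [hW]; exact Submodule.mem_top
      exact huW g
  have hcl : IsClosed {u : V | π.projK 0 u = 0} :=
    isClosed_eq (π.projK 0).continuous continuous_const
  have hsub : (π.smooth : Set V) ⊆ {u : V | π.projK 0 u = 0} := fun u hu =>
    hsm (π.projS 0 ⟨u, hu⟩) (π.projK_projK_self 0 u)
  exact hcl.closure_subset_iff.2 hsub (π.dense_smooth u)

end UnitaryRep

end Spherical

/-! ### Relative bound and coercivity off the spherical vectors -/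

section Estimates

open scoped InnerProductSpace Topology
open MeasureTheory Complex

variable {V : Type*} [NormedAddCommGroup V] [InnerProductSpace ℂ V]

namespace UnitaryRep

/-- The operator `-Ξ²` on smooth vectors. -/
def lapl (π : UnitaryRep V) : Module.End ℂ π.smooth := -(π.dpi Xi ^ 2)

lemma lapl_apply (π : UnitaryRep V) (v : π.smooth) :
    π.lapl v = -π.dpi Xi (π.dpi Xi v) := by
  simp [lapl, pow_two]

lemma inner_lapl_self (π : UnitaryRep V) (v : π.smooth) :
    ⟪(v : V), π.lapl v⟫_ℂ = ((‖(π.dpi Xi v : V)‖ ^ 2 : ℝ) : ℂ) := by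
  rw [lapl_apply, Submodule.coe_neg, inner_neg_right, inner_dpi_right, neg_neg, inner_self_ofReal]

/-- The orthogonal complement of the `K`-fixed vectors. -/
def nonspherical (π : UnitaryRep V) : Submodule ℂ V := ((π.projK 0 : V →L[ℂ] V) : V →ₗ[ℂ] V).ker

lemma mem_nonspherical (π : UnitaryRep V) (u : V) : u ∈ π.nonspherical ↔ π.projK 0 u = 0 :=
  LinearMap.mem_ker

/-- The smooth vectors in the orthogonal complement of the `K`-fixed vectors. -/
def smoothNonspherical (π : UnitaryRep V) : Submodule ℂ π.smooth :=
  π.nonspherical.comap π.smooth.subtype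

lemma projK_zero_of_mem (π : UnitaryRep V) (v : π.smoothNonspherical) :
    π.projK 0 (v : π.smooth) = 0 := v.2

variable [CompleteSpace V]

lemma projK_lapl (π : UnitaryRep V) (k : ℤ) (v : π.smooth) :
    π.projK k (π.lapl v) = ((k : ℂ) ^ 2) • π.projK k v := by
  rw [lapl_apply, Submodule.coe_neg, map_neg, projK_dpi_Xi, projK_dpi_Xi, smul_smul, ← neg_smul]
  congr 1
  linear_combination (-(k : ℂ) ^ 2) * I_mul_I

lemma hasSum_norm_sq_Xi (π : UnitaryRep V) (v : π.smooth) :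
    HasSum (fun k : ℤ => (k : ℝ) ^ 2 * ‖π.projK k v‖ ^ 2) (‖(π.dpi Xi v : V)‖ ^ 2) := by
  have h := π.hasSum_norm_sq_projK (π.dpi Xi v)
  convert h using 2 with k
  rw [projK_dpi_Xi, norm_smul, mul_pow, norm_mul, norm_I, mul_one, Complex.norm_intCast, sq_abs]

lemma hasSum_norm_sq_lapl_sub (π : UnitaryRep V) (ζ : ℂ) (v : π.smooth) :
    HasSum (fun k : ℤ => ‖(k : ℂ) ^ 2 - ζ‖ ^ 2 * ‖π.projK k v‖ ^ 2)
      (‖(π.lapl v : V) - ζ • (v : V)‖ ^ 2) := by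
  have h := π.hasSum_norm_sq_projK ((π.lapl v : V) - ζ • (v : V))
  convert h using 2 with k
  rw [map_sub, map_smul, projK_lapl, ← sub_smul, norm_smul, mul_pow]

lemma le_of_sq_le_sq' {a b : ℝ} (h : a ^ 2 ≤ b ^ 2) (hb : 0 ≤ b) : a ≤ b :=
  (le_abs_self a).trans (abs_le_of_sq_le_sq h hb)

lemma sq_sub_half_le {k : ℤ} (hk : k ≠ 0) {ζ : ℂ} (hζ : ζ.re ≤ 1 / 2) :
    1 ≤ (k : ℝ) ^ 2 ∧ ((k : ℝ) ^ 2 - 1 / 2) ^ 2 ≤ ‖(k : ℂ) ^ 2 - ζ‖ ^ 2 := by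
  have h1 : (1 : ℝ) ≤ (k : ℝ) ^ 2 := by
    have : 1 ≤ k ^ 2 := by
      have := Int.one_le_abs hk
      nlinarith [sq_abs k]
    exact_mod_cast this
  refine ⟨h1, pow_le_pow_left₀ (by linarith) ?_ 2⟩
  refine le_trans ?_ (Complex.re_le_norm _)
  have : (((k : ℂ) ^ 2 - ζ).re) = (k : ℝ) ^ 2 - ζ.re := by
    rw [Complex.sub_re, show ((k : ℂ) ^ 2) = (((k : ℝ) ^ 2 : ℝ) : ℂ) by push_cast; ring,
      Complex.ofReal_re]
  rw [this]
  linarith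

/-- By the Casimir identity `‖Hv‖²` is at most the sum over weights of `(k² + λ/4)‖v_k‖²`, which is
compared weight by weight with `|k² - ζ|²‖v_k‖²`, where `|k² - ζ| ≥ k² - 1/2` and `k ≠ 0`. -/
lemma norm_sq_Hg_le (π : UnitaryRep V) {lam L : ℝ} (h : π.HasCasimirScalar lam) (hL : lam ≤ L)
    (hL0 : 0 ≤ L) {ζ : ℂ} (hζ : ζ.re ≤ 1 / 2) {v : π.smooth} (hv : π.projK 0 v = 0) :
    ‖(π.dpi Hg v : V)‖ ^ 2 ≤ (L + 4) * ‖(π.lapl v : V) - ζ • (v : V)‖ ^ 2 := by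
  have h1 := π.norm_sq_Hg_add_Bg h v
  have h2 : ‖(π.dpi Xi v : V)‖ ^ 2 + lam / 4 * ‖(v : V)‖ ^ 2
      ≤ (L + 4) * ‖(π.lapl v : V) - ζ • (v : V)‖ ^ 2 := by
    refine hasSum_le (fun k => ?_)
      ((π.hasSum_norm_sq_Xi v).add ((π.hasSum_norm_sq_projK (v : V)).mul_left (lam / 4)))
      ((π.hasSum_norm_sq_lapl_sub ζ v).mul_left (L + 4))
    rcases eq_or_ne k 0 with rfl | hk
    · simp [hv]
    · obtain ⟨hk1, hk2⟩ := sq_sub_half_le hk hζ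
      rw [← add_mul, ← mul_assoc]
      refine mul_le_mul_of_nonneg_right ?_ (sq_nonneg _)
      have h3 : (k : ℝ) ^ 2 + L / 4 ≤ (L + 4) * ((k : ℝ) ^ 2 - 1 / 2) ^ 2 := by
        have h4 : (k : ℝ) ^ 2 / 4 ≤ ((k : ℝ) ^ 2 - 1 / 2) ^ 2 := by nlinarith
        have h5 : 1 / 4 ≤ ((k : ℝ) ^ 2 - 1 / 2) ^ 2 := by nlinarith
        nlinarith
      have h6 : (L + 4) * ((k : ℝ) ^ 2 - 1 / 2) ^ 2 ≤ (L + 4) * ‖(k : ℂ) ^ 2 - ζ‖ ^ 2 :=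
        mul_le_mul_of_nonneg_left hk2 (by linarith)
      linarith
  nlinarith [sq_nonneg ‖(π.dpi Bg v : V)‖]

lemma norm_sq_lapl_le (π : UnitaryRep V) {ζ : ℂ} (hζ : ζ.re ≤ 1 / 2) {v : π.smooth}
    (hv : π.projK 0 v = 0) :
    ‖(π.lapl v : V)‖ ^ 2 ≤ 4 * ‖(π.lapl v : V) - ζ • (v : V)‖ ^ 2 := by
  have h0 := π.hasSum_norm_sq_lapl_sub 0 v
  rw [zero_smul, sub_zero] at h0
  refine hasSum_le (fun k => ?_) h0 ((π.hasSum_norm_sq_lapl_sub ζ v).mul_left 4)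
  rcases eq_or_ne k 0 with rfl | hk
  · simp [hv]
  · obtain ⟨hk1, hk2⟩ := sq_sub_half_le hk hζ
    rw [← mul_assoc]
    refine mul_le_mul_of_nonneg_right ?_ (sq_nonneg _)
    rw [sub_zero, norm_pow, Complex.norm_intCast, sq_abs]
    nlinarith

lemma norm_sq_le_lapl (π : UnitaryRep V) {v : π.smooth} (hv : π.projK 0 v = 0) :
    ‖(v : V)‖ ^ 2 ≤ ‖(π.lapl v : V)‖ ^ 2 := by
  have h0 := π.hasSum_norm_sq_lapl_sub 0 v
  rw [zero_smul, sub_zero] at h0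
  refine hasSum_le (fun k => ?_) (π.hasSum_norm_sq_projK (v : V)) h0
  rcases eq_or_ne k 0 with rfl | hk
  · simp [hv]
  · obtain ⟨hk1, -⟩ := sq_sub_half_le (ζ := 0) hk (by norm_num)
    rw [sub_zero, norm_pow, Complex.norm_intCast, sq_abs]
    have h1 : 1 ≤ ((k : ℝ) ^ 2) ^ 2 := by nlinarith
    nlinarith [sq_nonneg ‖π.projK k (v : V)‖]

/-- The weights distributing the off-diagonal term between `k` and `k + 1` onto `k`. -/
def lowerWeight (k : ℤ) : ℝ := if 1 ≤ k then k / 10 else if k ≤ -2 then -(5 * k / 12) else 0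

/-- The weights distributing the off-diagonal term between `k - 1` and `k` onto `k`. -/
def upperWeight (k : ℤ) : ℝ := if 2 ≤ k then 5 * k / 12 else if k ≤ -1 then -(k / 10) else 0

lemma lowerWeight_nonneg (k : ℤ) : 0 ≤ lowerWeight k := by
  unfold lowerWeight
  split_ifs with h1 h2
  · have : (1 : ℝ) ≤ k := by exact_mod_cast h1
    linarith
  · have : (k : ℝ) ≤ -2 := by exact_mod_cast h2
    linarith
  · exact le_rfl

lemma upperWeight_nonneg (k : ℤ) : 0 ≤ upperWeight k := by
  unfold upperWeight
  split_ifs with h1 h2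
  · have : (2 : ℝ) ≤ k := by exact_mod_cast h1
    linarith
  · have : (k : ℝ) ≤ -1 := by exact_mod_cast h2
    linarith
  · exact le_rfl

/-- The critical case is `k = ±1`, with equality: as the weight `0` component is absent, such `k`
has only one off-diagonal neighbour, which costs `1/10`. -/
lemma lowerWeight_add_upperWeight_le {k : ℤ} (hk : k ≠ 0) :
    lowerWeight k + upperWeight k ≤ (k : ℝ) ^ 2 - 9 / 10 := by
  unfold lowerWeight upperWeight
  rcases lt_or_ge k 0 with h | h
  · rw [if_neg (by omega : ¬ 1 ≤ k), if_neg (by omega : ¬ 2 ≤ k), if_pos (by omega : k ≤ -1)]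
    split_ifs with h2
    · have : (k : ℝ) ≤ -2 := by exact_mod_cast h2
      nlinarith
    · have : k = -1 := by omega
      subst this
      norm_num
  · rw [if_pos (by omega : 1 ≤ k)]
    split_ifs with h2 h3
    · have : (2 : ℝ) ≤ k := by exact_mod_cast h2
      nlinarith
    · omega
    · have : k = 1 := by omega
      subst this
      norm_num

/-- The product `4 · (1/10) · (5/12) = 1/6` is what the arithmetic–geometric mean inequality
requires for an off-diagonal term of squared size `k(k + 1)/6`. The factor `1/10` goes to the weight
nearer `0`. -/
lemma four_mul_weights (k : ℤ) (hk : k ≠ 0) (hk' : k ≠ -1) :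
    4 * lowerWeight k * upperWeight (k + 1) = (k : ℝ) * (k + 1) / 6 ∧ 2 ≤ (k : ℝ) * (k + 1) := by
  unfold lowerWeight upperWeight
  rcases lt_or_ge k 0 with h | h
  · rw [if_neg (by omega : ¬ 1 ≤ k), if_neg (by omega : ¬ 2 ≤ k + 1), if_pos (by omega : k + 1 ≤ -1),
      if_pos (by omega : k ≤ -2)]
    have : (k : ℝ) ≤ -2 := by exact_mod_cast (by omega : k ≤ -2)
    push_cast
    exact ⟨by ring, by nlinarith⟩
  · rw [if_pos (by omega : 1 ≤ k), if_pos (by omega : 2 ≤ k + 1)]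
    have : (1 : ℝ) ≤ k := by exact_mod_cast (by omega : 1 ≤ k)
    push_cast
    exact ⟨by ring, by nlinarith⟩

lemma norm_inner_projK_ladder_le (π : UnitaryRep V) {lam : ℝ} (h : π.HasCasimirScalar lam)
    (hlam : 0 < lam) {ρ : ℝ} (hρ : 0 ≤ ρ) (hρ1 : ρ ^ 2 * (lam + 6) ≤ 1) {v : π.smooth}
    (hv : π.projK 0 v = 0) (k : ℤ) :
    ρ * ‖⟪π.projK (k + 1) (v : V), π.projK (k + 1) (π.ladder 1 v)⟫_ℂ‖
      ≤ lowerWeight k * ‖π.projK k v‖ ^ 2 + upperWeight (k + 1) * ‖π.projK (k + 1) v‖ ^ 2 := by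
  have hnn : 0 ≤ lowerWeight k * ‖π.projK k v‖ ^ 2
      + upperWeight (k + 1) * ‖π.projK (k + 1) v‖ ^ 2 :=
    add_nonneg (mul_nonneg (lowerWeight_nonneg _) (sq_nonneg _))
      (mul_nonneg (upperWeight_nonneg _) (sq_nonneg _))
  have hl : π.projK (k + 1) (π.ladder 1 v) = (π.ladder 1 (π.projS k v) : V) :=
    π.projK_ladder (Or.inl rfl) k v
  have hns := π.norm_sq_ladder h (Or.inl rfl) k (v := π.projS k v) (π.projK_projK_self k v)
  rw [projS_coe] at hns
  -- For `k = 0` and `k = -1` one of the two components involved has weight `0` and vanishes.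
  by_cases hk0 : k = 0
  · subst hk0
    rw [hv, norm_zero] at hns
    have : (π.ladder 1 (π.projS 0 v) : V) = 0 := by
      rw [← norm_eq_zero]
      exact pow_eq_zero_iff (two_ne_zero) |>.1 (by rw [hns]; ring)
    rw [hl, this, inner_zero_right, norm_zero, mul_zero]
    exact hnn
  by_cases hk1 : k = -1
  · subst hk1
    rw [neg_add_cancel, hv, inner_zero_left, norm_zero, mul_zero]
    rw [neg_add_cancel, hv] at hnn
    exact hnn
  obtain ⟨hw, hk2⟩ := four_mul_weights k hk0 hk1
  rw [hl]
  set a := ‖π.projK k (v : V)‖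
  set b := ‖π.projK (k + 1) (v : V)‖
  set c := ‖(π.ladder 1 (π.projS k v) : V)‖
  refine le_trans (mul_le_mul_of_nonneg_left (norm_inner_le_norm _ _) hρ) ?_
  change ρ * (b * c) ≤ lowerWeight k * a ^ 2 + upperWeight (k + 1) * b ^ 2
  refine le_of_sq_le_sq' ?_ hnn
  -- Since `k(k + 1) ≥ 2`, one has `k(k + 1) + λ/4 ≤ (λ + 6) k(k + 1)/6`; this is where `λ + 6`
  -- enters.
  have hc : ρ ^ 2 * c ^ 2 ≤ (k : ℝ) * (k + 1) / 6 * a ^ 2 := by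
    rw [hns, ← mul_assoc]
    refine mul_le_mul_of_nonneg_right ?_ (sq_nonneg _)
    push_cast
    nlinarith [sq_nonneg ρ, mul_nonneg (sq_nonneg ρ) hlam.le]
  calc (ρ * (b * c)) ^ 2 = b ^ 2 * (ρ ^ 2 * c ^ 2) := by ring
    _ ≤ b ^ 2 * ((k : ℝ) * (k + 1) / 6 * a ^ 2) := by gcongr
    _ = 4 * (lowerWeight k * a ^ 2) * (upperWeight (k + 1) * b ^ 2) := by rw [← hw]; ring
    _ ≤ _ := by nlinarith [sq_nonneg (lowerWeight k * a ^ 2 - upperWeight (k + 1) * b ^ 2)]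

/-- The form of `H` couples only neighbouring weights. Each coupling is split between its two
weights, and after shifting one index the shares at weight `k` sum to at most `k² - 9/10`. -/
lemma norm_inner_Hg_le (π : UnitaryRep V) {lam : ℝ} (h : π.HasCasimirScalar lam)
    (hlam : 0 < lam) {ρ : ℝ} (hρ : 0 ≤ ρ) (hρ1 : ρ ^ 2 * (lam + 6) ≤ 1) {v : π.smooth}
    (hv : π.projK 0 v = 0) :
    ρ * ‖⟪(v : V), π.dpi Hg v⟫_ℂ‖ ≤ ‖(π.dpi Xi v : V)‖ ^ 2 - 9 / 10 * ‖(v : V)‖ ^ 2 := by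
  have hX := (π.hasSum_norm_sq_Xi v).sub
    ((π.hasSum_norm_sq_projK (v : V)).mul_left (9 / 10))
  have hle : ∀ k : ℤ, lowerWeight k * ‖π.projK k (v : V)‖ ^ 2
      + upperWeight k * ‖π.projK k (v : V)‖ ^ 2
      ≤ (k : ℝ) ^ 2 * ‖π.projK k (v : V)‖ ^ 2 - 9 / 10 * ‖π.projK k (v : V)‖ ^ 2 := by
    intro k
    rcases eq_or_ne k 0 with rfl | hk
    · simp [hv]
    · rw [← add_mul, ← sub_mul]
      exact mul_le_mul_of_nonneg_right (lowerWeight_add_upperWeight_le hk) (sq_nonneg _)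
  have hl0 : ∀ k : ℤ, 0 ≤ lowerWeight k * ‖π.projK k (v : V)‖ ^ 2 := fun k =>
    mul_nonneg (lowerWeight_nonneg k) (sq_nonneg _)
  have hu0 : ∀ k : ℤ, 0 ≤ upperWeight k * ‖π.projK k (v : V)‖ ^ 2 := fun k =>
    mul_nonneg (upperWeight_nonneg k) (sq_nonneg _)
  have hls : Summable fun k : ℤ => lowerWeight k * ‖π.projK k (v : V)‖ ^ 2 :=
    Summable.of_nonneg_of_le hl0 (fun k => by linarith [hle k, hu0 k]) hX.summable
  have hus : Summable fun k : ℤ => upperWeight k * ‖π.projK k (v : V)‖ ^ 2 :=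
    Summable.of_nonneg_of_le hu0 (fun k => by linarith [hle k, hl0 k]) hX.summable
  have hus' := ((Equiv.addRight (1 : ℤ)).hasSum_iff).2 hus.hasSum
  have hE := ((Equiv.addRight (1 : ℤ)).hasSum_iff).2
    (π.hasSum_inner_projK (v : V) (π.ladder 1 v))
  have hmain : ‖((ρ : ℝ) : ℂ) * ⟪(v : V), π.ladder 1 v⟫_ℂ‖
      ≤ (∑' k : ℤ, lowerWeight k * ‖π.projK k (v : V)‖ ^ 2)
        + ∑' k : ℤ, upperWeight k * ‖π.projK k (v : V)‖ ^ 2 := by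
    refine HasSum.norm_le_of_bounded (hE.mul_left (ρ : ℂ)) (hls.hasSum.add hus') fun k => ?_
    rw [norm_mul, Complex.norm_real, Real.norm_of_nonneg hρ]
    exact π.norm_inner_projK_ladder_le h hlam hρ hρ1 hv k
  have hsum := hasSum_le hle (hls.hasSum.add hus.hasSum) hX
  rw [norm_mul, Complex.norm_real, Real.norm_of_nonneg hρ] at hmain
  -- The raising and lowering parts contribute `z` and `-z̄`, so only the raising part needs to be
  -- estimated.
  have hH : ‖⟪(v : V), π.dpi Hg v⟫_ℂ‖ ≤ ‖⟪(v : V), π.ladder 1 v⟫_ℂ‖ := by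
    have h1 : ⟪(v : V), π.ladder (-1) v⟫_ℂ = -conj ⟪(v : V), π.ladder 1 v⟫_ℂ := by
      rw [inner_conj_symm, inner_ladder_left, neg_neg]
    rw [dpi_Hg_eq, Submodule.coe_smul, Submodule.coe_add, inner_smul_right, inner_add_right, h1,
      ← sub_eq_add_neg, norm_mul]
    have h2 := norm_sub_le ⟪(v : V), π.ladder 1 v⟫_ℂ (conj ⟪(v : V), π.ladder 1 v⟫_ℂ)
    rw [RCLike.norm_conj] at h2
    have h3 : ‖(1 / 2 : ℂ)‖ = 1 / 2 := by norm_num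
    rw [h3]
    linarith
  have := mul_le_mul_of_nonneg_left hH hρ
  linarith

instance (π : UnitaryRep V) : CompleteSpace π.nonspherical :=
  (ContinuousLinearMap.isClosed_ker (π.projK 0)).completeSpace_coe

/-- The projection to the orthogonal complement of the `K`-fixed vectors. -/
def toNonspherical (π : UnitaryRep V) : V →ₗ[ℂ] π.nonspherical :=
  LinearMap.codRestrict _ ((1 - π.projK 0 : V →L[ℂ] V) : V →ₗ[ℂ] V) fun u => by
    rw [mem_nonspherical]
    simp [projK_projK_self]

lemma toNonspherical_coe (π : UnitaryRep V) (u : V) :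
    (π.toNonspherical u : V) = u - π.projK 0 u := rfl

lemma toNonspherical_of_mem (π : UnitaryRep V) {u : V} (hu : π.projK 0 u = 0) :
    (π.toNonspherical u : V) = u := by rw [toNonspherical_coe, hu, sub_zero]

lemma inner_toNonspherical_right (π : UnitaryRep V) (w : π.nonspherical) (u : V) :
    ⟪w, π.toNonspherical u⟫_ℂ = ⟪(w : V), u⟫_ℂ := by
  rw [Submodule.coe_inner, toNonspherical_coe, inner_sub_right, inner_projK_right,
    (π.mem_nonspherical _).1 w.2, inner_zero_left, sub_zero]

lemma inner_toNonspherical_left (π : UnitaryRep V) (w : π.nonspherical) (u : V) :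
    ⟪π.toNonspherical u, w⟫_ℂ = ⟪u, (w : V)⟫_ℂ := by
  rw [← inner_conj_symm, inner_toNonspherical_right, inner_conj_symm]

lemma norm_toNonspherical_le (π : UnitaryRep V) (u : V) : ‖π.toNonspherical u‖ ≤ ‖u‖ := by
  have h1 : ⟪π.toNonspherical u, π.toNonspherical u⟫_ℂ = ⟪(π.toNonspherical u : V), u⟫_ℂ :=
    π.inner_toNonspherical_right _ u
  rw [inner_self_ofReal] at h1
  have h2 := congrArg norm h1
  rw [Complex.norm_real, norm_pow, norm_norm] at h2
  have h3 := norm_inner_le_norm (𝕜 := ℂ) (π.toNonspherical u : V) u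
  rw [← h2, Submodule.coe_norm] at h3
  rw [Submodule.coe_norm]
  rcases eq_or_lt_of_le (norm_nonneg (π.toNonspherical u : V)) with h0 | h0
  · rw [← h0]; exact norm_nonneg u
  · nlinarith

/-- The inclusion of `smoothNonspherical` into `nonspherical`. -/
def inclNS (π : UnitaryRep V) : π.smoothNonspherical →ₗ[ℂ] π.nonspherical :=
  π.toNonspherical ∘ₗ π.smooth.subtype ∘ₗ π.smoothNonspherical.subtype

/-- The operator `-Ξ²` from `smoothNonspherical` to `nonspherical`. -/
def laplNS (π : UnitaryRep V) : π.smoothNonspherical →ₗ[ℂ] π.nonspherical :=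
  π.toNonspherical ∘ₗ π.smooth.subtype ∘ₗ π.lapl ∘ₗ π.smoothNonspherical.subtype

/-- The operator `H` compressed to `nonspherical`. -/
def geoNS (π : UnitaryRep V) : π.smoothNonspherical →ₗ[ℂ] π.nonspherical :=
  π.toNonspherical ∘ₗ π.smooth.subtype ∘ₗ π.dpi Hg ∘ₗ π.smoothNonspherical.subtype

lemma laplNS_apply (π : UnitaryRep V) (v : π.smoothNonspherical) :
    π.laplNS v = π.toNonspherical (π.lapl v) := rfl

lemma geoNS_apply (π : UnitaryRep V) (v : π.smoothNonspherical) :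
    π.geoNS v = π.toNonspherical (π.dpi Hg v) := rfl

lemma inclNS_coe (π : UnitaryRep V) (v : π.smoothNonspherical) :
    (π.inclNS v : V) = (v : π.smooth) :=
  π.toNonspherical_of_mem (π.projK_zero_of_mem v)

lemma laplNS_coe (π : UnitaryRep V) (v : π.smoothNonspherical) :
    (π.laplNS v : V) = π.lapl v := by
  refine π.toNonspherical_of_mem ?_
  change π.projK 0 (π.lapl v) = 0
  rw [projK_lapl, projK_zero_of_mem, smul_zero]

lemma norm_laplNS_sub (π : UnitaryRep V) (ζ : ℂ) (v : π.smoothNonspherical) :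
    ‖π.laplNS v - ζ • π.inclNS v‖ = ‖(π.lapl v : V) - ζ • ((v : π.smooth) : V)‖ := by
  rw [Submodule.coe_norm, Submodule.coe_sub, Submodule.coe_smul, laplNS_coe, inclNS_coe]

lemma denseRange_laplNS_sub (π : UnitaryRep V) {ζ : ℂ} (hζ : ζ.re ≤ 1 / 2) :
    DenseRange (π.laplNS - ζ • π.inclNS) := by
  have hr : Dense ((LinearMap.range (π.laplNS - ζ • π.inclNS) : Submodule ℂ π.nonspherical) :
      Set π.nonspherical) := by
    rw [Submodule.dense_iff_topologicalClosure_eq_top, Submodule.topologicalClosure_eq_top_iff,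
      Submodule.eq_bot_iff]
    intro w hw
    refine Subtype.ext (π.eq_zero_of_projK_eq_zero fun k => ?_)
    rcases eq_or_ne k 0 with rfl | hk
    · exact (π.mem_nonspherical _).1 w.2
    refine π.dense_smooth.eq_zero_of_inner_right (𝕜 := ℂ) fun u hu => ?_
    set p : π.smooth := π.projS k ⟨u, hu⟩
    have hp : π.projK 0 p = 0 := π.projK_projK_of_ne hk.symm u
    have h1 := (Submodule.mem_orthogonal _ _).1 hw
      ((π.laplNS - ζ • π.inclNS) (⟨p, hp⟩ : π.smoothNonspherical)) ⟨_, rfl⟩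
    rw [Submodule.coe_inner, LinearMap.sub_apply, LinearMap.smul_apply, Submodule.coe_sub,
      Submodule.coe_smul, laplNS_coe, inclNS_coe] at h1
    have h2 : (π.lapl p : V) = ((k : ℂ) ^ 2) • (p : V) := by
      rw [lapl_apply, dpi_Xi_projS, map_smul, dpi_Xi_projS, smul_smul, ← neg_smul,
        Submodule.coe_smul]
      congr 1
      linear_combination (-(k : ℂ) ^ 2) * I_mul_I
    simp only at h1
    rw [h2, ← sub_smul, inner_smul_left, mul_eq_zero] at h1
    rw [inner_projK_right]
    refine h1.resolve_left fun h3 => ?_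
    rw [map_eq_zero] at h3
    obtain ⟨h4, h5⟩ := sq_sub_half_le hk hζ
    rw [h3, norm_zero] at h5
    nlinarith
  exact hr

/-- The parameter `L` covers both cases: `L = λ` when `λ > 0`, and `L = 0` when `λ ≤ 0`. -/
lemma relBounded (π : UnitaryRep V) {lam L : ℝ} (h : π.HasCasimirScalar lam) (hL : lam ≤ L)
    (hL0 : 0 ≤ L) : RelBounded π.inclNS π.laplNS π.geoNS (Real.sqrt (L + 4)) where
  dense ζ hζ := π.denseRange_laplNS_sub hζ
  bound ζ hζ v := by
    rw [norm_laplNS_sub, geoNS_apply]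
    refine (π.norm_toNonspherical_le _).trans ?_
    refine le_of_sq_le_sq' ?_ (by positivity)
    rw [mul_pow, Real.sq_sqrt (by linarith)]
    exact π.norm_sq_Hg_le h hL hL0 hζ (π.projK_zero_of_mem v)
  bound_self ζ hζ v := by
    rw [norm_laplNS_sub]
    have h1 := π.norm_sq_lapl_le hζ (π.projK_zero_of_mem v)
    rw [Submodule.coe_norm, laplNS_coe]
    refine le_of_sq_le_sq' ?_ (by positivity)
    rw [mul_pow]
    linarith
  bound_incl v := by
    have h1 := π.norm_sq_le_lapl (π.projK_zero_of_mem v)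
    rw [Submodule.coe_norm, Submodule.coe_norm, laplNS_coe, inclNS_coe]
    refine le_of_sq_le_sq' ?_ (by positivity)
    rw [mul_pow]
    nlinarith [sq_nonneg ‖(π.lapl v : V)‖]

/-- The constant is `9/10 - 1/2`: the gap left by `norm_inner_Hg_le` minus the largest allowed `Re
ζ`. -/
lemma coercive (π : UnitaryRep V) {lam : ℝ} (h : π.HasCasimirScalar lam) (hlam : 0 < lam)
    {x ζ : ℂ} (hx : ‖x‖ ^ 2 * (lam + 6) ≤ 1) (hζ : ζ.re ≤ 1 / 2) (v : π.smoothNonspherical) :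
    2 / 5 * ‖π.inclNS v‖ ^ 2
      ≤ (⟪π.inclNS v, π.laplNS v - conj x • π.geoNS v - conj ζ • π.inclNS v⟫_ℂ).re := by
  have h1 := π.norm_inner_Hg_le h hlam (norm_nonneg x) hx (π.projK_zero_of_mem v)
  have h2 : ⟪π.inclNS v, π.laplNS v - conj x • π.geoNS v - conj ζ • π.inclNS v⟫_ℂ
      = ((‖(π.dpi Xi v : V)‖ ^ 2 : ℝ) : ℂ) - conj x * ⟪((v : π.smooth) : V), π.dpi Hg v⟫_ℂ
        - conj ζ * ((‖((v : π.smooth) : V)‖ ^ 2 : ℝ) : ℂ) := by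
    rw [inner_sub_right, inner_sub_right, inner_smul_right, inner_smul_right, laplNS_apply,
      geoNS_apply, inner_toNonspherical_right, inner_toNonspherical_right, inclNS_coe,
      inner_lapl_self, Submodule.coe_inner, inclNS_coe, inner_self_ofReal]
  have h3 := Complex.re_le_norm (conj x * ⟪((v : π.smooth) : V), π.dpi Hg v⟫_ℂ)
  rw [norm_mul, RCLike.norm_conj] at h3
  rw [h2, Submodule.coe_norm, inclNS_coe, Complex.sub_re, Complex.sub_re, Complex.ofReal_re,
    Complex.re_mul_ofReal, Complex.conj_re]
  nlinarith [sq_nonneg ‖((v : π.smooth) : V)‖]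

end UnitaryRep

end Estimates

/-! ### Weak formulation and splitting along the spherical vector -/

section Schur

open scoped InnerProductSpace Topology
open Complex

variable {V : Type*} [NormedAddCommGroup V] [InnerProductSpace ℂ V]

namespace UnitaryRep

/-- The weak formulation of the equation `(T(x) - ζ) u = w`. -/
def WeakSol (π : UnitaryRep V) (x ζ : ℂ) (u w : V) : Prop :=
  ∀ v : π.smooth, ⟪w, (v : V)⟫_ℂ
    = ⟪u, (π.lapl v : V) - conj x • (π.dpi Hg v : V) - conj ζ • (v : V)⟫_ℂ

lemma formalTPMap_apply (π : UnitaryRep V) (x : ℂ) (v : π.smooth) :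
    π.formalTPMap (-conj x) v = (π.lapl v : V) - conj x • (π.dpi Hg v : V) := by
  change ((π.formalT (-conj x) v : π.smooth) : V) = _
  rw [formalT, LinearMap.add_apply, LinearMap.smul_apply, neg_smul, ← sub_eq_add_neg]
  rfl

/-- `φ` is a smooth unit vector spanning the spherical vectors. -/
structure IsSpherical (π : UnitaryRep V) (φ : π.smooth) : Prop where
  norm_eq : ‖(φ : V)‖ = 1
  fixed : π.projK 0 φ = (φ : V)
  projK_eq : ∀ u : V, π.projK 0 u = ⟪(φ : V), u⟫_ℂ • (φ : V)

namespace IsSpherical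

variable {π : UnitaryRep V} {φ : π.smooth}

lemma inner_self (hφ : π.IsSpherical φ) : ⟪(φ : V), (φ : V)⟫_ℂ = 1 := by
  rw [inner_self_ofReal, hφ.norm_eq]; simp

lemma projK_zero_iff (hφ : π.IsSpherical φ) (u : V) : π.projK 0 u = 0 ↔ ⟪(φ : V), u⟫_ℂ = 0 := by
  have hne : (φ : V) ≠ 0 := norm_ne_zero_iff.1 (by rw [hφ.norm_eq]; norm_num)
  rw [hφ.projK_eq, smul_eq_zero, or_iff_left hne]

lemma projK_sub (hφ : π.IsSpherical φ) (u : V) : π.projK 0 (u - ⟪(φ : V), u⟫_ℂ • (φ : V)) = 0 := by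
  rw [map_sub, map_smul, hφ.fixed, hφ.projK_eq, sub_self]

end IsSpherical

variable [CompleteSpace V]

lemma weakSol_iff (π : UnitaryRep V) (x ζ : ℂ) (u w : V) :
    π.WeakSol x ζ u w ↔ ∃ hu : u ∈ (π.T x).domain, π.T x ⟨u, hu⟩ - ζ • u = w := by
  have hd : Dense ((π.formalTPMap (-conj x)).domain : Set V) := π.dense_smooth
  have hiff : π.WeakSol x ζ u w ↔ ∀ v : (π.formalTPMap (-conj x)).domain,
      ⟪w + ζ • u, (v : V)⟫_ℂ = ⟪u, π.formalTPMap (-conj x) v⟫_ℂ := by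
    refine forall_congr' fun v => ?_
    rw [formalTPMap_apply, inner_sub_right _ _ (conj ζ • (v : V)), inner_add_left, inner_smul_left,
      inner_smul_right, eq_sub_iff_add_eq]
  rw [hiff]
  constructor
  · intro h
    have hu : u ∈ (π.T x).domain := LinearPMap.mem_adjoint_domain_of_exists u ⟨w + ζ • u, h⟩
    refine ⟨hu, ?_⟩
    have : π.T x ⟨u, hu⟩ = w + ζ • u := LinearPMap.adjoint_apply_eq hd ⟨u, hu⟩ h
    rw [this, add_sub_cancel_right]
  · rintro ⟨hu, rfl⟩ v
    rw [sub_add_cancel]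
    exact LinearPMap.adjoint_isFormalAdjoint hd ⟨u, hu⟩ v

/-- Bounded solution operators for the weak formulation give points of the resolvent set. -/
lemma mem_resolventSet_of_weakSol (π : UnitaryRep V) {x ζ : ℂ} (R : V →L[ℂ] V)
    (h : ∀ u w, π.WeakSol x ζ u w ↔ u = R w) : ζ ∈ resolventSet (π.T x) :=
  ⟨R, fun w => (π.weakSol_iff x ζ _ w).1 ((h _ w).2 rfl),
    fun u => ((h _ _).1 ((π.weakSol_iff x ζ u _).2 ⟨u.2, rfl⟩)).symm⟩

/-- The resolvent on the complement of the spherical vectors, extended by zero. -/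
def resNS (π : UnitaryRep V) {C : ℝ} (hR : RelBounded π.inclNS π.laplNS π.geoNS C) (x ζ : ℂ) :
    V →L[ℂ] V :=
  π.nonspherical.subtypeL ∘L hR.resolvent x ζ ∘L π.toNonspherical.mkContinuous 1
    (fun u => by rw [one_mul]; exact π.norm_toNonspherical_le u)

section Res

variable (π : UnitaryRep V) {C : ℝ} (hR : RelBounded π.inclNS π.laplNS π.geoNS C) {x ζ : ℂ}

lemma resNS_apply (w : V) :
    π.resNS hR x ζ w = (hR.resolvent x ζ (π.toNonspherical w) : V) := rfl

lemma projK_zero_resNS (w : V) : π.projK 0 (π.resNS hR x ζ w) = 0 :=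
  (hR.resolvent x ζ (π.toNonspherical w)).2

lemma eq_resNS_iff (hx : ‖x‖ * C < 1) (hζ : ζ.re ≤ 1 / 2) {u : V} (hu : π.projK 0 u = 0) (w : V) :
    (∀ v : π.smooth, π.projK 0 v = 0 → ⟪w, (v : V)⟫_ℂ
      = ⟪u, (π.lapl v : V) - conj x • (π.dpi Hg v : V) - conj ζ • (v : V)⟫_ℂ)
      ↔ u = π.resNS hR x ζ w := by
  have h := hR.inner_eq_iff_eq_resolvent hx hζ (⟨u, hu⟩ : π.nonspherical) (π.toNonspherical w)
  have e : ∀ v : π.smoothNonspherical,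
      (⟪π.toNonspherical w, π.inclNS v⟫_ℂ = ⟪(⟨u, hu⟩ : π.nonspherical),
        π.laplNS v - conj x • π.geoNS v - conj ζ • π.inclNS v⟫_ℂ) ↔
      ⟪w, ((v : π.smooth) : V)⟫_ℂ
        = ⟪u, (π.lapl v : V) - conj x • (π.dpi Hg v : V) - conj ζ • ((v : π.smooth) : V)⟫_ℂ := by
    intro v
    simp only [inner_sub_right, inner_smul_right]
    rw [inner_toNonspherical_left, laplNS_apply, geoNS_apply, inner_toNonspherical_right,
      inner_toNonspherical_right, Submodule.coe_inner, inclNS_coe]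
  simp_rw [e] at h
  constructor
  · intro h1
    exact congrArg Subtype.val (h.1 fun v => h1 v v.2)
  · intro h1 v hv
    exact h.2 (Subtype.ext h1) ⟨v, hv⟩

lemma resNS_sub_resNS {η : ℂ} (hx : ‖x‖ * C < 1) (hζ : ζ.re ≤ 1 / 2) (hη : η.re ≤ 1 / 2) (w : V) :
    π.resNS hR x ζ w - π.resNS hR x η w = (ζ - η) • π.resNS hR x ζ (π.resNS hR x η w) := by
  have h := congrArg Subtype.val
    (hR.resolvent_sub_resolvent hx hζ hη (π.toNonspherical w))
  have e : π.toNonspherical (hR.resolvent x η (π.toNonspherical w) : V)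
      = hR.resolvent x η (π.toNonspherical w) :=
    Subtype.ext (π.toNonspherical_of_mem (hR.resolvent x η (π.toNonspherical w)).2)
  simp only [resNS_apply, e]
  exact h

lemma differentiableOn_inner_resNS {U : Set ℂ} {f : ℂ → ℂ} (hf : DifferentiableOn ℂ f U)
    (hU : ∀ x ∈ U, ‖x‖ * C < 1 ∧ (f x).re ≤ 1 / 2) (u w : V) :
    DifferentiableOn ℂ (fun x => ⟪u, π.resNS hR x (f x) w⟫_ℂ) U := by
  have h := hR.differentiableOn_resolvent hf hU
  let ev : (π.nonspherical →L[ℂ] π.nonspherical) →L[ℂ] ℂ :=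
    (innerSL ℂ u ∘L π.nonspherical.subtypeL) ∘L
      ContinuousLinearMap.apply ℂ π.nonspherical (π.toNonspherical w)
  have h2 : DifferentiableOn ℂ (fun x => ev (hR.resolvent x (f x))) U :=
    ev.differentiable.comp_differentiableOn h
  exact h2

lemma norm_resNS_le {lam : ℝ} (h : π.HasCasimirScalar lam) (hlam : 0 < lam)
    (hx : ‖x‖ * C < 1) (hx2 : ‖x‖ ^ 2 * (lam + 6) ≤ 1) (hζ : ζ.re ≤ 1 / 2) (w : V) :
    ‖π.resNS hR x ζ w‖ ≤ 5 / 2 * ‖w‖ := by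
  have h1 := hR.norm_resolvent_le hx hζ (δ := 2 / 5) (by norm_num)
    (π.coercive h hlam hx2 hζ) (π.toNonspherical w)
  have h2 := π.norm_toNonspherical_le w
  rw [resNS_apply, ← Submodule.coe_norm]
  rw [show (2 / 5 : ℝ)⁻¹ = 5 / 2 by norm_num] at h1
  exact h1.trans (mul_le_mul_of_nonneg_left h2 (by norm_num))

end Res

/-- If there are no spherical vectors then the half plane `Re ζ ≤ 1/2` is in the resolvent set. -/
lemma mem_resolventSet_of_projK_zero (π : UnitaryRep V) {C : ℝ}
    (hR : RelBounded π.inclNS π.laplNS π.geoNS C) (h0 : ∀ u, π.projK 0 u = 0) {x ζ : ℂ}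
    (hx : ‖x‖ * C < 1) (hζ : ζ.re ≤ 1 / 2) : ζ ∈ resolventSet (π.T x) :=
  π.mem_resolventSet_of_weakSol (π.resNS hR x ζ) fun u w => by
    rw [← π.eq_resNS_iff hR hx hζ (h0 u)]
    exact ⟨fun h v _ => h v, fun h v => h v (h0 _)⟩

namespace IsSpherical

variable {π : UnitaryRep V} {φ : π.smooth}

lemma lapl_eq (hφ : π.IsSpherical φ) : π.lapl φ = 0 := by
  rw [lapl_apply, π.dpi_Xi_of_projK_zero hφ.fixed, map_zero, neg_zero]

lemma projK_ladder (hφ : π.IsSpherical φ) {e : ℤ} (he : e = 1 ∨ e = -1) :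
    π.projK e (π.ladder e φ) = (π.ladder e φ : V) := by
  have := π.projK_ladder_of_projK_eq he hφ.fixed
  rwa [zero_add] at this

lemma projK_zero_Hg (hφ : π.IsSpherical φ) : π.projK 0 (π.dpi Hg φ) = 0 := by
  rw [dpi_Hg_eq, Submodule.coe_smul, Submodule.coe_add, map_smul, map_add,
    ← hφ.projK_ladder (Or.inl rfl), ← hφ.projK_ladder (Or.inr rfl),
    projK_projK_of_ne π (by norm_num), projK_projK_of_ne π (by norm_num), add_zero, smul_zero]

lemma lapl_Hg (hφ : π.IsSpherical φ) : π.lapl (π.dpi Hg φ) = π.dpi Hg φ := by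
  have h : ∀ e : ℤ, (e = 1 ∨ e = -1) → π.lapl (π.ladder e φ) = π.ladder e φ := by
    intro e he
    have he2 : (e : ℂ) * e = 1 := by rcases he with rfl | rfl <;> norm_num
    rw [lapl_apply, π.dpi_Xi_eq_of_projK_eq e (hφ.projK_ladder he), map_smul,
      π.dpi_Xi_eq_of_projK_eq e (hφ.projK_ladder he), smul_smul, ← neg_smul]
    have : -((e : ℂ) * I * (e * I)) = 1 := by linear_combination (-(e : ℂ) * e) * I_mul_I + he2
    rw [this, one_smul]
  rw [dpi_Hg_eq, map_smul, map_add, h 1 (Or.inl rfl), h (-1) (Or.inr rfl)]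

lemma norm_sq_Hg (hφ : π.IsSpherical φ) {lam : ℝ} (h : π.HasCasimirScalar lam) :
    ‖(π.dpi Hg φ : V)‖ ^ 2 = lam / 8 := by
  have h1 := π.norm_sq_ladder h (Or.inl rfl) 0 hφ.fixed
  have h2 := π.norm_sq_ladder h (Or.inr rfl) 0 hφ.fixed
  have ho : ⟪(π.ladder 1 φ : V), (π.ladder (-1) φ : V)⟫_ℂ = 0 := by
    rw [← hφ.projK_ladder (Or.inl rfl), ← hφ.projK_ladder (Or.inr rfl),
      inner_projK_of_ne π (by norm_num)]
  have h3 := norm_add_sq_eq_norm_sq_add_norm_sq_of_inner_eq_zero _ _ ho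
  rw [dpi_Hg_eq, Submodule.coe_smul, Submodule.coe_add, norm_smul, mul_pow, pow_two ‖_ + _‖, h3,
    ← pow_two, ← pow_two, h1, h2, hφ.norm_eq]
  norm_num
  ring

/-- Testing against smooth vectors orthogonal to `φ` and against `φ` itself gives the two equations
of the block decomposition. The off-diagonal blocks are `x Hφ` and, by skew-symmetry, `-x ⟪Hφ, ·⟫`.
-/
lemma weakSol_iff (hφ : π.IsSpherical φ) {C : ℝ}
    (hR : RelBounded π.inclNS π.laplNS π.geoNS C) {x ζ : ℂ} (hx : ‖x‖ * C < 1)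
    (hζ : ζ.re ≤ 1 / 2) (u w : V) :
    π.WeakSol x ζ u w ↔
      u - ⟪(φ : V), u⟫_ℂ • (φ : V)
        = π.resNS hR x ζ (w - (⟪(φ : V), u⟫_ℂ * x) • (π.dpi Hg φ : V)) ∧
      ⟪(φ : V), w⟫_ℂ = -(ζ * ⟪(φ : V), u⟫_ℂ) - x * ⟪(π.dpi Hg φ : V),
        u - ⟪(φ : V), u⟫_ℂ • (φ : V)⟫_ℂ := by
  set α := ⟪(φ : V), u⟫_ℂ with hα
  set u' := u - α • (φ : V) with hu'
  have hP : π.projK 0 u' = 0 := hφ.projK_sub u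
  have hu : u = u' + α • (φ : V) := by rw [hu', sub_add_cancel]
  clear_value u'
  have hlφ (v : π.smooth) : ⟪(φ : V), (π.lapl v : V)⟫_ℂ = 0 := by
    have h0 := π.dpi_Xi_of_projK_zero hφ.fixed
    rw [lapl_apply, Submodule.coe_neg, inner_neg_right, inner_dpi_right, h0]
    simp
  have hφH : ⟪(φ : V), (π.dpi Hg φ : V)⟫_ℂ = 0 := (hφ.projK_zero_iff _).1 hφ.projK_zero_Hg
  have hφu' : ⟪(φ : V), u'⟫_ℂ = 0 := (hφ.projK_zero_iff _).1 hP
  have hu'φ : ⟪u', (φ : V)⟫_ℂ = 0 := inner_eq_zero_symm.1 hφu'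
  have hoff (v : π.smooth) (hv : π.projK 0 v = 0) :
      ⟪w, (v : V)⟫_ℂ
        = ⟪u, (π.lapl v : V) - conj x • (π.dpi Hg v : V) - conj ζ • (v : V)⟫_ℂ ↔
      ⟪w - (α * x) • (π.dpi Hg φ : V), (v : V)⟫_ℂ
        = ⟪u', (π.lapl v : V) - conj x • (π.dpi Hg v : V) - conj ζ • (v : V)⟫_ℂ := by
    have hv0 : ⟪(φ : V), (v : V)⟫_ℂ = 0 := (hφ.projK_zero_iff _).1 hv
    have hH : ⟪(φ : V), (π.dpi Hg v : V)⟫_ℂ = -⟪(π.dpi Hg φ : V), (v : V)⟫_ℂ := by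
      rw [inner_dpi_right]
    rw [hu, inner_add_left, inner_smul_left, inner_sub_right (φ : V), inner_sub_right (φ : V),
      inner_smul_right, inner_smul_right, hlφ, hv0, hH, inner_sub_left, inner_smul_left, map_mul]
    constructor <;> intro h <;> linear_combination h
  have hon : ⟪w, (φ : V)⟫_ℂ
        = ⟪u, (π.lapl φ : V) - conj x • (π.dpi Hg φ : V) - conj ζ • (φ : V)⟫_ℂ ↔
      ⟪(φ : V), w⟫_ℂ = -(ζ * α) - x * ⟪(π.dpi Hg φ : V), u'⟫_ℂ := by
    rw [hφ.lapl_eq, hu, inner_add_left, inner_smul_left]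
    simp only [inner_sub_right, inner_smul_right, hφH, hu'φ, hφ.inner_self, Submodule.coe_zero,
      inner_zero_right]
    rw [← (starRingEnd ℂ).injective.eq_iff, inner_conj_symm]
    simp only [map_sub, map_add, map_mul, inner_conj_symm, conj_conj, map_zero, map_one]
    constructor <;> intro h <;> linear_combination h
  rw [← π.eq_resNS_iff hR hx hζ hP, ← hon]
  constructor
  · intro h
    exact ⟨fun v hv => (hoff v hv).1 (h v), h φ⟩
  · rintro ⟨h1, h2⟩ v
    set β := ⟪(φ : V), (v : V)⟫_ℂ
    have hv' := (hoff (v - β • φ) (hφ.projK_sub v)).2 (h1 _ (hφ.projK_sub v))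
    have e : v = (v - β • φ) + β • φ := by rw [sub_add_cancel]
    rw [e, Submodule.coe_add, inner_add_right, hv', map_add, map_add, map_smul, map_smul,
      Submodule.coe_smul, inner_smul_right, h2, ← inner_smul_right, ← inner_add_right]
    congr 1
    simp only [Submodule.coe_add, Submodule.coe_smul, smul_add, smul_sub]
    rw [smul_comm β, smul_comm β (conj ζ)]
    abel

end IsSpherical

end UnitaryRep

end Schur

/-! ### The scalar equation, simplicity and asymptotics of the eigenvalue -/

section Eigenvalue

open scoped InnerProductSpace Topology
open Complex

variable {V : Type*} [NormedAddCommGroup V] [InnerProductSpace ℂ V] [CompleteSpace V]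

namespace UnitaryRep

lemma hasCasimirScalar_unique (π : UnitaryRep V) [Nontrivial V] {a b : ℝ}
    (ha : π.HasCasimirScalar a) (hb : π.HasCasimirScalar b) : a = b := by
  obtain ⟨k, u, hu, -⟩ := π.exists_smooth_projK_ne_zero
  have h : ((a : ℂ) • (1 : Module.End ℂ π.smooth)) u = ((b : ℂ) • (1 : Module.End ℂ π.smooth)) u :=
    congrArg (fun f : Module.End ℂ π.smooth => f u) (ha.symm.trans hb)
  have hu' : u ≠ 0 := fun h0 => hu (by rw [h0]; rfl)
  exact_mod_cast smul_left_injective ℂ hu' h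

namespace IsSpherical

variable {π : UnitaryRep V} {φ : π.smooth} {C : ℝ}
  {hR : RelBounded π.inclNS π.laplNS π.geoNS C} {x ζ : ℂ}

lemma resNS_self (hφ : π.IsSpherical φ) : π.resNS hR x ζ φ = 0 := by
  have h : π.toNonspherical (φ : V) = 0 :=
    Subtype.ext (by rw [toNonspherical_coe, hφ.fixed, sub_self]; rfl)
  rw [resNS_apply, h, map_zero]
  rfl

lemma inner_resNS (hφ : π.IsSpherical φ) (w : V) : ⟪(φ : V), π.resNS hR x ζ w⟫_ℂ = 0 :=
  (hφ.projK_zero_iff _).1 (π.projK_zero_resNS hR w)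

/-- `Hφ` has components of weights `±1` only, so `-Ξ²` fixes it. -/
lemma resNS_zero_zero_Hg (hφ : π.IsSpherical φ) :
    π.resNS hR 0 0 (π.dpi Hg φ) = (π.dpi Hg φ : V) := by
  refine ((π.eq_resNS_iff hR (by simp) (by simp) hφ.projK_zero_Hg _).1 fun v _ => ?_).symm
  have h : ⟪(π.dpi Hg φ : V), (π.lapl v : V)⟫_ℂ = ⟪(π.lapl (π.dpi Hg φ) : V), (v : V)⟫_ℂ := by
    simp only [lapl_apply, Submodule.coe_neg, inner_neg_right, inner_neg_left, inner_dpi_right,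
      neg_neg]
  rw [map_zero, zero_smul, zero_smul, sub_zero, sub_zero, h, hφ.lapl_Hg]

end IsSpherical

/-- The effective matrix element of the resolvent off the spherical vectors. -/
def schurCoeff (π : UnitaryRep V) {C : ℝ} (hR : RelBounded π.inclNS π.laplNS π.geoNS C)
    (φ : π.smooth) (x ζ : ℂ) : ℂ :=
  ⟪(π.dpi Hg φ : V), π.resNS hR x ζ (π.dpi Hg φ)⟫_ℂ

/-- The candidate eigenvector, normalized to have spherical component `φ`. -/
def schurVec (π : UnitaryRep V) {C : ℝ} (hR : RelBounded π.inclNS π.laplNS π.geoNS C)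
    (φ : π.smooth) (x ζ : ℂ) : V :=
  φ - x • π.resNS hR x ζ (π.dpi Hg φ)

namespace IsSpherical

variable {π : UnitaryRep V} {φ : π.smooth} {C : ℝ}
  {hR : RelBounded π.inclNS π.laplNS π.geoNS C} {x ζ : ℂ}

/-- Schur complement reduction of the resolvent equation to a scalar equation. -/
lemma weakSol_iff_schur (hφ : π.IsSpherical φ) (hR : RelBounded π.inclNS π.laplNS π.geoNS C)
    (hx : ‖x‖ * C < 1) (hζ : ζ.re ≤ 1 / 2) (u w : V) :
    π.WeakSol x ζ u w ↔
      u = ⟪(φ : V), u⟫_ℂ • π.schurVec hR φ x ζ + π.resNS hR x ζ w ∧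
      (x ^ 2 * π.schurCoeff hR φ x ζ - ζ) * ⟪(φ : V), u⟫_ℂ
        = ⟪(φ : V), w⟫_ℂ + x * ⟪(π.dpi Hg φ : V), π.resNS hR x ζ w⟫_ℂ := by
  rw [hφ.weakSol_iff hR hx hζ]
  set α := ⟪(φ : V), u⟫_ℂ
  have e : u - α • (φ : V) = π.resNS hR x ζ (w - (α * x) • (π.dpi Hg φ : V)) ↔
      u = α • π.schurVec hR φ x ζ + π.resNS hR x ζ w := by
    rw [map_sub, map_smul, schurVec, smul_sub, smul_smul, sub_eq_iff_eq_add]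
    constructor <;> intro h <;> rw [h] <;> abel
  refine and_congr_right_iff.2 ?_ |>.trans (and_congr_left_iff.2 fun _ => e)
  intro h
  rw [h, map_sub, map_smul, inner_sub_right, inner_smul_right]
  simp only [schurCoeff]
  constructor <;> intro h <;> linear_combination -h

lemma inner_schurVec (hφ : π.IsSpherical φ) : ⟪(φ : V), π.schurVec hR φ x ζ⟫_ℂ = 1 := by
  rw [schurVec, inner_sub_right, inner_smul_right, hφ.inner_resNS, hφ.inner_self]
  ring

lemma mem_resolventSet (hφ : π.IsSpherical φ) (hx : ‖x‖ * C < 1) (hζ : ζ.re ≤ 1 / 2)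
    (hF : x ^ 2 * π.schurCoeff hR φ x ζ ≠ ζ) : ζ ∈ resolventSet (π.T x) := by
  set F := x ^ 2 * π.schurCoeff hR φ x ζ - ζ with hFdef
  have hF0 : F ≠ 0 := sub_ne_zero.2 hF
  let ℓ : V →L[ℂ] ℂ := F⁻¹ • (innerSL ℂ (φ : V) + x • (innerSL ℂ (π.dpi Hg φ : V) ∘L π.resNS hR x ζ))
  have hℓ (w : V) : ℓ w = F⁻¹ * (⟪(φ : V), w⟫_ℂ + x * ⟪(π.dpi Hg φ : V), π.resNS hR x ζ w⟫_ℂ) := rfl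
  refine π.mem_resolventSet_of_weakSol
    (ℓ.smulRight (π.schurVec hR φ x ζ) + π.resNS hR x ζ) fun u w => ?_
  rw [hφ.weakSol_iff_schur hR hx hζ, add_apply,
    ContinuousLinearMap.smulRight_apply, ← hFdef]
  constructor
  · rintro ⟨h1, h2⟩
    have : ⟪(φ : V), u⟫_ℂ = ℓ w := by rw [hℓ, ← h2, inv_mul_cancel_left₀ hF0]
    rw [← this]
    exact h1
  · intro h
    have : ⟪(φ : V), u⟫_ℂ = ℓ w := by
      rw [h, inner_add_right, inner_smul_right, hφ.inner_schurVec, hφ.inner_resNS]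
      ring
    rw [this]
    exact ⟨h, by rw [hℓ, mul_inv_cancel_left₀ hF0]⟩

lemma weakSol_schurVec (hφ : π.IsSpherical φ) (hx : ‖x‖ * C < 1) (hζ : ζ.re ≤ 1 / 2)
    (hF : x ^ 2 * π.schurCoeff hR φ x ζ = ζ) : π.WeakSol x ζ (π.schurVec hR φ x ζ) 0 := by
  rw [hφ.weakSol_iff_schur hR hx hζ, hφ.inner_schurVec, hF]
  simp

lemma schurVec_ne_zero (hφ : π.IsSpherical φ) : π.schurVec hR φ x ζ ≠ 0 := fun h => by
  have := hφ.inner_schurVec (hR := hR) (x := x) (ζ := ζ)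
  rw [h, inner_zero_right] at this
  exact zero_ne_one this

lemma mem_spec (hφ : π.IsSpherical φ) (hx : ‖x‖ * C < 1) (hζ : ζ.re ≤ 1 / 2)
    (hF : x ^ 2 * π.schurCoeff hR φ x ζ = ζ) : ζ ∈ spec (π.T x) := by
  rintro ⟨R, -, h⟩
  obtain ⟨hu, he⟩ := (π.weakSol_iff x ζ _ _).1 (hφ.weakSol_schurVec hx hζ hF)
  have := h ⟨_, hu⟩
  rw [he, map_zero] at this
  exact hφ.schurVec_ne_zero this.symm

lemma isSimpleEigenvalue (hφ : π.IsSpherical φ) (hx : ‖x‖ * C < 1) (hζ : ζ.re ≤ 1 / 2)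
    (hF : x ^ 2 * π.schurCoeff hR φ x ζ = ζ)
    (hs : ‖x ^ 2 * ⟪(π.dpi Hg φ : V), π.resNS hR x ζ (π.resNS hR x ζ (π.dpi Hg φ))⟫_ℂ‖ < 1) :
    IsSimpleEigenvalue (π.T x) ζ := by
  set e := π.schurVec hR φ x ζ with he
  have hsol : π.WeakSol x ζ e 0 := hφ.weakSol_schurVec hx hζ hF
  obtain ⟨hu, hT⟩ := (π.weakSol_iff x ζ _ _).1 hsol
  refine ⟨⟨⟨e, hu⟩, hφ.schurVec_ne_zero, sub_eq_zero.1 hT⟩, ?_⟩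
  have hker : ∀ n, kerPow (π.T x) ζ n ≤ Submodule.span ℂ {e} := by
    intro n
    induction n with
    | zero => exact bot_le
    | succ n ih =>
      rintro u ⟨hu, hk⟩
      obtain ⟨β, hβ⟩ := Submodule.mem_span_singleton.1 (ih hk)
      have h1 : π.WeakSol x ζ u (β • e) := (π.weakSol_iff x ζ _ _).2 ⟨hu, hβ.symm⟩
      obtain ⟨h2, h3⟩ := (hφ.weakSol_iff_schur hR hx hζ _ _).1 h1
      have h4 : π.resNS hR x ζ e
          = -(x • π.resNS hR x ζ (π.resNS hR x ζ (π.dpi Hg φ))) := by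
        rw [he, schurVec, map_sub, hφ.resNS_self, map_smul, zero_sub]
      -- If `(T - ζ)u = βe`, solvability of the scalar equation reads `β(1 - x²⟪Hφ, R²Hφ⟫) = 0`. The
      -- bracket is minus the `ζ`-derivative of the scalar equation's left side minus `ζ`, nonzero
      -- by `hs`; so `β = 0` and no Jordan chain starts.
      rw [hF, sub_self, zero_mul, inner_smul_right, hφ.inner_schurVec, map_smul, h4,
        inner_smul_right, inner_neg_right, inner_smul_right] at h3
      have hβ0 : β = 0 := by
        by_contra hne
        have h5 : x ^ 2 * ⟪(π.dpi Hg φ : V), π.resNS hR x ζ (π.resNS hR x ζ (π.dpi Hg φ))⟫_ℂ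
            = 1 := by
          refine mul_left_cancel₀ hne ?_
          linear_combination h3
        rw [h5, norm_one] at hs
        exact lt_irrefl _ hs
      rw [h2, hβ0, zero_smul, map_zero, add_zero]
      exact Submodule.smul_mem _ _ (Submodule.mem_span_singleton_self _)
  have hsup : (⨆ n, kerPow (π.T x) ζ n) = Submodule.span ℂ {e} := by
    refine le_antisymm (iSup_le hker) ?_
    rw [Submodule.span_singleton_le_iff_mem]
    exact Submodule.mem_iSup_of_mem 1 ⟨hu, hT⟩
  rw [hsup, finrank_span_singleton hφ.schurVec_ne_zero]

variable {lam : ℝ}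

lemma schurCoeff_zero_zero (hφ : π.IsSpherical φ) (h : π.HasCasimirScalar lam) :
    π.schurCoeff hR φ 0 0 = (lam : ℂ) / 8 := by
  rw [schurCoeff, hφ.resNS_zero_zero_Hg, inner_self_ofReal, hφ.norm_sq_Hg h]
  push_cast
  rfl

lemma norm_schurCoeff_le (hφ : π.IsSpherical φ) (h : π.HasCasimirScalar lam) (hlam : 0 < lam)
    (hx : ‖x‖ * C < 1) (hx2 : ‖x‖ ^ 2 * (lam + 6) ≤ 1) (hζ : ζ.re ≤ 1 / 2) :
    ‖π.schurCoeff hR φ x ζ‖ ≤ 5 / 16 * lam := by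
  have h1 := norm_inner_le_norm (𝕜 := ℂ) (π.dpi Hg φ : V) (π.resNS hR x ζ (π.dpi Hg φ))
  have h2 := π.norm_resNS_le hR h hlam hx hx2 hζ (π.dpi Hg φ)
  have h3 := hφ.norm_sq_Hg h
  have h4 := mul_le_mul_of_nonneg_left h2 (norm_nonneg (π.dpi Hg φ : V))
  rw [schurCoeff]
  linarith

/-- `25/32 = (5/2)² · (1/8)`: two resolvent bounds, `‖Hφ‖² = λ/8`, and `‖x‖²λ ≤ 1`. By the resolvent
identity this is the contraction constant; with `η = ζ` it gives simplicity. -/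
lemma norm_inner_resNS_resNS_le (hφ : π.IsSpherical φ) (h : π.HasCasimirScalar lam)
    (hlam : 0 < lam) (hx : ‖x‖ * C < 1) (hx2 : ‖x‖ ^ 2 * (lam + 6) ≤ 1) {η : ℂ}
    (hζ : ζ.re ≤ 1 / 2) (hη : η.re ≤ 1 / 2) :
    ‖x ^ 2 * ⟪(π.dpi Hg φ : V), π.resNS hR x ζ (π.resNS hR x η (π.dpi Hg φ))⟫_ℂ‖ ≤ 25 / 32 := by
  have h1 := norm_inner_le_norm (𝕜 := ℂ) (π.dpi Hg φ : V)
    (π.resNS hR x ζ (π.resNS hR x η (π.dpi Hg φ)))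
  have h2 := π.norm_resNS_le hR h hlam hx hx2 hη (π.dpi Hg φ)
  have h3 := π.norm_resNS_le hR h hlam hx hx2 hζ (π.resNS hR x η (π.dpi Hg φ))
  have h4 := hφ.norm_sq_Hg h
  have h5 := mul_le_mul_of_nonneg_left (h3.trans (mul_le_mul_of_nonneg_left h2 (by norm_num)))
    (norm_nonneg (π.dpi Hg φ : V))
  rw [norm_mul, norm_pow]
  have h6 : ‖x‖ ^ 2 * (25 / 4 * (lam / 8)) ≤ 25 / 32 := by nlinarith [sq_nonneg ‖x‖]
  refine (mul_le_mul_of_nonneg_left (h1.trans (h5.trans (le_of_eq ?_))) (sq_nonneg _)).trans h6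
  rw [← h4]
  ring

/-- The low-lying eigenvalue, for a representation with a spherical vector. -/
theorem exists_eigenvalue (hφ : π.IsSpherical φ) (h : π.HasCasimirScalar lam) (hlam : 0 < lam)
    {r : ℝ} (hr : 0 < r) (hr2 : r ^ 2 * (lam + 6) = 1) :
    ∃ μ : ℂ → ℂ, DifferentiableOn ℂ μ (Metric.ball 0 r) ∧
      ∀ x ∈ Metric.ball (0 : ℂ) r, IsSimpleEigenvalue (π.T x) (μ x) ∧ ‖μ x‖ ≤ 1 / 2 ∧
        spec (π.T x) ∩ {ζ : ℂ | ζ.re ≤ 1 / 2} = {μ x} ∧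
        ‖μ x - (lam : ℂ) / 8 * x ^ 2‖ ≤ ‖x‖ ^ 3 / (2 * r ^ 2 * (r - ‖x‖)) := by
  have hR := π.relBounded h le_rfl hlam.le
  have hx2 : ∀ x ∈ Metric.ball (0 : ℂ) r, ‖x‖ ^ 2 * (lam + 6) ≤ 1 := fun x hx => by
    rw [mem_ball_zero_iff] at hx
    rw [← hr2]
    gcongr
  have hx1 : ∀ x ∈ Metric.ball (0 : ℂ) r, ‖x‖ * Real.sqrt (lam + 4) < 1 := fun x hx => by
    refine lt_of_pow_lt_pow_left₀ 2 zero_le_one ?_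
    rw [mul_pow, Real.sq_sqrt (by linarith)]
    rcases eq_or_lt_of_le (sq_nonneg ‖x‖) with h0 | h0
    · rw [← h0]; norm_num
    · nlinarith [hx2 x hx]
  have hdiff : ∀ f : ℂ → ℂ, DifferentiableOn ℂ f (Metric.ball 0 r) →
      (∀ x ∈ Metric.ball (0 : ℂ) r, (f x).re ≤ 1 / 2) →
      DifferentiableOn ℂ (fun x => π.schurCoeff hR φ x (f x)) (Metric.ball 0 r) := fun f hf hf2 =>
    π.differentiableOn_inner_resNS hR hf (fun x hx => ⟨hx1 x hx, hf2 x hx⟩) _ _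
  obtain ⟨μ, hμ, hμ2⟩ : ∃ μ : ℂ → ℂ, DifferentiableOn ℂ μ (Metric.ball 0 r) ∧
      ∀ x ∈ Metric.ball (0 : ℂ) r, ‖μ x‖ ≤ 1 / 2 ∧ x ^ 2 * π.schurCoeff hR φ x (μ x) = μ x ∧
        ∀ ζ, ζ.re ≤ 1 / 2 → x ^ 2 * π.schurCoeff hR φ x ζ = ζ → ζ = μ x := by
    refine exists_differentiableOn_fixedPoint (κ := 25 / 32) Metric.isOpen_ball
      (fun x ζ => x ^ 2 * π.schurCoeff hR φ x ζ) (by norm_num) (by norm_num) ?_ ?_ ?_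
    · intro x hx ζ hζ
      have h4 := hφ.norm_schurCoeff_le (hR := hR) h hlam (hx1 x hx) (hx2 x hx) hζ
      rw [norm_mul, norm_pow]
      have h5 := mul_le_mul_of_nonneg_left h4 (sq_nonneg ‖x‖)
      nlinarith [hx2 x hx, sq_nonneg ‖x‖]
    · intro x hx ζ η hζ hη
      have h4 := hφ.norm_inner_resNS_resNS_le (hR := hR) h hlam (hx1 x hx) (hx2 x hx) hζ hη
      have h5 := π.resNS_sub_resNS hR (hx1 x hx) hζ hη (π.dpi Hg φ)
      have h6 : x ^ 2 * π.schurCoeff hR φ x ζ - x ^ 2 * π.schurCoeff hR φ x η = (ζ - η) *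
          (x ^ 2 * ⟪(π.dpi Hg φ : V), π.resNS hR x ζ (π.resNS hR x η (π.dpi Hg φ))⟫_ℂ) := by
        rw [← mul_sub, schurCoeff, schurCoeff, ← inner_sub_right, h5, inner_smul_right]
        ring
      rw [h6, norm_mul, mul_comm]
      gcongr
    · intro f hf hf2
      exact (differentiableOn_id.pow 2).mul (hdiff f hf hf2)
  have hre : ∀ x ∈ Metric.ball (0 : ℂ) r, (μ x).re ≤ 1 / 2 := fun x hx =>
    (Complex.re_le_norm _).trans (hμ2 x hx).1
  refine ⟨μ, hμ, fun x hx => ?_⟩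
  obtain ⟨h1, h2, h3⟩ := hμ2 x hx
  refine ⟨hφ.isSimpleEigenvalue (hx1 x hx) (hre x hx) h2
    ((hφ.norm_inner_resNS_resNS_le h hlam (hx1 x hx) (hx2 x hx) (hre x hx) (hre x hx)).trans_lt
      (by norm_num)), h1, ?_, ?_⟩
  · refine Set.Subset.antisymm ?_ ?_
    · rintro ζ ⟨hs, hζ⟩
      refine h3 ζ hζ ?_
      by_contra hne
      exact hs (hφ.mem_resolventSet (hx1 x hx) hζ hne)
    · rintro _ rfl
      exact ⟨hφ.mem_spec (hx1 x hx) (hre x hx) h2, hre x hx⟩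
  · set g : ℂ → ℂ := fun x => π.schurCoeff hR φ x (μ x) with hg
    have hμ0 : μ 0 = 0 := by
      have := (hμ2 0 (Metric.mem_ball_self hr)).2.1
      rw [← this]; simp
    have hg0 : g 0 = (lam : ℂ) / 8 := by rw [hg]; simp only [hμ0]; exact hφ.schurCoeff_zero_zero h
    have hg0n : ‖g 0‖ = lam / 8 := by
      rw [hg0, norm_div, Complex.norm_real, Real.norm_of_nonneg hlam.le]; norm_num
    -- The oscillation is at most `(5/16 + 1/8)λ`, below `(λ + 6)/2 = 1/(2r²)`; the Schwarz lemma
    -- then gains the factor `‖x‖/r`.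
    have hmaps : Set.MapsTo g (Metric.ball 0 r) (Metric.closedBall (g 0) (1 / (2 * r ^ 2))) := by
      intro y hy
      have h4 := hφ.norm_schurCoeff_le (hR := hR) h hlam (hx1 y hy) (hx2 y hy) (hre y hy)
      have h5 : 1 / (2 * r ^ 2) = (lam + 6) / 2 := by
        rw [← hr2]; field_simp
      rw [mem_closedBall_iff_norm, h5]
      refine (norm_sub_le _ _).trans ?_
      rw [hg0n]
      linarith
    have hdist := Complex.dist_le_div_mul_dist_of_mapsTo_ball (hdiff μ hμ hre) hmaps hx
    rw [dist_eq_norm, dist_zero_right] at hdist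
    replace hdist : ‖g x - g 0‖ ≤ 1 / (2 * r ^ 2) / r * ‖x‖ := hdist
    rw [hg0] at hdist
    have hxr : ‖x‖ < r := mem_ball_zero_iff.1 hx
    have h6 : μ x - (lam : ℂ) / 8 * x ^ 2 = x ^ 2 * (g x - (lam : ℂ) / 8) := by
      rw [← h2]; ring
    rw [h6, norm_mul, norm_pow]
    calc ‖x‖ ^ 2 * ‖g x - (lam : ℂ) / 8‖ ≤ ‖x‖ ^ 2 * (1 / (2 * r ^ 2) / r * ‖x‖) := by gcongr
      _ = ‖x‖ ^ 3 / (2 * r ^ 2 * r) := by field_simp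
      -- The Schwarz lemma gives the sharper denominator `2r³`; replacing `r` by `r - ‖x‖` weakens
      -- it to the stated form.
      _ ≤ ‖x‖ ^ 3 / (2 * r ^ 2 * (r - ‖x‖)) := by
        have : 0 < r - ‖x‖ := sub_pos.2 hxr
        gcongr
        linarith [norm_nonneg x]

end IsSpherical

lemma exists_isSpherical (π : UnitaryRep V) {lam : ℝ} (h : π.HasCasimirScalar lam) (hlam : 0 < lam)
    (hirr : π.IsIrreducible) : ∃ φ, π.IsSpherical φ := by
  have := hirr.1
  obtain ⟨φ, h1, h2⟩ := π.exists_spherical h hlam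
  exact ⟨φ, h1, h2, π.projK_zero_eq h hlam hirr h2 h1⟩

lemma half_lt_re_of_mem_spec (π : UnitaryRep V) {lam : ℝ} (h : π.HasCasimirScalar lam)
    (hlam : lam ≤ 0) (hirr : π.IsIrreducible) (hnt : ¬ π.IsTrivial) {x ζ : ℂ}
    (hx : ‖x‖ * 2 < 1) (hζ : ζ ∈ spec (π.T x)) : 1 / 2 < ζ.re := by
  by_contra! hre
  have h4 : Real.sqrt (0 + 4) = 2 := by
    rw [show (0 + 4 : ℝ) = 2 ^ 2 by norm_num, Real.sqrt_sq (by norm_num)]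
  exact hζ (π.mem_resolventSet_of_projK_zero (π.relBounded h hlam le_rfl)
    (π.projK_zero_eq_zero h hlam hirr hnt) (by rw [h4]; exact hx) hre)

end UnitaryRep

end Eigenvalue

end KineticBrownian

end

theorem theorem3p5 {V : Type*} [NormedAddCommGroup V] [InnerProductSpace ℂ V] [CompleteSpace V]
    (π : KineticBrownian.UnitaryRep V) :
    (∀ lam r : ℝ, ((∃ s, π.IsPrincipalSeries s) ∨ (∃ s, π.IsComplementarySeries s)) →
      π.HasCasimirScalar lam → r = (lam + 6) ^ (-(1 / 2) : ℝ) →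
      ∃ μ : ℂ → ℂ, DifferentiableOn ℂ μ (Metric.ball 0 r) ∧
        (∀ x ∈ Metric.ball (0 : ℂ) r,
          KineticBrownian.IsSimpleEigenvalue (π.T x) (μ x) ∧
          ‖μ x‖ ≤ 1 / 2 ∧
          KineticBrownian.spec (π.T x) ∩ {ζ : ℂ | ζ.re ≤ 1 / 2} = {μ x} ∧
          ‖μ x - (lam : ℂ) / 8 * x ^ 2‖ ≤ ‖x‖ ^ 3 / (2 * r ^ 2 * (r - ‖x‖)))) ∧
    (∀ n : ℕ, π.IsDiscreteSeries n → ∀ x : ℂ, ‖x‖ < 1 / Real.sqrt 32 →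
      ∀ ζ ∈ KineticBrownian.spec (π.T x), 1 / 2 < ζ.re) := by
  refine ⟨fun lam r hπ h hr => ?_, fun n ⟨hn, hirr, hnt, h⟩ x hx ζ hζ => ?_⟩
  · have hirr : π.IsIrreducible := by
      rcases hπ with ⟨s, hs⟩ | ⟨s, hs⟩
      exacts [hs.1, hs.2.2.1]
    have := hirr.1
    have hlam : 0 < lam := by
      rcases hπ with ⟨s, hs⟩ | ⟨s, hs⟩
      · rw [π.hasCasimirScalar_unique h hs.2]
        positivity
      · rw [π.hasCasimirScalar_unique h hs.2.2.2]
        nlinarith [hs.1.1, hs.1.2]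
    obtain ⟨φ, hφ⟩ := π.exists_isSpherical h hlam hirr
    have h6 : 0 < lam + 6 := by linarith
    refine hφ.exists_eigenvalue h hlam (hr ▸ Real.rpow_pos_of_pos h6 _) ?_
    rw [hr, ← Real.rpow_natCast, ← Real.rpow_mul h6.le]
    norm_num
    rw [Real.rpow_neg_one, inv_mul_cancel₀ h6.ne']
  · have hn' : (1 : ℝ) ≤ n := by exact_mod_cast hn
    refine π.half_lt_re_of_mem_spec h (by nlinarith) hirr hnt ?_ hζ
    -- With `L = 0` the relative bound is `√4 = 2`, so `‖x‖ < 1/2` suffices.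
    have h5 : (2 : ℝ) < Real.sqrt 32 := by
      rw [Real.lt_sqrt (by norm_num)]; norm_num
    rw [lt_div_iff₀ (by linarith)] at hx
    nlinarith [norm_nonneg x]
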